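/- Let $p$ be a prime and let $F\in\mathbb{Q}_p[X]$ be a polynomial of degree $6$ with roots $\theta_1,\dots,\theta_6\in\overline{\mathbb{Q}}_p$ (listed with multiplicity). Assume that the roots lie in the complement of the $E_6$ hyperplane arrangement, i.e. that $\theta_i-\theta_j\neq 0$ for $i<j$, $\theta_i+\theta_j+\theta_k\neq 0$ for $i<j<k$, and $\theta_1+\cdots+\theta_6\neq 0$. Let $V$ be the space of ternary cubic forms over $\overline{\mathbb{Q}}_p$ vanishing at the six points $(1:\theta_i:\theta_i^3)\in\mathbb{P}^2$. Then $V$ has a basis $f_0,\dots,f_3$ consisting of four forms with coefficients in $\mathbb{Q}_p$. For every such basis, let $\mathrm{Bl}\subset\mathbb{P}^2\times\mathbb{P}^3$ be the Zariski closure of the graph of the rational map $(f_0:f_1:f_2:f_3)\colon\mathbb{P}^2\dashrightarrow\mathbb{P}^3$ over $\overline{\mathbb{Q}}_p$ (this is the blow-up of $\mathbb{P}^2$ at the six points), and let $\mathcal{S}(F)\subset\mathbb{P}^3$ be the image of $\mathrm{Bl}$ under the second projection. Then this projection is injective on $\mathrm{Bl}$; the image $\mathcal{S}(F)$ is a smooth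 cubic surface defined over $\mathbb{Q}_p$, i.e. the zero locus of a cubic form with coefficients in $\mathbb{Q}_p$ that has no singular point over $\overline{\mathbb{Q}}_p$; and $\mathcal{S}(F)$ contains exactly $$2\ell+q+\binom{\ell}{2}$$ lines of $\mathbb{P}^3$ that are defined over $\mathbb{Q}_p$, where $\ell$ and $q$ are the numbers of linear and quadratic irreducible factors of $F$ in $\mathbb{Q}_p[X]$, respectively. -/

import Mathlib

open Polynomial
open scoped LinearAlgebra.Projectivization

/-- The six parameters `θ i` lie in the complement of the hyperplane arrangement of type `E6`. -/
structure AvoidsE6 {L : Type*} [Field L] (θ : Fin 6 → L) : Prop where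
  sub_ne_zero : ∀ i j, i < j → θ i - θ j ≠ 0
  add_add_ne_zero : ∀ i j k, i < j → j < k → θ i + θ j + θ k ≠ 0
  sum_ne_zero : ∑ i, θ i ≠ 0

/-- Homogeneous coordinates of the point `(1 : t : t ^ 3)` of the cuspidal cubic curve. -/
def cuspPoint {L : Type*} [Field L] (t : L) : Fin 3 → L := ![1, t, t ^ 3]

/-- The space of ternary cubic forms over `L` that vanish at the six points
`(1 : θ i : θ i ^ 3)`. -/
noncomputable def cubicsThrough {L : Type*} [Field L] (θ : Fin 6 → L) :
    Submodule L (MvPolynomial (Fin 3) L) :=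
  MvPolynomial.homogeneousSubmodule (Fin 3) L 3 ⊓
    ⨅ i, LinearMap.ker (MvPolynomial.aeval (R := L) (cuspPoint (θ i))).toLinearMap

/-- The forms `f j`, with their coefficients regarded as elements of the extension field `L`. -/
noncomputable def extendScalars {K : Type*} (L : Type*) [Field K] [Field L] [Algebra K L]
    (f : Fin 4 → MvPolynomial (Fin 3) K) (j : Fin 4) : MvPolynomial (Fin 3) L :=
  MvPolynomial.map (algebraMap K L) (f j)

/-- `f` consists of four cubic forms with coefficients in the subfield `K` which form an `L`-basis
of the space of all cubic forms over `L` through the six points. -/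
structure IsRationalBasis {K L : Type*} [Field K] [Field L] [Algebra K L] (θ : Fin 6 → L)
    (f : Fin 4 → MvPolynomial (Fin 3) K) : Prop where
  linearIndependent : LinearIndependent L (extendScalars L f)
  span_eq : Submodule.span L (Set.range (extendScalars L f)) = cubicsThrough θ

/-- The polynomial `h`, in two groups of variables, vanishes at the point `z` of a product of two
projective spaces, i.e. at all pairs of coordinate vectors of `z`. Over an infinite field this
means that every bihomogeneous component of `h` vanishes at `z`. -/
def VanishesAt {L : Type*} [Field L] {m n : ℕ} (h : MvPolynomial (Fin m ⊕ Fin n) L)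
    (z : ℙ L (Fin m → L) × ℙ L (Fin n → L)) : Prop :=
  ∀ (u : Fin m → L) (hu : u ≠ 0) (v : Fin n → L) (hv : v ≠ 0),
    (Projectivization.mk L u hu, Projectivization.mk L v hv) = z →
      MvPolynomial.eval (Sum.elim u v) h = 0

/-- The Zariski closure of a subset of a product of two projective spaces over an infinite
field. -/
def biprojectiveClosure {L : Type*} [Field L] {m n : ℕ}
    (A : Set (ℙ L (Fin m → L) × ℙ L (Fin n → L))) :
    Set (ℙ L (Fin m → L) × ℙ L (Fin n → L)) :=
  {z | ∀ h : MvPolynomial (Fin m ⊕ Fin n) L, (∀ w ∈ A, VanishesAt h w) → VanishesAt h z}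

/-- The graph of the rational map `x ↦ (f 0 x : f 1 x : f 2 x : f 3 x)` from the projective plane
to projective three-space, over the open set where the `f j` do not all vanish. -/
def rationalMapGraph {L : Type*} [Field L] (f : Fin 4 → MvPolynomial (Fin 3) L) :
    Set (ℙ L (Fin 3 → L) × ℙ L (Fin 4 → L)) :=
  {z | ∃ (u : Fin 3 → L) (hu : u ≠ 0) (hv : (fun j => MvPolynomial.eval u (f j)) ≠ 0),
    z = (Projectivization.mk L u hu, Projectivization.mk L _ hv)}

/-- The blow-up of the projective plane along the ideal generated by the cubic forms `f j`: the
closure of the graph of the rational map they define. If the `f j` are a basis of the cubic forms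
through six points in general position, they generate the homogeneous ideal of the six points, and
this is the blow-up of the plane at the six points. -/
def blowUp {L : Type*} [Field L] (f : Fin 4 → MvPolynomial (Fin 3) L) :
    Set (ℙ L (Fin 3 → L) × ℙ L (Fin 4 → L)) :=
  biprojectiveClosure (rationalMapGraph f)

/-- The surface in projective three-space which is the image of the blow-up under the morphism
given by the cubic forms `f j`. -/
def blowUpSurface {L : Type*} [Field L] (f : Fin 4 → MvPolynomial (Fin 3) L) :
    Set (ℙ L (Fin 4 → L)) :=
  Prod.snd '' blowUp f

/-- `S` is a smooth cubic surface over `L` defined over `K`: the zero locus of a cubic form with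
coefficients in `K` that has no singular zero over `L`. (Here `L` is meant to be algebraically
closed.) -/
def IsSmoothCubicSurfaceOver (K : Type*) {L : Type*} [Field K] [Field L] [Algebra K L]
    (S : Set (ℙ L (Fin 4 → L))) : Prop :=
  ∃ g : MvPolynomial (Fin 4) K, g.IsHomogeneous 3 ∧
    (∀ (v : Fin 4 → L) (hv : v ≠ 0),
      Projectivization.mk L v hv ∈ S ↔ MvPolynomial.aeval v g = 0) ∧
    ∀ v : Fin 4 → L, v ≠ 0 → MvPolynomial.aeval v g = 0 →
      ∃ k, MvPolynomial.aeval v (MvPolynomial.pderiv k g) ≠ 0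

/-- The `K`-rational lines on `S`: the lines of projective three-space over `L`, given as
two-dimensional linear subspaces of `L ^ 4`, that are contained in `S` and are defined over `K`,
i.e. are spanned by a linear subspace of `K ^ 4`. -/
def rationalLines (K : Type*) {L : Type*} [Field K] [Field L] [Algebra K L]
    (S : Set (ℙ L (Fin 4 → L))) : Set (Submodule L (Fin 4 → L)) :=
  {W | Module.finrank L W = 2 ∧
    (∀ (v : Fin 4 → L) (hv : v ≠ 0), v ∈ W → Projectivization.mk L v hv ∈ S) ∧
    ∃ W₀ : Submodule K (Fin 4 → K),
      W = Submodule.span L ((fun w j => algebraMap K L (w j)) '' (W₀ : Set (Fin 4 → K)))}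

open Classical in
/-- The number of irreducible factors of degree `d` of a nonzero polynomial over a field, counted
with multiplicity. -/
noncomputable def numIrreducibleFactors {K : Type*} [Field K] (F : K[X]) (d : ℕ) :
    ℕ :=
  ((UniqueFactorizationMonoid.normalizedFactors F).filter fun P => P.natDegree = d).card

open scoped Matrix

/-! Write M(v) for `syzMatrix e v`, linear in v, and N(u) for the 3 by 4 matrix, linear in u, with
N(u) v = M(v) u. This is a Hilbert-Burch presentation of the six points: up to sign the maximal
minors of N(u) are `e 0` times the four cubics `cubicMap e u`. The coefficient `e 0` is the sum of
the roots; it is nonzero exactly when the six points lie on no conic. Hence the blow-up is the set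
of pairs (u, v) with M(v) u = 0, and its image is the determinantal surface det M(v) = 0, with all
coefficients in the base field. Any other rational basis changes this by an invertible matrix over
the base field.

If M(v) had rank at most 1 for some v ≠ 0, the sextic would split into two cubics, one without
quadratic term, so three roots would sum to zero (`eq_zero_of_adjugate`). So kernels are
one-dimensional, which gives injectivity. At a singular point the left and right kernels of M(v)
would both belong to one base point, which is impossible for a simple root
(`eq_zero_of_leftPoint_of_cuspPoint`, `eq_zero_of_trace_adjugate_mul`).

A line on the surface is a singular pencil of 3 by 3 matrices. Kronecker's classification
(`singular_pencil_trichotomy`) leaves three types: a constant right kernel gives an exceptional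
line, a kernel of degree one gives the image of a chord through two base points, a constant left
kernel gives the image of a conic through five. The set of exceptional lines that a line meets has
size 1, 2 or 5 respectively; it determines the line, and every subset of these sizes occurs
(`incidence_injOn`, `exists_incidence_eq`), which accounts for 6 + 15 + 6 = 27 lines.

This labelling is Galois equivariant, so a line is rational exactly when its set of indices is
Galois stable (`isRationalSubspace_iff`). Stable singletons are the linear factors, stable 5-sets
their complements, and a stable pair is a quadratic factor or two rational roots (`encard_stable`).
-/

/-! ### Explicit cubics through the six points and their linear syzygies. -/

/-- The value at `t` of the monic sextic with signed coefficients `e`. -/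
def sextic {R : Type*} [CommRing R] (e : Fin 6 → R) (t : R) : R :=
  t ^ 6 - e 0 * t ^ 5 + e 1 * t ^ 4 - e 2 * t ^ 3 + e 3 * t ^ 2 - e 4 * t + e 5

/-- The value at `t` of the derivative of the monic sextic with signed coefficients `e`. -/
def sexticDeriv {R : Type*} [CommRing R] (e : Fin 6 → R) (t : R) : R :=
  6 * t ^ 5 - 5 * e 0 * t ^ 4 + 4 * e 1 * t ^ 3 - 3 * e 2 * t ^ 2 + 2 * e 3 * t - e 4

/-- Four cubic forms through the six points of the cuspidal cubic whose parameters are the roots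
of `sextic e`: the equation of the cuspidal cubic itself, and three cubics that restrict to
`sextic e t`, `t * sextic e t` and `(t ^ 3 + e 0 * t ^ 2) * sextic e t` on it. -/
def cubicMap {R : Type*} [CommRing R] (e : Fin 6 → R) (u : Fin 3 → R) : Fin 4 → R :=
  ![u 0 ^ 2 * u 2 - u 1 ^ 3,
    u 0 * u 2 ^ 2 - e 0 * u 1 ^ 2 * u 2 + e 1 * u 0 * u 1 * u 2 - e 2 * u 0 ^ 2 * u 2
      + e 3 * u 0 * u 1 ^ 2 - e 4 * u 0 ^ 2 * u 1 + e 5 * u 0 ^ 3,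
    u 1 * u 2 ^ 2 - e 0 * u 0 * u 2 ^ 2 + e 1 * u 1 ^ 2 * u 2 - e 2 * u 0 * u 1 * u 2
      + e 3 * u 0 ^ 2 * u 2 - e 4 * u 0 * u 1 ^ 2 + e 5 * u 0 ^ 2 * u 1,
    u 2 ^ 3 + (e 1 - e 0 ^ 2) * u 1 * u 2 ^ 2 + (e 0 * e 1 - e 2) * u 0 * u 2 ^ 2
      + (e 3 - e 0 * e 2) * u 1 ^ 2 * u 2 + (e 0 * e 3 - e 4) * u 0 * u 1 * u 2
      + (e 5 - e 0 * e 4) * u 0 ^ 2 * u 2 + e 0 * e 5 * u 0 * u 1 ^ 2]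

/-- The derivative of `cubicMap e` at `u` in the direction `w`. -/
def cubicDeriv {R : Type*} [CommRing R] (e : Fin 6 → R) (u w : Fin 3 → R) : Fin 4 → R :=
  ![2 * u 0 * u 2 * w 0 - 3 * u 1 ^ 2 * w 1 + u 0 ^ 2 * w 2,
    (u 2 ^ 2 + e 1 * u 1 * u 2 - 2 * e 2 * u 0 * u 2 + e 3 * u 1 ^ 2 - 2 * e 4 * u 0 * u 1
        + 3 * e 5 * u 0 ^ 2) * w 0
      + (-2 * e 0 * u 1 * u 2 + e 1 * u 0 * u 2 + 2 * e 3 * u 0 * u 1 - e 4 * u 0 ^ 2) * w 1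
      + (2 * u 0 * u 2 - e 0 * u 1 ^ 2 + e 1 * u 0 * u 1 - e 2 * u 0 ^ 2) * w 2,
    (- e 0 * u 2 ^ 2 - e 2 * u 1 * u 2 + 2 * e 3 * u 0 * u 2 - e 4 * u 1 ^ 2
        + 2 * e 5 * u 0 * u 1) * w 0
      + (u 2 ^ 2 + 2 * e 1 * u 1 * u 2 - e 2 * u 0 * u 2 - 2 * e 4 * u 0 * u 1
        + e 5 * u 0 ^ 2) * w 1
      + (2 * u 1 * u 2 - 2 * e 0 * u 0 * u 2 + e 1 * u 1 ^ 2 - e 2 * u 0 * u 1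
        + e 3 * u 0 ^ 2) * w 2,
    ((e 0 * e 1 - e 2) * u 2 ^ 2 + (e 0 * e 3 - e 4) * u 1 * u 2
        + 2 * (e 5 - e 0 * e 4) * u 0 * u 2 + e 0 * e 5 * u 1 ^ 2) * w 0
      + ((e 1 - e 0 ^ 2) * u 2 ^ 2 + 2 * (e 3 - e 0 * e 2) * u 1 * u 2
        + (e 0 * e 3 - e 4) * u 0 * u 2 + 2 * e 0 * e 5 * u 0 * u 1) * w 1
      + (3 * u 2 ^ 2 + 2 * (e 1 - e 0 ^ 2) * u 1 * u 2 + 2 * (e 0 * e 1 - e 2) * u 0 * u 2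
        + (e 3 - e 0 * e 2) * u 1 ^ 2 + (e 0 * e 3 - e 4) * u 0 * u 1
        + (e 5 - e 0 * e 4) * u 0 ^ 2) * w 2]

/-- The matrix of the three linear syzygies of `cubicMap e`: its rows, paired with `u`, are linear
in `u` and in `v`, and vanish for `v = cubicMap e u`. -/
def syzMatrix {R : Type*} [CommRing R] (e : Fin 6 → R) (v : Fin 4 → R) :
    Matrix (Fin 3) (Fin 3) R :=
  !![v 2 - e 3 * v 0, - v 1, e 0 * v 0;
    v 3 + e 0 * e 4 * v 0, - e 0 * v 2, - v 1 - e 0 * e 1 * v 0;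
    e 0 * e 5 * v 0, v 3, - v 2 - e 0 * v 1 - (e 0 * e 2 - e 3) * v 0]

section Ring

variable {R : Type*} [CommRing R] (e : Fin 6 → R)

theorem map_cubicMap {S : Type*} [CommRing S] (φ : R →+* S) (u : Fin 3 → R) (j : Fin 4) :
    φ (cubicMap e u j) = cubicMap (φ ∘ e) (φ ∘ u) j := by
  fin_cases j <;> simp [cubicMap]

theorem map_syzMatrix {S : Type*} [CommRing S] (φ : R →+* S) (v : Fin 4 → R) (i j : Fin 3) :
    φ (syzMatrix e v i j) = syzMatrix (φ ∘ e) (φ ∘ v) i j := by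
  fin_cases i <;> fin_cases j <;> simp [syzMatrix]

theorem syzMatrix_add (v w : Fin 4 → R) :
    syzMatrix e (v + w) = syzMatrix e v + syzMatrix e w := by
  ext i j
  fin_cases i <;> fin_cases j <;> simp [syzMatrix] <;> ring

theorem syzMatrix_smul (a : R) (v : Fin 4 → R) :
    syzMatrix e (a • v) = a • syzMatrix e v := by
  ext i j
  fin_cases i <;> fin_cases j <;> simp [syzMatrix] <;> ring

@[simp]
theorem syzMatrix_zero : syzMatrix e 0 = 0 := by
  simpa using syzMatrix_smul e 0 0

theorem syzMatrix_apply_eq_sum (v : Fin 4 → R) (i j : Fin 3) :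
    syzMatrix e v i j = ∑ k, v k * syzMatrix e (Pi.single k 1) i j := by
  fin_cases i <;> fin_cases j <;> simp [syzMatrix, Fin.sum_univ_four] <;> ring

theorem cubicMap_smul (a : R) (u : Fin 3 → R) : cubicMap e (a • u) = a ^ 3 • cubicMap e u := by
  ext j
  fin_cases j <;> simp [cubicMap] <;> ring

theorem cubicDeriv_smul_left (a : R) (u w : Fin 3 → R) :
    cubicDeriv e (a • u) w = a ^ 2 • cubicDeriv e u w := by
  ext j
  fin_cases j <;> simp [cubicDeriv] <;> ring

theorem cubicDeriv_smul_right (a : R) (u w : Fin 3 → R) :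
    cubicDeriv e u (a • w) = a • cubicDeriv e u w := by
  ext j
  fin_cases j <;> simp [cubicDeriv] <;> ring

theorem cubicMap_add_smul (a : R) (u w : Fin 3 → R) :
    cubicMap e (u + a • w) =
      cubicMap e u + a • cubicDeriv e u w + a ^ 2 • cubicDeriv e w u + a ^ 3 • cubicMap e w := by
  ext j
  fin_cases j <;> simp [cubicMap, cubicDeriv] <;> ring

theorem syzMatrix_cubicMap_mulVec (u : Fin 3 → R) :
    (syzMatrix e (cubicMap e u)).mulVec u = 0 := by
  ext j
  fin_cases j <;> simp [cubicMap, syzMatrix, Matrix.mulVec, dotProduct, Fin.sum_univ_three] <;> ring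

/-- This is `syzMatrix_cubicMap_mulVec` differentiated in the direction `w`. -/
theorem syzMatrix_cubicDeriv_mulVec (u w : Fin 3 → R) :
    (syzMatrix e (cubicDeriv e u w)).mulVec u + (syzMatrix e (cubicMap e u)).mulVec w = 0 := by
  ext j
  fin_cases j <;>
    simp [cubicMap, cubicDeriv, syzMatrix, dotProduct, Fin.sum_univ_three] <;> ring

/-- Cramer's rule for the three syzygies. -/
theorem cubicMap_mul_eq (u : Fin 3 → R) (v : Fin 4 → R) (h : (syzMatrix e v).mulVec u = 0)
    (j k : Fin 4) : e 0 * (cubicMap e u j * v k) = e 0 * (cubicMap e u k * v j) := by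
  have h0 := congrFun h 0
  have h1 := congrFun h 1
  have h2 := congrFun h 2
  simp [syzMatrix, Matrix.mulVec, dotProduct, Fin.sum_univ_three] at h0 h1 h2
  -- With N(u) v = M(v) u = 0, the dot product with the cross product of the two columns of N(u)
  -- other than j and k leaves only `v j` and `v k`. Their coefficients are maximal minors, that is
  -- ± `e 0` times the cubics.
  have h01 : e 0 * (cubicMap e u 0 * v 1) = e 0 * (cubicMap e u 1 * v 0) := by
    simp [cubicMap]
    linear_combination -(((-e 0 * u 1) * u 1 - (-u 2) * u 0) * h0 + ((-u 2) * 0 - u 0 * u 1) * h1 + (u 0 * u 0 - (-e 0 * u 1) * 0) * h2)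
  have h02 : e 0 * (cubicMap e u 0 * v 2) = e 0 * (cubicMap e u 2 * v 0) := by
    simp [cubicMap]
    linear_combination ((-u 2) * u 1 - (-e 0 * u 2) * u 0) * h0 + ((-e 0 * u 2) * 0 - (-u 1) * u 1) * h1 + ((-u 1) * u 0 - (-u 2) * 0) * h2
  have h03 : e 0 * (cubicMap e u 0 * v 3) = e 0 * (cubicMap e u 3 * v 0) := by
    simp [cubicMap]
    linear_combination -(((-u 2) * (-u 2) - (-e 0 * u 2) * (-e 0 * u 1)) * h0 + ((-e 0 * u 2) * u 0 - (-u 1) * (-u 2)) * h1 + ((-u 1) * (-e 0 * u 1) - (-u 2) * u 0) * h2)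
  have h12 : e 0 * (cubicMap e u 1 * v 2) = e 0 * (cubicMap e u 2 * v 1) := by
    simp [cubicMap]
    linear_combination -(((e 0 * e 4 * u 0 - e 0 * e 1 * u 2) * u 1 - (e 0 * e 5 * u 0 - (e 0 * e 2 - e 3) * u 2) * u 0) * h0 + ((e 0 * e 5 * u 0 - (e 0 * e 2 - e 3) * u 2) * 0 - (e 0 * u 2 - e 3 * u 0) * u 1) * h1 + ((e 0 * u 2 - e 3 * u 0) * u 0 - (e 0 * e 4 * u 0 - e 0 * e 1 * u 2) * 0) * h2)
  have h13 : e 0 * (cubicMap e u 1 * v 3) = e 0 * (cubicMap e u 3 * v 1) := by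
    simp [cubicMap]
    linear_combination ((e 0 * e 4 * u 0 - e 0 * e 1 * u 2) * (-u 2) - (e 0 * e 5 * u 0 - (e 0 * e 2 - e 3) * u 2) * (-e 0 * u 1)) * h0 + ((e 0 * e 5 * u 0 - (e 0 * e 2 - e 3) * u 2) * u 0 - (e 0 * u 2 - e 3 * u 0) * (-u 2)) * h1 + ((e 0 * u 2 - e 3 * u 0) * (-e 0 * u 1) - (e 0 * e 4 * u 0 - e 0 * e 1 * u 2) * u 0) * h2
  have h23 : e 0 * (cubicMap e u 2 * v 3) = e 0 * (cubicMap e u 3 * v 2) := by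
    simp [cubicMap]
    linear_combination -(((e 0 * e 4 * u 0 - e 0 * e 1 * u 2) * (-e 0 * u 2) - (e 0 * e 5 * u 0 - (e 0 * e 2 - e 3) * u 2) * (-u 2)) * h0 + ((e 0 * e 5 * u 0 - (e 0 * e 2 - e 3) * u 2) * (-u 1) - (e 0 * u 2 - e 3 * u 0) * (-e 0 * u 2)) * h1 + ((e 0 * u 2 - e 3 * u 0) * (-u 2) - (e 0 * e 4 * u 0 - e 0 * e 1 * u 2) * (-u 1)) * h2)
  fin_cases j <;> fin_cases k <;> first | rfl | assumption | (symm; assumption)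

end Ring

/-- The roots of `sextic e` are the `θ i`; they are simple and satisfy the conditions of general
position of the `E6` arrangement. -/
structure GeneralSextic {L : Type*} [Field L] (e θ : Fin 6 → L) : Prop where
  injective : Function.Injective θ
  sextic_eq_zero_iff : ∀ t, sextic e t = 0 ↔ ∃ i, θ i = t
  sexticDeriv_ne_zero : ∀ i, sexticDeriv e (θ i) ≠ 0
  add_add_ne_zero : ∀ i j k, i ≠ j → j ≠ k → i ≠ k → θ i + θ j + θ k ≠ 0
  coeff_ne_zero : e 0 ≠ 0

/-! ### Base points of the cubics and rank of the syzygy matrix. -/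

section Field

variable {L : Type*} [Field L] {e θ : Fin 6 → L}

/-- For `e 0 ≠ 0` the plane `v 0 = 0` cuts the surface in a cuspidal cubic, parametrized by (0 : 1 :
t : t³ + e₀t²), with cusp (0 : 0 : 0 : 1). -/
theorem det_syzMatrix_of_apply_zero {v : Fin 4 → L} (h : v 0 = 0) :
    (syzMatrix e v).det = - e 0 * (v 3 * v 1 ^ 2 - v 2 ^ 3 - e 0 * v 2 ^ 2 * v 1) := by
  simp [syzMatrix, Matrix.det_fin_three, h]
  ring

theorem cuspPoint_ne_zero (t : L) : cuspPoint t ≠ 0 := fun h => by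
  simpa [cuspPoint] using congrFun h 0

theorem eq_of_cuspPoint_eq_smul {s t c : L} (h : cuspPoint s = c • cuspPoint t) : s = t := by
  have h0 := congrFun h 0
  have h1 := congrFun h 1
  simp [cuspPoint] at h0 h1
  rw [h1, ← h0, one_mul]

/-- Off the base points N(u) has rank 3, so its kernel is spanned by the vector of its maximal
minors. -/
theorem eq_smul_cubicMap (h0 : e 0 ≠ 0) {u : Fin 3 → L} {v : Fin 4 → L}
    (hu : cubicMap e u ≠ 0) (h : syzMatrix e v *ᵥ u = 0) : ∃ c : L, v = c • cubicMap e u := by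
  obtain ⟨k, hk⟩ := Function.ne_iff.mp hu
  refine ⟨v k / cubicMap e u k, ?_⟩
  ext j
  have := mul_left_cancel₀ h0 (cubicMap_mul_eq e u v h j k)
  have hk' : cubicMap e u k ≠ 0 := hk
  simp only [Pi.smul_apply, smul_eq_mul]
  field_simp
  linear_combination -this

/-- A left kernel vector, of all the matrices `syzMatrix e v` applied to `u`, makes the maximal
minors vanish. -/
theorem cubicMap_eq_zero_of_dotProduct (h0 : e 0 ≠ 0) {u w : Fin 3 → L} (hw : w ≠ 0)
    (h : ∀ v, w ⬝ᵥ (syzMatrix e v *ᵥ u) = 0) : cubicMap e u = 0 := by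
  have hA := h ![1, 0, 0, 0]
  have hB := h ![0, 1, 0, 0]
  have hC := h ![0, 0, 1, 0]
  have hD := h ![0, 0, 0, 1]
  simp [syzMatrix, Matrix.mulVec, dotProduct, Fin.sum_univ_three] at hA hB hC hD
  obtain ⟨i, hi⟩ := Function.ne_iff.mp hw
  ext j
  refine mul_left_cancel₀ (mul_ne_zero h0 hi) ?_
  -- `w` is orthogonal to all four columns of N(u). Combining three of these relations with the
  -- cofactors of those columns gives `w i` times their determinant, which is ± `e 0 * cubicMap e u
  -- j`.
  have k00 : e 0 * w 0 * cubicMap e u 0 = 0 := by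
    simp [cubicMap, -mul_eq_zero]
    linear_combination -(((-e 0 * u 1) * u 1 - (-u 2) * u 0) * hB + (u 0 * (-e 0 * u 2) - u 1 * (-u 2)) * hC + ((-u 2) * (-u 2) - (-e 0 * u 2) * (-e 0 * u 1)) * hD)
  have k01 : e 0 * w 1 * cubicMap e u 0 = 0 := by
    simp [cubicMap, -mul_eq_zero]
    linear_combination -(((-u 2) * 0 - u 0 * u 1) * hB + (u 1 * (-u 1) - 0 * (-e 0 * u 2)) * hC + ((-e 0 * u 2) * u 0 - (-u 1) * (-u 2)) * hD)
  have k02 : e 0 * w 2 * cubicMap e u 0 = 0 := by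
    simp [cubicMap, -mul_eq_zero]
    linear_combination -((u 0 * u 0 - (-e 0 * u 1) * 0) * hB + (0 * (-u 2) - u 0 * (-u 1)) * hC + ((-u 1) * (-e 0 * u 1) - (-u 2) * u 0) * hD)
  have k10 : e 0 * w 0 * cubicMap e u 1 = 0 := by
    simp [cubicMap, -mul_eq_zero]
    linear_combination ((-e 0 * u 1) * u 1 - (-u 2) * u 0) * hA + (u 0 * (e 0 * e 5 * u 0 - (e 0 * e 2 - e 3) * u 2) - u 1 * (e 0 * e 4 * u 0 - e 0 * e 1 * u 2)) * hC + ((e 0 * e 4 * u 0 - e 0 * e 1 * u 2) * (-u 2) - (e 0 * e 5 * u 0 - (e 0 * e 2 - e 3) * u 2) * (-e 0 * u 1)) * hD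
  have k11 : e 0 * w 1 * cubicMap e u 1 = 0 := by
    simp [cubicMap, -mul_eq_zero]
    linear_combination ((-u 2) * 0 - u 0 * u 1) * hA + (u 1 * (e 0 * u 2 - e 3 * u 0) - 0 * (e 0 * e 5 * u 0 - (e 0 * e 2 - e 3) * u 2)) * hC + ((e 0 * e 5 * u 0 - (e 0 * e 2 - e 3) * u 2) * u 0 - (e 0 * u 2 - e 3 * u 0) * (-u 2)) * hD
  have k12 : e 0 * w 2 * cubicMap e u 1 = 0 := by
    simp [cubicMap, -mul_eq_zero]
    linear_combination (u 0 * u 0 - (-e 0 * u 1) * 0) * hA + (0 * (e 0 * e 4 * u 0 - e 0 * e 1 * u 2) - u 0 * (e 0 * u 2 - e 3 * u 0)) * hC + ((e 0 * u 2 - e 3 * u 0) * (-e 0 * u 1) - (e 0 * e 4 * u 0 - e 0 * e 1 * u 2) * u 0) * hD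
  have k20 : e 0 * w 0 * cubicMap e u 2 = 0 := by
    simp [cubicMap, -mul_eq_zero]
    linear_combination -(((-u 2) * u 1 - (-e 0 * u 2) * u 0) * hA + (u 0 * (e 0 * e 5 * u 0 - (e 0 * e 2 - e 3) * u 2) - u 1 * (e 0 * e 4 * u 0 - e 0 * e 1 * u 2)) * hB + ((e 0 * e 4 * u 0 - e 0 * e 1 * u 2) * (-e 0 * u 2) - (e 0 * e 5 * u 0 - (e 0 * e 2 - e 3) * u 2) * (-u 2)) * hD)
  have k21 : e 0 * w 1 * cubicMap e u 2 = 0 := by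
    simp [cubicMap, -mul_eq_zero]
    linear_combination -(((-e 0 * u 2) * 0 - (-u 1) * u 1) * hA + (u 1 * (e 0 * u 2 - e 3 * u 0) - 0 * (e 0 * e 5 * u 0 - (e 0 * e 2 - e 3) * u 2)) * hB + ((e 0 * e 5 * u 0 - (e 0 * e 2 - e 3) * u 2) * (-u 1) - (e 0 * u 2 - e 3 * u 0) * (-e 0 * u 2)) * hD)
  have k22 : e 0 * w 2 * cubicMap e u 2 = 0 := by
    simp [cubicMap, -mul_eq_zero]
    linear_combination -(((-u 1) * u 0 - (-u 2) * 0) * hA + (0 * (e 0 * e 4 * u 0 - e 0 * e 1 * u 2) - u 0 * (e 0 * u 2 - e 3 * u 0)) * hB + ((e 0 * u 2 - e 3 * u 0) * (-u 2) - (e 0 * e 4 * u 0 - e 0 * e 1 * u 2) * (-u 1)) * hD)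
  have k30 : e 0 * w 0 * cubicMap e u 3 = 0 := by
    simp [cubicMap, -mul_eq_zero]
    linear_combination ((-u 2) * (-u 2) - (-e 0 * u 2) * (-e 0 * u 1)) * hA + ((-e 0 * u 1) * (e 0 * e 5 * u 0 - (e 0 * e 2 - e 3) * u 2) - (-u 2) * (e 0 * e 4 * u 0 - e 0 * e 1 * u 2)) * hB + ((e 0 * e 4 * u 0 - e 0 * e 1 * u 2) * (-e 0 * u 2) - (e 0 * e 5 * u 0 - (e 0 * e 2 - e 3) * u 2) * (-u 2)) * hC
  have k31 : e 0 * w 1 * cubicMap e u 3 = 0 := by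
    simp [cubicMap, -mul_eq_zero]
    linear_combination ((-e 0 * u 2) * u 0 - (-u 1) * (-u 2)) * hA + ((-u 2) * (e 0 * u 2 - e 3 * u 0) - u 0 * (e 0 * e 5 * u 0 - (e 0 * e 2 - e 3) * u 2)) * hB + ((e 0 * e 5 * u 0 - (e 0 * e 2 - e 3) * u 2) * (-u 1) - (e 0 * u 2 - e 3 * u 0) * (-e 0 * u 2)) * hC
  have k32 : e 0 * w 2 * cubicMap e u 3 = 0 := by
    simp [cubicMap, -mul_eq_zero]
    linear_combination ((-u 1) * (-e 0 * u 1) - (-u 2) * u 0) * hA + (u 0 * (e 0 * e 4 * u 0 - e 0 * e 1 * u 2) - (-e 0 * u 1) * (e 0 * u 2 - e 3 * u 0)) * hB + ((e 0 * u 2 - e 3 * u 0) * (-u 2) - (e 0 * e 4 * u 0 - e 0 * e 1 * u 2) * (-u 1)) * hC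
  fin_cases i <;> fin_cases j <;> simpa only [Pi.zero_apply, mul_zero]

theorem cubicMap_cuspPoint_eq_zero (h : GeneralSextic e θ) (i : Fin 6) :
    cubicMap e (cuspPoint (θ i)) = 0 := by
  have := (h.sextic_eq_zero_iff (θ i)).mpr ⟨i, rfl⟩
  unfold sextic at this
  ext j
  fin_cases j
  · simp [cubicMap, cuspPoint]
  · simp [cubicMap, cuspPoint]
    linear_combination this
  · simp [cubicMap, cuspPoint]
    linear_combination θ i * this
  · simp [cubicMap, cuspPoint]
    linear_combination (θ i ^ 3 + e 0 * θ i ^ 2) * this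

/-- The first cubic puts `u` on the cuspidal cubic curve, the fourth excludes the cusp (0 : 0 : 1),
and the second then restricts to the sextic at `u 1 / u 0`. -/
theorem exists_eq_smul_cuspPoint (h : GeneralSextic e θ) {u : Fin 3 → L} (hu : u ≠ 0)
    (hc : cubicMap e u = 0) : ∃ i, ∃ c : L, c ≠ 0 ∧ u = c • cuspPoint (θ i) := by
  have h0 := congrFun hc 0
  have h1 := congrFun hc 1
  have h3 := congrFun hc 3
  simp [cubicMap] at h0 h1 h3
  have hx : u 0 ≠ 0 := by
    intro hx
    simp [hx] at h0 h1 h3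
    simp [h0] at h3
    refine hu ?_
    ext j
    fin_cases j <;> simp [hx, h0, h3]
  obtain ⟨i, hi⟩ := (h.sextic_eq_zero_iff (u 1 / u 0)).mp (by
    have hz : u 2 = u 1 ^ 3 / u 0 ^ 2 := by
      field_simp
      linear_combination h0
    rw [hz] at h1
    unfold sextic
    field_simp at h1 ⊢
    linear_combination h1)
  refine ⟨i, u 0, hx, ?_⟩
  ext j
  fin_cases j
  · simp [cuspPoint]
  · simp [cuspPoint, hi]
    field_simp
  · simp [cuspPoint, hi]
    field_simp
    linear_combination h0

theorem eq_zero_of_adjugate_apply_zero (h0 : e 0 ≠ 0) {v : Fin 4 → L} (hv : v 0 = 0)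
    (hadj : (syzMatrix e v).adjugate = 0) : v = 0 := by
  have h00 := congrFun (congrFun hadj 0) 0
  have h01 := congrFun (congrFun hadj 2) 0
  have h2 := congrFun (congrFun hadj 0) 2
  have h11 := congrFun (congrFun hadj 1) 1
  simp [syzMatrix, Matrix.adjugate_fin_three, hv] at h00 h01 h2 h11
  simp [h2] at h00 h01 h11
  ext j
  fin_cases j <;> simp_all

/-- This is where the condition on sums of three roots enters. The vanishing of the 2 by 2 minors at
`v 0 = 1` factors the sextic as (t³ - βt + n)(t³ - e₀t² + (β + e₁)t + μ). The first factor has roots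
with sum zero, and they are distinct because the sextic has simple roots. -/
theorem eq_zero_of_adjugate [IsAlgClosed L] [CharZero L] (h : GeneralSextic e θ) {v : Fin 4 → L}
    (hadj : (syzMatrix e v).adjugate = 0) : v = 0 := by
  by_cases hv : v 0 = 0
  · exact eq_zero_of_adjugate_apply_zero h.coeff_ne_zero hv hadj
  exfalso
  wlog hv1 : v 0 = 1 generalizing v
  · refine this (v := (v 0)⁻¹ • v) ?_ ?_ ?_
    · rw [syzMatrix_smul, Matrix.adjugate_smul, hadj, smul_zero]
    · simp [hv]
    · simp [hv]
  have h0 := h.coeff_ne_zero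
  -- `β`, `n` and `μ` are the coefficients of the two cubic factors in `hfac`.
  obtain ⟨β, hβ⟩ : ∃ β, v 1 = e 0 * β := ⟨v 1 / e 0, by field_simp⟩
  obtain ⟨n, hn⟩ : ∃ n, v 2 = e 0 * n + e 3 := ⟨(v 2 - e 3) / e 0, by field_simp; ring⟩
  obtain ⟨μ, hμ⟩ : ∃ μ, μ = - n - e 0 * β - e 2 := ⟨_, rfl⟩
  have m00 := congrFun (congrFun hadj 0) 0
  have m01 := congrFun (congrFun hadj 0) 1
  have m02 := congrFun (congrFun hadj 0) 2
  have m10 := congrFun (congrFun hadj 1) 0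
  have m11 := congrFun (congrFun hadj 1) 1
  have m12 := congrFun (congrFun hadj 1) 2
  simp [syzMatrix, Matrix.adjugate_fin_three, hv1, hβ, hn] at m00 m01 m02 m10 m11 m12
  have E3 : e 3 = - β * (β + e 1) - e 0 * n := by
    refine mul_left_cancel₀ (pow_ne_zero 2 h0) ?_
    linear_combination m02
  have E4 : e 4 = β * μ - n * (β + e 1) := by
    refine mul_left_cancel₀ (pow_ne_zero 2 h0) ?_
    rw [hμ]
    linear_combination m12 - m01
  have E5 : e 5 = n * μ := by
    refine mul_left_cancel₀ (pow_ne_zero 2 h0) ?_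
    rw [hμ]
    linear_combination -m11
  have E2 : e 2 = - n - e 0 * β - μ := by rw [hμ]; ring
  have hfac : ∀ t, sextic e t = (t ^ 3 - β * t + n) * (t ^ 3 - e 0 * t ^ 2 + (β + e 1) * t + μ) := by
    intro t
    rw [sextic, E3, E4, E5, E2]
    ring
  have hder : ∀ t, t ^ 3 - β * t + n = 0 → 3 * t ^ 2 - β = 0 → sexticDeriv e t = 0 := by
    intro t h1 h2
    rw [sexticDeriv, E3, E4, E2]
    linear_combination (t ^ 3 - e 0 * t ^ 2 + (β + e 1) * t + μ) * h2 +
      (3 * t ^ 2 - 2 * e 0 * t + (β + e 1)) * h1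
  obtain ⟨r, hr⟩ : ∃ r : L, r ^ 3 - β * r + n = 0 := by
    obtain ⟨r, hr⟩ := IsAlgClosed.exists_root (X ^ 3 - C β * X + C n : L[X]) (by
      have : (X ^ 3 - C β * X + C n : L[X]).degree = 3 := by compute_degree!
      rw [this]; decide)
    exact ⟨r, by simpa using hr⟩
  -- The quadratic is (t³ - βt + n)/(t - r), so the three roots are `r`, `s` and `-r - s`.
  obtain ⟨s, hs⟩ : ∃ s : L, s ^ 2 + r * s + (r ^ 2 - β) = 0 := by
    obtain ⟨r, hr⟩ := IsAlgClosed.exists_root (X ^ 2 + C r * X + C (r ^ 2 - β) : L[X]) (by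
      have : (X ^ 2 + C r * X + C (r ^ 2 - β) : L[X]).degree = 2 := by compute_degree!
      rw [this]; decide)
    exact ⟨r, by simpa using hr⟩
  have key : ∀ t, t ^ 3 - β * t + n = 0 → ∃ i, θ i = t ∧ 3 * t ^ 2 - β ≠ 0 := by
    intro t ht
    obtain ⟨i, rfl⟩ := (h.sextic_eq_zero_iff t).mp (by rw [hfac, ht, zero_mul])
    exact ⟨i, rfl, fun h2 => h.sexticDeriv_ne_zero i (hder _ ht h2)⟩
  obtain ⟨i, hi, hi'⟩ := key r hr
  obtain ⟨j, hj, hj'⟩ := key s (by linear_combination (s - r) * hs + hr)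
  obtain ⟨k, hk, -⟩ := key (- r - s) (by linear_combination (-2 * r - s) * hs + hr)
  refine h.add_add_ne_zero i j k ?_ ?_ ?_ (by rw [hi, hj, hk]; ring)
  · rintro rfl
    exact hi' (by linear_combination hs + (s + 2 * r) * (hi.symm.trans hj))
  · rintro rfl
    exact hj' (by linear_combination hs + (s - r) * (hj.symm.trans hk))
  · rintro rfl
    exact hi' (by linear_combination hs + (r - s) * (hi.symm.trans hk))

end Field

/-! ### Kernels of the syzygy matrix, smoothness, and the exceptional lines. -/

section Field

variable {L : Type*} [Field L] {e θ : Fin 6 → L}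

/-- A 3-by-3 matrix that kills two independent vectors has vanishing 2-by-2 minors. -/
theorem adjugate_eq_zero_of_mulVec {A : Matrix (Fin 3) (Fin 3) L} {u u' : Fin 3 → L}
    (hli : LinearIndependent L ![u, u']) (hu : A *ᵥ u = 0) (hu' : A *ᵥ u' = 0) :
    A.adjugate = 0 := by
  have hn := crossProduct_ne_zero_iff_linearIndependent.mpr hli
  obtain ⟨k, hk⟩ := Function.ne_iff.mp hn
  -- Every row is orthogonal to `u` and `u'`, hence proportional to `u ⨯₃ u'`.
  have hcross : ∀ i, A i ⨯₃ (u ⨯₃ u') = 0 := by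
    intro i
    have h1 : A i ⬝ᵥ u = 0 := congrFun hu i
    have h2 : A i ⬝ᵥ u' = 0 := congrFun hu' i
    rw [cross_cross_eq_smul_sub_smul', dotProduct_comm u, h1, h2, zero_smul, zero_smul, sub_zero]
  have hprop : ∀ i p q, A i p * (u ⨯₃ u') q = A i q * (u ⨯₃ u') p := by
    intro i p q
    have := hcross i
    generalize u ⨯₃ u' = n at *
    rw [cross_apply] at this
    have h0 := congrFun this 0
    have h1 := congrFun this 1
    have h2 := congrFun this 2
    simp [sub_eq_zero] at h0 h1 h2
    fin_cases p <;> fin_cases q <;> first | rfl | assumption | (symm; assumption)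
  have hminor : ∀ i j p q, A i p * A j q - A i q * A j p = 0 := by
    intro i j p q
    refine (mul_eq_zero.mp ?_).resolve_right hk
    linear_combination A j q * hprop i p k - A j p * hprop i q k + A i k * hprop j q p
  ext i j
  rw [Matrix.adjugate_fin_three]
  fin_cases i <;> fin_cases j <;> simp only [Matrix.of_apply] <;> simp
  · linear_combination hminor 1 2 1 2
  · linear_combination - hminor 0 2 1 2
  · linear_combination hminor 0 1 1 2
  · linear_combination - hminor 1 2 0 2
  · linear_combination hminor 0 2 0 2
  · linear_combination - hminor 0 1 0 2
  · linear_combination hminor 1 2 0 1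
  · linear_combination - hminor 0 2 0 1
  · linear_combination hminor 0 1 0 1

theorem eq_zero_of_mulVec_of_linearIndependent [IsAlgClosed L] [CharZero L]
    (h : GeneralSextic e θ) {v : Fin 4 → L} {u u' : Fin 3 → L}
    (hli : LinearIndependent L ![u, u']) (hu : syzMatrix e v *ᵥ u = 0)
    (hu' : syzMatrix e v *ᵥ u' = 0) : v = 0 :=
  eq_zero_of_adjugate h (adjugate_eq_zero_of_mulVec hli hu hu')

/-- The fibre of the blow-up over a point `v` of the surface is the projectivized kernel of M(v); it
is a single point because M(v) has rank at least 2. -/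
theorem eq_smul_of_mulVec [IsAlgClosed L] [CharZero L] (h : GeneralSextic e θ) {v : Fin 4 → L}
    (hv : v ≠ 0) {u u' : Fin 3 → L} (hu0 : u ≠ 0) (hu : syzMatrix e v *ᵥ u = 0)
    (hu' : syzMatrix e v *ᵥ u' = 0) : ∃ c : L, u' = c • u := by
  by_contra hc
  push Not at hc
  refine hv (eq_zero_of_mulVec_of_linearIndependent h (u := u) (u' := u') ?_ hu hu')
  rw [LinearIndependent.pair_iff' hu0]
  exact fun a ha => hc a ha.symm

/-- The vector that spans the left kernel of `u ↦ syzMatrix e v *ᵥ u` at `cuspPoint t`, for all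
`v` simultaneously. -/
def leftPoint (e : Fin 6 → L) (t : L) : Fin 3 → L := ![t ^ 3 - e 0 * t ^ 2, -t, 1]

/-- Orthogonality to the columns of N(u) for `v 2` and `v 3` already determines `w` up to scale. -/
theorem eq_smul_leftPoint {t : L} {w : Fin 3 → L}
    (h : ∀ v, w ⬝ᵥ (syzMatrix e v *ᵥ cuspPoint t) = 0) : w = w 2 • leftPoint e t := by
  have hC := h ![0, 0, 1, 0]
  have hD := h ![0, 0, 0, 1]
  simp [syzMatrix, cuspPoint, Matrix.mulVec, dotProduct, Fin.sum_univ_three] at hC hD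
  ext j
  fin_cases j
  · simp [leftPoint]
    linear_combination hC + e 0 * t * hD
  · simp [leftPoint]
    linear_combination hD
  · simp [leftPoint]

/-- The exceptional line and the conic line with the same index are skew: elimination leaves `e 0`
times the derivative of the sextic times `v 0`, and the root is simple. -/
theorem eq_zero_of_leftPoint_of_cuspPoint [CharZero L] (h : GeneralSextic e θ) (i : Fin 6)
    {v : Fin 4 → L} (hl : leftPoint e (θ i) ᵥ* syzMatrix e v = 0)
    (hr : syzMatrix e v *ᵥ cuspPoint (θ i) = 0) : v = 0 := by
  have h0 := h.coeff_ne_zero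
  have hP := h.sexticDeriv_ne_zero i
  unfold sexticDeriv at hP
  generalize θ i = t at *
  have l0 := congrFun hl 0
  have l1 := congrFun hl 1
  have l2 := congrFun hl 2
  have r0 := congrFun hr 0
  have r1 := congrFun hr 1
  simp [syzMatrix, leftPoint, cuspPoint, Matrix.mulVec, Matrix.vecMul, dotProduct,
    Fin.sum_univ_three] at l0 l1 l2 r0 r1
  have hB : v 1 = (2 * t ^ 3 - e 0 * t ^ 2 + e 1 * t - e 2) * v 0 := by
    refine mul_left_cancel₀ h0 ?_
    linear_combination -l2 - r0
  have hA : v 0 = 0 := by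
    refine mul_left_cancel₀ (mul_ne_zero h0 hP) ?_
    linear_combination l1 - r1 - 2 * t * e 0 * r0 - 3 * t ^ 2 * e 0 * hB
  have hB' : v 1 = 0 := by rw [hB, hA, mul_zero]
  simp [hA, hB'] at r0 l1
  simp [r0] at l1
  ext j
  fin_cases j <;> simp [*]

/-- The determinantal cubic surface has no singular point. -/
theorem eq_zero_of_trace_adjugate_mul [IsAlgClosed L] [CharZero L] (h : GeneralSextic e θ)
    {v : Fin 4 → L} (hdet : (syzMatrix e v).det = 0)
    (htr : ∀ v', ((syzMatrix e v).adjugate * syzMatrix e v').trace = 0) : v = 0 := by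
  by_contra hv
  have hadj : (syzMatrix e v).adjugate ≠ 0 := fun hadj => hv (eq_zero_of_adjugate h hadj)
  set A := (syzMatrix e v).adjugate with hA
  obtain ⟨a, ha⟩ := Function.ne_iff.mp hadj
  obtain ⟨b, hab⟩ := Function.ne_iff.mp ha
  have hab : A a b ≠ 0 := hab
  -- M(v) has rank exactly 2, so its adjugate has rank one: a nonzero column `u` spans the right
  -- kernel and a nonzero row `w` lies in the left kernel.
  set u : Fin 3 → L := fun i => A i b with hu
  set w : Fin 3 → L := fun j => A a j with hw
  have hu0 : u ≠ 0 := fun h0 => hab (congrFun h0 a)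
  have hw0 : w ≠ 0 := fun h0 => hab (congrFun h0 b)
  have hMu : syzMatrix e v *ᵥ u = 0 := by
    ext i
    have := congrFun (congrFun (Matrix.mul_adjugate (syzMatrix e v)) i) b
    rw [hdet, zero_smul] at this
    exact this
  have hMw : w ᵥ* syzMatrix e v = 0 := by
    ext i
    have := congrFun (congrFun (Matrix.adjugate_mul (syzMatrix e v)) a) i
    rw [hdet, zero_smul] at this
    exact this
  have hrank : ∀ i j, u i * w j = A a b * A i j := by
    intro i j
    obtain ⟨c, hc⟩ := eq_smul_of_mulVec h hv hu0 hMu (u' := fun i => A i j) (by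
      ext i
      have := congrFun (congrFun (Matrix.mul_adjugate (syzMatrix e v)) i) j
      rw [hdet, zero_smul] at this
      exact this)
    have h1 := congrFun hc i
    have h2 := congrFun hc a
    simp only [hu, Pi.smul_apply, smul_eq_mul] at h1 h2
    simp only [hu, hw]
    rw [h1, h2]
    ring
  -- By `hrank` the trace is w M(v') u up to the factor `A a b`. Its vanishing for all `v'` puts `w`
  -- in the left kernel of N(u), so `u` is a base point and `w` a multiple of the corresponding
  -- `leftPoint`.
  have hall : ∀ v', w ⬝ᵥ (syzMatrix e v' *ᵥ u) = 0 := by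
    intro v'
    have : w ⬝ᵥ (syzMatrix e v' *ᵥ u) = A a b * (A * syzMatrix e v').trace := by
      simp only [Matrix.trace, Matrix.diag, Matrix.mul_apply, Matrix.mulVec, dotProduct,
        Finset.mul_sum]
      rw [Finset.sum_comm]
      refine Finset.sum_congr rfl fun i _ => Finset.sum_congr rfl fun j _ => ?_
      linear_combination syzMatrix e v' j i * hrank i j
    rw [this, htr, mul_zero]
  obtain ⟨i, c, hc, hui⟩ := exists_eq_smul_cuspPoint h hu0
    (cubicMap_eq_zero_of_dotProduct h.coeff_ne_zero hw0 hall)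
  have hw' := eq_smul_leftPoint (e := e) (t := θ i) (w := w) (fun v' => by
    have := hall v'
    rw [hui, Matrix.mulVec_smul, dotProduct_smul, smul_eq_mul] at this
    exact (mul_eq_zero.mp this).resolve_left hc)
  have hw2 : w 2 ≠ 0 := fun h0 => hw0 (by rw [hw', h0, zero_smul])
  refine hv (eq_zero_of_leftPoint_of_cuspPoint h i ?_ ?_)
  · rw [hw', Matrix.smul_vecMul] at hMw
    exact (smul_eq_zero.mp hMw).resolve_left hw2
  · rw [hui, Matrix.mulVec_smul] at hMu
    exact (smul_eq_zero.mp hMu).resolve_left hc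

/-! ### The lines over the six points -/

/-- The line in three-space over the point `cuspPoint t` of the plane. -/
def exceptionalLine (e : Fin 6 → L) (t : L) : Submodule L (Fin 4 → L) where
  carrier := {v | syzMatrix e v *ᵥ cuspPoint t = 0}
  zero_mem' := by simp
  add_mem' {v w} hv hw := by
    simp only [Set.mem_ofPred_eq] at hv hw ⊢
    rw [syzMatrix_add, Matrix.add_mulVec, hv, hw, add_zero]
  smul_mem' c v hv := by
    simp only [Set.mem_ofPred_eq] at hv ⊢
    rw [syzMatrix_smul, Matrix.smul_mulVec, hv, smul_zero]

theorem mem_exceptionalLine {t : L} {v : Fin 4 → L} :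
    v ∈ exceptionalLine e t ↔ syzMatrix e v *ᵥ cuspPoint t = 0 := Iff.rfl

/-- The first two rows solve for `v 2` and `v 3`; the third row then becomes `e 0 * v 0` times the
value of the sextic at the root. -/
theorem mem_exceptionalLine_iff (h : GeneralSextic e θ) (i : Fin 6) {v : Fin 4 → L} :
    v ∈ exceptionalLine e (θ i) ↔ v 2 = (e 3 - e 0 * θ i ^ 3) * v 0 + θ i * v 1 ∧
      v 3 = e 0 * (θ i * e 3 - e 0 * θ i ^ 4 + e 1 * θ i ^ 3 - e 4) * v 0
        + (θ i ^ 3 + e 0 * θ i ^ 2) * v 1 := by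
  have hP := (h.sextic_eq_zero_iff (θ i)).mpr ⟨i, rfl⟩
  unfold sextic at hP
  generalize θ i = t at *
  rw [mem_exceptionalLine]
  constructor
  · intro hv
    have r0 := congrFun hv 0
    have r1 := congrFun hv 1
    simp [syzMatrix, cuspPoint, Matrix.mulVec, dotProduct, Fin.sum_univ_three] at r0 r1
    constructor
    · linear_combination r0
    · linear_combination r1 + e 0 * t * r0
  · rintro ⟨h2, h3⟩
    ext j
    fin_cases j
    · simp [syzMatrix, cuspPoint, Matrix.mulVec, dotProduct, Fin.sum_univ_three, h2]
      ring
    · simp [syzMatrix, cuspPoint, Matrix.mulVec, dotProduct, Fin.sum_univ_three, h2, h3]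
      ring
    · simp [syzMatrix, cuspPoint, Matrix.mulVec, dotProduct, Fin.sum_univ_three, h2, h3]
      linear_combination e 0 * v 0 * hP

theorem cubicDeriv_mem_exceptionalLine (h : GeneralSextic e θ) (i : Fin 6) (w : Fin 3 → L) :
    cubicDeriv e (cuspPoint (θ i)) w ∈ exceptionalLine e (θ i) := by
  have := syzMatrix_cubicDeriv_mulVec e (cuspPoint (θ i)) w
  rw [cubicMap_cuspPoint_eq_zero h, syzMatrix_zero, Matrix.zero_mulVec, add_zero] at this
  exact this

/-- Every point of the exceptional line is the limit of the cubics along some tangent direction at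
the base point. This is what places the whole line in the closure of the graph. -/
theorem exists_cubicDeriv_eq (h : GeneralSextic e θ) (i : Fin 6) {v : Fin 4 → L}
    (hv : v ∈ exceptionalLine e (θ i)) : ∃ w, cubicDeriv e (cuspPoint (θ i)) w = v := by
  have hd := h.sexticDeriv_ne_zero i
  set t := θ i with ht
  obtain ⟨g, hg⟩ : ∃ g, g = 2 * t ^ 3 - e 0 * t ^ 2 + e 1 * t - e 2 := ⟨_, rfl⟩
  set w1 := (v 1 - g * v 0) / sexticDeriv e t with hw1
  have hw1' : sexticDeriv e t * w1 = v 1 - g * v 0 := by rw [hw1]; field_simp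
  unfold sexticDeriv at hw1'
  -- Only the direction modulo `cuspPoint t` matters, so entry 0 is 0. Coordinate 0 of the
  -- derivative fixes entry 2; coordinate 1 then has coefficient `sexticDeriv e t` at `w1`.
  refine ⟨![0, w1, v 0 + 3 * t ^ 2 * w1], ?_⟩
  have hm := cubicDeriv_mem_exceptionalLine h i ![0, w1, v 0 + 3 * t ^ 2 * w1]
  rw [mem_exceptionalLine_iff h] at hm hv
  rw [← ht] at hm hv
  have e0 : cubicDeriv e (cuspPoint t) ![0, w1, v 0 + 3 * t ^ 2 * w1] 0 = v 0 := by
    simp [cubicDeriv, cuspPoint]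
  have e1 : cubicDeriv e (cuspPoint t) ![0, w1, v 0 + 3 * t ^ 2 * w1] 1 = v 1 := by
    simp [cubicDeriv, cuspPoint]
    linear_combination hw1' + v 0 * (-hg)
  rw [e0, e1] at hm
  ext j
  fin_cases j
  · exact e0
  · exact e1
  · exact hm.1.trans hv.1.symm
  · exact hm.2.trans hv.2.symm

/-- The base points are reduced: no tangent direction at one of them kills the derivatives of all
four cubics. -/
theorem eq_smul_of_cubicDeriv_eq_zero (h : GeneralSextic e θ) (i : Fin 6) {w : Fin 3 → L}
    (hw : cubicDeriv e (cuspPoint (θ i)) w = 0) : w = w 0 • cuspPoint (θ i) := by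
  have hd := h.sexticDeriv_ne_zero i
  have hP := (h.sextic_eq_zero_iff (θ i)).mpr ⟨i, rfl⟩
  unfold sexticDeriv at hd
  unfold sextic at hP
  generalize θ i = t at *
  have h0 := congrFun hw 0
  have h1 := congrFun hw 1
  simp [cubicDeriv, cuspPoint] at h0 h1
  have hy : w 1 = w 0 * t := by
    refine mul_left_cancel₀ hd ?_
    linear_combination h1 - (2 * t ^ 3 - e 0 * t ^ 2 + e 1 * t - e 2) * h0 - 3 * w 0 * hP
  ext j
  fin_cases j
  · simp [cuspPoint]
  · simp [cuspPoint, hy]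
  · simp [cuspPoint]
    linear_combination h0 + 3 * t ^ 2 * hy

end Field

/-! ### Singular pencils of 3 by 3 matrices and binary quadratic forms. -/

section Pencil

variable {L : Type*} [Field L]

theorem det_add_smul_fin_three (A B : Matrix (Fin 3) (Fin 3) L) (s : L) :
    (A + s • B).det = A 2 ⬝ᵥ (A 0 ⨯₃ A 1)
      + s * (A 2 ⬝ᵥ (A 0 ⨯₃ B 1 + B 0 ⨯₃ A 1) + B 2 ⬝ᵥ (A 0 ⨯₃ A 1))
      + s ^ 2 * (A 2 ⬝ᵥ (B 0 ⨯₃ B 1) + B 2 ⬝ᵥ (A 0 ⨯₃ B 1 + B 0 ⨯₃ A 1))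
      + s ^ 3 * (B 2 ⬝ᵥ (B 0 ⨯₃ B 1)) := by
  simp [Matrix.det_fin_three, cross_apply, dotProduct, Fin.sum_univ_three]
  ring

/-- Interpolation of a quartic at 0, ±1, ±2; the denominators divide 24. -/
theorem coeffs_eq_zero_of_forall [CharZero L] {c₀ c₁ c₂ c₃ c₄ : L}
    (h : ∀ s : L, c₀ + s * c₁ + s ^ 2 * c₂ + s ^ 3 * c₃ + s ^ 4 * c₄ = 0) :
    c₀ = 0 ∧ c₁ = 0 ∧ c₂ = 0 ∧ c₃ = 0 ∧ c₄ = 0 := by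
  have h0 := h 0
  have h1 := h 1
  have h2 := h (-1)
  have h3 := h 2
  have h4 := h (-2)
  refine ⟨?_, ?_, ?_, ?_, ?_⟩
  · linear_combination h0
  · linear_combination (2 / 3) * h1 - (2 / 3) * h2 - (1 / 12) * h3 + (1 / 12) * h4
  · linear_combination (2 / 3) * h1 + (2 / 3) * h2 - (1 / 24) * h3 - (1 / 24) * h4 - (5 / 4) * h0
  · linear_combination -(1 / 6) * h1 + (1 / 6) * h2 + (1 / 12) * h3 - (1 / 12) * h4
  · linear_combination -(1 / 6) * h1 - (1 / 6) * h2 + (1 / 24) * h3 + (1 / 24) * h4 + (1 / 4) * h0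

theorem mulVec_eq_zero_fin_three {A : Matrix (Fin 3) (Fin 3) L} {u : Fin 3 → L} :
    A *ᵥ u = 0 ↔ A 0 ⬝ᵥ u = 0 ∧ A 1 ⬝ᵥ u = 0 ∧ A 2 ⬝ᵥ u = 0 := by
  constructor
  · intro h
    exact ⟨congrFun h 0, congrFun h 1, congrFun h 2⟩
  · rintro ⟨h0, h1, h2⟩
    ext i
    fin_cases i
    exacts [h0, h1, h2]

theorem exists_ne_zero_dotProduct_pair_eq_zero (x y : Fin 3 → L) :
    ∃ w : Fin 3 → L, w ≠ 0 ∧ w ⬝ᵥ x = 0 ∧ w ⬝ᵥ y = 0 := by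
  obtain ⟨w, hw, h⟩ := (Matrix.exists_mulVec_eq_zero_iff (M := Matrix.of ![x, y, 0])).mpr
    (Matrix.det_eq_zero_of_row_eq_zero 2 fun j => rfl)
  refine ⟨w, hw, ?_, ?_⟩
  · rw [dotProduct_comm]
    exact congrFun h 0
  · rw [dotProduct_comm]
    exact congrFun h 1

/-- The Kronecker classification of those singular pencils of 3-by-3 matrices whose kernel is
generically one-dimensional. -/
theorem singular_pencil_trichotomy [CharZero L] {A B : Matrix (Fin 3) (Fin 3) L}
    (hdet : ∀ s : L, (A + s • B).det = 0) (hc : B 0 ⨯₃ B 1 ≠ 0) :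
    (∃ u ≠ 0, A *ᵥ u = 0 ∧ B *ᵥ u = 0) ∨
    (∃ a b, LinearIndependent L ![a, b] ∧ A *ᵥ a = 0 ∧ B *ᵥ b = 0 ∧ A *ᵥ b + B *ᵥ a = 0) ∨
    (∃ w ≠ 0, w ᵥ* A = 0 ∧ w ᵥ* B = 0) := by
  obtain ⟨d0, d1, d2, d3, -⟩ := coeffs_eq_zero_of_forall (c₄ := (0 : L)) fun s =>
    (add_eq_left.mpr (mul_zero (s ^ 4))).trans
      ((det_add_smul_fin_three A B s).symm.trans (hdet s))
  -- `a + s b + s² c` is the cross product of the first two rows of `A + s B`: a polynomial vector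
  -- in the kernel of the pencil.
  obtain ⟨a, ha⟩ : ∃ a, a = A 0 ⨯₃ A 1 := ⟨_, rfl⟩
  obtain ⟨b, hb⟩ : ∃ b, b = A 0 ⨯₃ B 1 + B 0 ⨯₃ A 1 := ⟨_, rfl⟩
  obtain ⟨c, hc'⟩ : ∃ c, c = B 0 ⨯₃ B 1 := ⟨_, rfl⟩
  rw [← ha, ← hb] at d1
  rw [← hc', ← hb] at d2
  rw [← ha] at d0
  rw [← hc'] at d3 hc
  -- `E0` to `E3` are the coefficients in `s` of (A + sB)(a + sb + s²c) = 0. Rows 0 and 1 hold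
  -- identically, row 2 is the vanishing of the determinant.
  have E0 : A *ᵥ a = 0 := by
    refine mulVec_eq_zero_fin_three.mpr ⟨?_, ?_, d0⟩ <;>
      simp [ha, cross_apply, dotProduct, Fin.sum_univ_three] <;> ring
  have E3 : B *ᵥ c = 0 := by
    refine mulVec_eq_zero_fin_three.mpr ⟨?_, ?_, d3⟩ <;>
      simp [hc', cross_apply, dotProduct, Fin.sum_univ_three] <;> ring
  have E1 : A *ᵥ b + B *ᵥ a = 0 := by
    ext i
    fin_cases i
    · change A 0 ⬝ᵥ b + B 0 ⬝ᵥ a = 0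
      simp [ha, hb, cross_apply, dotProduct, Fin.sum_univ_three]
      ring
    · change A 1 ⬝ᵥ b + B 1 ⬝ᵥ a = 0
      simp [ha, hb, cross_apply, dotProduct, Fin.sum_univ_three]
      ring
    · exact d1
  have E2 : A *ᵥ c + B *ᵥ b = 0 := by
    ext i
    fin_cases i
    · change A 0 ⬝ᵥ c + B 0 ⬝ᵥ b = 0
      simp [hc', hb, cross_apply, dotProduct, Fin.sum_univ_three]
      ring
    · change A 1 ⬝ᵥ c + B 1 ⬝ᵥ b = 0
      simp [hc', hb, cross_apply, dotProduct, Fin.sum_univ_three]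
      ring
    · exact d2
  clear ha hb hc' d0 d1 d2 d3
  -- If `a`, `b`, `c` are dependent, the kernel vector can be replaced by one of degree 0 or 1 in
  -- `s`.
  by_cases hli : (Matrix.of ![a, b, c]).det = 0
  · obtain ⟨c', x₀, w₀, x₁, w₁, hac, hbc⟩ : ∃ (c' : Fin 3 → L) (x₀ w₀ x₁ w₁ : L),
        a = x₀ • c + w₀ • c' ∧ b = x₁ • c + w₁ • c' := by
      obtain ⟨w, hw, h⟩ := Matrix.exists_vecMul_eq_zero_iff.mpr hli
      have hrel : w 0 • a + w 1 • b + w 2 • c = 0 := by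
        rw [← h]
        ext i
        simp [Matrix.vecMul, dotProduct, Fin.sum_univ_three]
      by_cases h0 : w 0 = 0
      · have h1 : w 1 ≠ 0 := by
          intro h1
          rw [h0, h1, zero_smul, zero_smul, zero_add, zero_add, smul_eq_zero] at hrel
          refine hw ?_
          ext i
          fin_cases i
          exacts [h0, h1, hrel.resolve_right hc]
        refine ⟨a, 0, 1, - (w 2 / w 1), 0, by simp, ?_⟩
        ext i
        have := congrFun hrel i
        simp [h0] at this ⊢
        field_simp
        linear_combination this
      · refine ⟨b, -(w 2 / w 0), -(w 1 / w 0), 0, 1, ?_, by simp⟩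
        ext i
        have := congrFun hrel i
        simp at this ⊢
        field_simp
        linear_combination this
    rw [hac] at E0 E1
    rw [hbc] at E1 E2
    simp only [Matrix.mulVec_add, Matrix.mulVec_smul, E3, smul_zero, zero_add] at E0 E1 E2
    by_cases hm : A *ᵥ c = 0
    · exact Or.inl ⟨c, hc, hm, E3⟩
    refine Or.inr (Or.inl ?_)
    generalize hm' : A *ᵥ c = m at *
    have hw₁ : w₁ ≠ 0 := by
      rintro rfl
      rw [zero_smul, add_zero] at E2
      exact hm E2
    have hB : B *ᵥ c' = -(w₁⁻¹ • m) := by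
      ext i
      have := congrFun E2 i
      simp at this ⊢
      field_simp
      linear_combination this
    have hA : A *ᵥ c' = ((w₀ / w₁ - x₁) / w₁) • m := by
      rw [hB] at E1
      ext i
      have := congrFun E1 i
      simp at this ⊢
      field_simp at this ⊢
      linear_combination this
    have hb : w₁⁻¹ • c ≠ 0 := smul_ne_zero (inv_ne_zero hw₁) hc
    -- Correcting `c'` by a multiple of `c` moves it into the kernel of `A`, and rescaling `c` makes
    -- the mixed terms cancel.
    refine ⟨c' - ((w₀ / w₁ - x₁) / w₁) • c, w₁⁻¹ • c, ?_, ?_, ?_, ?_⟩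
    · rw [LinearIndependent.pair_symm_iff, LinearIndependent.pair_iff' hb]
      intro k hk
      have := congrArg (B *ᵥ ·) hk
      simp only [Matrix.mulVec_smul, Matrix.mulVec_sub, E3, hB, smul_zero, sub_zero] at this
      exact smul_ne_zero (inv_ne_zero hw₁) hm (neg_eq_zero.mp this.symm)
    · rw [Matrix.mulVec_sub, Matrix.mulVec_smul, hA, hm', sub_self]
    · rw [Matrix.mulVec_smul, E3, smul_zero]
    · rw [Matrix.mulVec_smul, Matrix.mulVec_sub, Matrix.mulVec_smul, E3, hB, hm', smul_zero,
        sub_zero, add_neg_cancel]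
  · refine Or.inr (Or.inr ?_)
    -- Now `a`, `b`, `c` is a basis, and by `E0` to `E3` the images of `A` and `B` are both spanned
    -- by `B a` and `B b`. A vector orthogonal to these two is a common left kernel vector.
    obtain ⟨w, hw, hx, hy⟩ := exists_ne_zero_dotProduct_pair_eq_zero (B *ᵥ a) (B *ᵥ b)
    have key : ∀ C : Matrix (Fin 3) (Fin 3) L, w ⬝ᵥ (C *ᵥ a) = 0 → w ⬝ᵥ (C *ᵥ b) = 0 →
        w ⬝ᵥ (C *ᵥ c) = 0 → w ᵥ* C = 0 := by
      intro C h0 h1 h2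
      refine Matrix.eq_zero_of_mulVec_eq_zero hli ?_
      rw [Matrix.dotProduct_mulVec, dotProduct_comm] at h0 h1 h2
      exact mulVec_eq_zero_fin_three.mpr ⟨h0, h1, h2⟩
    refine ⟨w, hw, key A ?_ ?_ ?_, key B hx hy ?_⟩
    · rw [E0, dotProduct_zero]
    · rw [eq_neg_of_add_eq_zero_left E1, dotProduct_neg, hx, neg_zero]
    · rw [eq_neg_of_add_eq_zero_left E2, dotProduct_neg, hy, neg_zero]
    · rw [E3, dotProduct_zero]

/-- A binary quadratic form has two independent zeros or a double zero. -/
theorem binary_quadratic_zeros [IsAlgClosed L] [CharZero L] (k₀ k₁ k₂ : L) :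
    (∃ q₁ s₁ q₂ s₂, q₁ * s₂ - q₂ * s₁ ≠ 0 ∧ k₀ * q₁ ^ 2 + k₁ * q₁ * s₁ + k₂ * s₁ ^ 2 = 0 ∧
      k₀ * q₂ ^ 2 + k₁ * q₂ * s₂ + k₂ * s₂ ^ 2 = 0) ∨
    (∃ q s, (q ≠ 0 ∨ s ≠ 0) ∧ 2 * k₀ * q + k₁ * s = 0 ∧ k₁ * q + 2 * k₂ * s = 0) := by
  by_cases h2 : k₂ = 0
  · by_cases h1 : k₁ = 0
    · exact Or.inr ⟨0, 1, by simp, by simp [h1], by simp [h2]⟩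
    · exact Or.inl ⟨0, 1, k₁, -k₀, by simpa, by simp [h2], by rw [h2]; ring⟩
  · obtain ⟨d, hd⟩ := IsAlgClosed.exists_pow_nat_eq (k₁ ^ 2 - 4 * k₀ * k₂) two_pos
    by_cases hd0 : d = 0
    · refine Or.inr ⟨2 * k₂, -k₁, by simp [h2], ?_, by ring⟩
      rw [hd0] at hd
      linear_combination hd
    · refine Or.inl ⟨2 * k₂, -k₁ + d, 2 * k₂, -k₁ - d, ?_, ?_, ?_⟩
      · have : 2 * k₂ * (-k₁ - d) - 2 * k₂ * (-k₁ + d) = -4 * k₂ * d := by ring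
        rw [this]
        simp [h2, hd0]
      · linear_combination k₂ * hd
      · linear_combination k₂ * hd

end Pencil

/-! ### The three families of lines on the determinantal surface. -/

section Lines

variable {L : Type*} [Field L] {e θ : Fin 6 → L}

/-- The two-dimensional subspace of `L ^ 4` spanned by `(1, 0, α, γ)` and `(0, 1, τ, δ)`. -/
def graphPlane (α τ γ δ : L) : Submodule L (Fin 4 → L) where
  carrier := {v | v 2 = α * v 0 + τ * v 1 ∧ v 3 = γ * v 0 + δ * v 1}
  zero_mem' := by simp
  add_mem' {v w} hv hw := by
    simp only [Set.mem_ofPred_eq, Pi.add_apply] at hv hw ⊢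
    rw [hv.1, hv.2, hw.1, hw.2]
    constructor <;> ring
  smul_mem' c v hv := by
    simp only [Set.mem_ofPred_eq, Pi.smul_apply, smul_eq_mul] at hv ⊢
    rw [hv.1, hv.2]
    constructor <;> ring

theorem mem_graphPlane {α τ γ δ : L} {v : Fin 4 → L} :
    v ∈ graphPlane α τ γ δ ↔ v 2 = α * v 0 + τ * v 1 ∧ v 3 = γ * v 0 + δ * v 1 := Iff.rfl

theorem fst_mem_graphPlane (α τ γ δ : L) : ![1, 0, α, γ] ∈ graphPlane α τ γ δ := by
  simp [mem_graphPlane]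

theorem snd_mem_graphPlane (α τ γ δ : L) : ![0, 1, τ, δ] ∈ graphPlane α τ γ δ := by
  simp [mem_graphPlane]

theorem graphPlane_le_iff {α τ γ δ : L} {W : Submodule L (Fin 4 → L)} :
    graphPlane α τ γ δ ≤ W ↔ ![1, 0, α, γ] ∈ W ∧ ![0, 1, τ, δ] ∈ W := by
  constructor
  · intro h
    exact ⟨h (fst_mem_graphPlane α τ γ δ), h (snd_mem_graphPlane α τ γ δ)⟩
  · rintro ⟨h0, h1⟩ v hv
    have : v = v 0 • ![1, 0, α, γ] + v 1 • ![0, 1, τ, δ] := by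
      ext j
      fin_cases j
      · simp
      · simp
      · simp [hv.1]
        ring
      · simp [hv.2]
        ring
    rw [this]
    exact W.add_mem (W.smul_mem _ h0) (W.smul_mem _ h1)

theorem graphPlane_eq_span (α τ γ δ : L) :
    graphPlane α τ γ δ = Submodule.span L (Set.range ![![1, 0, α, γ], ![0, 1, τ, δ]]) := by
  refine le_antisymm (graphPlane_le_iff.mpr ⟨?_, ?_⟩) (Submodule.span_le.mpr ?_)
  · exact Submodule.subset_span ⟨0, rfl⟩
  · exact Submodule.subset_span ⟨1, rfl⟩
  · rintro _ ⟨i, rfl⟩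
    fin_cases i
    exacts [fst_mem_graphPlane α τ γ δ, snd_mem_graphPlane α τ γ δ]

theorem finrank_graphPlane (α τ γ δ : L) : Module.finrank L (graphPlane α τ γ δ) = 2 := by
  rw [graphPlane_eq_span, finrank_span_eq_card, Fintype.card_fin]
  rw [LinearIndependent.pair_iff]
  intro s t h
  have h0 := congrFun h 0
  have h1 := congrFun h 1
  simp at h0 h1
  exact ⟨h0, h1⟩

theorem eq_graphPlane_of_le {α τ γ δ : L} {W : Submodule L (Fin 4 → L)}
    (hW : Module.finrank L W = 2) (h : graphPlane α τ γ δ ≤ W) : W = graphPlane α τ γ δ :=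
  (Submodule.eq_of_le_of_finrank_eq h (by rw [hW, finrank_graphPlane])).symm

/-- `W` is a line on the cubic surface `det (syzMatrix e v) = 0`. -/
def IsSurfaceLine (e : Fin 6 → L) (W : Submodule L (Fin 4 → L)) : Prop :=
  Module.finrank L W = 2 ∧ ∀ v ∈ W, (syzMatrix e v).det = 0

/-- No line passes through the cusp of the plane section `v 0 = 0`: it would lie in that plane,
hence in an irreducible cuspidal cubic. Consequently the first two coordinates parametrize every
line. -/
theorem IsSurfaceLine.eq_zero_of_apply_eq_zero [CharZero L] (h0 : e 0 ≠ 0)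
    {W : Submodule L (Fin 4 → L)} (hW : IsSurfaceLine e W) {v : Fin 4 → L} (hv : v ∈ W)
    (hv0 : v 0 = 0) (hv1 : v 1 = 0) : v = 0 := by
  have hcurve : ∀ v ∈ W, v 0 = 0 → v 3 * v 1 ^ 2 - v 2 ^ 3 - e 0 * v 2 ^ 2 * v 1 = 0 := by
    intro v hv hv0
    have := hW.2 v hv
    rw [det_syzMatrix_of_apply_zero hv0] at this
    exact (mul_eq_zero.mp this).resolve_left (neg_ne_zero.mpr h0)
  have hv2 : ∀ v ∈ W, v 0 = 0 → v 1 = 0 → v 2 = 0 := by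
    intro v hv hv0 hv1
    simpa [hv1] using hcurve v hv hv0
  have h2 := hv2 v hv hv0 hv1
  by_contra hne
  have hv3 : v 3 ≠ 0 := by
    intro h3
    refine hne ?_
    ext j
    fin_cases j
    exacts [hv0, hv1, h2, h3]
  have hall : ∀ w ∈ W, ∃ c : L, c • v = w := by
    intro w hw
    have hdet : ∀ s : L, (syzMatrix e (w + s • v)).det = 0 := fun s =>
      hW.2 _ (W.add_mem hw (W.smul_mem s hv))
    have h00 : w 0 = 0 := by
      -- The second difference at -1, 0, 1 isolates the coefficient `e 0 * v 3 ^ 2 * w 0` of `s ^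
      -- 2`.
      have a := hdet 0
      have b := hdet 1
      have c := hdet (-1)
      simp [syzMatrix, Matrix.det_fin_three, hv0, hv1, h2] at a b c
      have : 2 * (e 0 * v 3 ^ 2 * w 0) = 0 := by
        linear_combination b + c - 2 * a
      simpa [h0, hv3] using this
    have h11 : w 1 = 0 := by
      have a := hcurve _ hw h00
      have b := hcurve _ (W.add_mem hw hv) (by simp [h00, hv0])
      simp [hv1, h2] at b
      have : v 3 * w 1 ^ 2 = 0 := by linear_combination b - a
      simpa [hv3] using this
    refine ⟨w 3 / v 3, ?_⟩
    ext j
    fin_cases j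
    · simp [hv0, h00]
    · simp [hv1, h11]
    · simp [h2, hv2 w hw h00 h11]
    · simp [hv3]
  have : W ≤ Submodule.span L {v} := by
    intro w hw
    obtain ⟨c, rfl⟩ := hall w hw
    exact Submodule.smul_mem _ _ (Submodule.mem_span_singleton_self v)
  have := Submodule.finrank_mono this
  rw [hW.1, finrank_span_singleton hne] at this
  omega

/-- The fourth parameter is forced because the point of the line with `v 0 = 0` lies on the cuspidal
plane section, away from its cusp. -/
theorem IsSurfaceLine.exists_eq_graphPlane [CharZero L] (h0 : e 0 ≠ 0)
    {W : Submodule L (Fin 4 → L)} (hW : IsSurfaceLine e W) :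
    ∃ α τ γ, W = graphPlane α τ γ (τ ^ 3 + e 0 * τ ^ 2) := by
  let π : W →ₗ[L] (Fin 2 → L) :=
    LinearMap.pi ![(LinearMap.proj 0).comp W.subtype, (LinearMap.proj 1).comp W.subtype]
  have hπ : Function.Injective π := by
    rw [← LinearMap.ker_eq_bot, LinearMap.ker_eq_bot']
    intro v hv
    have e0 : v.1 0 = 0 := congrFun hv 0
    have e1 : v.1 1 = 0 := congrFun hv 1
    exact Subtype.ext (hW.eq_zero_of_apply_eq_zero h0 v.2 e0 e1)
  have hsurj : Function.Surjective π :=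
    (LinearMap.injective_iff_surjective_of_finrank_eq_finrank
      (by rw [hW.1, Module.finrank_fin_fun])).mp hπ
  obtain ⟨⟨v, hv⟩, hv'⟩ := hsurj ![1, 0]
  obtain ⟨⟨w, hw⟩, hw'⟩ := hsurj ![0, 1]
  have v0 : v 0 = 1 := congrFun hv' 0
  have v1 : v 1 = 0 := congrFun hv' 1
  have w0 : w 0 = 0 := congrFun hw' 0
  have w1 : w 1 = 1 := congrFun hw' 1
  have w3 : w 3 = w 2 ^ 3 + e 0 * w 2 ^ 2 := by
    have := hW.2 w hw
    rw [det_syzMatrix_of_apply_zero w0, w1] at this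
    refine mul_left_cancel₀ h0 ?_
    linear_combination -this
  refine ⟨v 2, w 2, v 3, eq_graphPlane_of_le hW.1 (graphPlane_le_iff.mpr ⟨?_, ?_⟩)⟩
  · convert hv
    ext j
    fin_cases j <;> simp [v0, v1]
  · convert hw
    ext j
    fin_cases j <;> simp [w0, w1, w3]

theorem exceptionalLine_eq_graphPlane (h : GeneralSextic e θ) (i : Fin 6) :
    exceptionalLine e (θ i) = graphPlane (e 3 - e 0 * θ i ^ 3) (θ i)
      (e 0 * (θ i * e 3 - e 0 * θ i ^ 4 + e 1 * θ i ^ 3 - e 4)) (θ i ^ 3 + e 0 * θ i ^ 2) := by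
  ext v
  exact mem_exceptionalLine_iff h i

theorem finrank_exceptionalLine (h : GeneralSextic e θ) (i : Fin 6) :
    Module.finrank L (exceptionalLine e (θ i)) = 2 := by
  rw [exceptionalLine_eq_graphPlane h, finrank_graphPlane]

theorem isSurfaceLine_exceptionalLine (h : GeneralSextic e θ) (i : Fin 6) :
    IsSurfaceLine e (exceptionalLine e (θ i)) :=
  ⟨finrank_exceptionalLine h i, fun _ hv =>
    Matrix.exists_mulVec_eq_zero_iff.mp ⟨_, cuspPoint_ne_zero _, hv⟩⟩

/-- The line in three-space which is the image of the conic through all six points but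
`cuspPoint t`. -/
def conicLine (e : Fin 6 → L) (t : L) : Submodule L (Fin 4 → L) where
  carrier := {v | leftPoint e t ᵥ* syzMatrix e v = 0}
  zero_mem' := by simp
  add_mem' {v w} hv hw := by
    simp only [Set.mem_ofPred_eq] at hv hw ⊢
    rw [syzMatrix_add, Matrix.vecMul_add, hv, hw, add_zero]
  smul_mem' c v hv := by
    simp only [Set.mem_ofPred_eq] at hv ⊢
    rw [syzMatrix_smul, Matrix.vecMul_smul, hv, smul_zero]

theorem mem_conicLine {t : L} {v : Fin 4 → L} :
    v ∈ conicLine e t ↔ leftPoint e t ᵥ* syzMatrix e v = 0 := Iff.rfl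

/-- Columns 1 and 2 solve for `v 3` and `v 2`; column 0 is then a multiple of the sextic at its
root. -/
theorem conicLine_eq_graphPlane (h : GeneralSextic e θ) (i : Fin 6) :
    conicLine e (θ i) = graphPlane
      (e 0 * (θ i ^ 3 - e 0 * θ i ^ 2 + e 1 * θ i - e 2) + e 3) (θ i - e 0)
      (- e 0 * θ i * (e 0 * (θ i ^ 3 - e 0 * θ i ^ 2 + e 1 * θ i - e 2) + e 3))
      (θ i * (θ i - e 0) ^ 2) := by
  have hP := (h.sextic_eq_zero_iff (θ i)).mpr ⟨i, rfl⟩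
  unfold sextic at hP
  generalize θ i = t at *
  ext v
  rw [mem_conicLine, mem_graphPlane]
  constructor
  · intro hv
    have r1 := congrFun hv 1
    have r2 := congrFun hv 2
    simp [syzMatrix, leftPoint, Matrix.vecMul, dotProduct, Fin.sum_univ_three] at r1 r2
    constructor
    · linear_combination -r2
    · linear_combination r1 + e 0 * t * r2
  · rintro ⟨h2, h3⟩
    ext j
    fin_cases j
    · simp [syzMatrix, leftPoint, Matrix.vecMul, dotProduct, Fin.sum_univ_three, h2, h3]
      linear_combination e 0 * v 0 * hP
    · simp [syzMatrix, leftPoint, Matrix.vecMul, dotProduct, Fin.sum_univ_three, h2, h3]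
      ring
    · simp [syzMatrix, leftPoint, Matrix.vecMul, dotProduct, Fin.sum_univ_three, h2]
      ring

theorem leftPoint_ne_zero (t : L) : leftPoint e t ≠ 0 := fun h => by
  simpa [leftPoint] using congrFun h 2

theorem isSurfaceLine_conicLine (h : GeneralSextic e θ) (i : Fin 6) :
    IsSurfaceLine e (conicLine e (θ i)) :=
  ⟨by rw [conicLine_eq_graphPlane h, finrank_graphPlane], fun _ hv =>
    Matrix.exists_vecMul_eq_zero_iff.mp ⟨_, leftPoint_ne_zero _, hv⟩⟩

/-- `W` is the line in three-space which is the image of the line through the points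
`cuspPoint s` and `cuspPoint t`. -/
def IsChord (e : Fin 6 → L) (s t : L) (W : Submodule L (Fin 4 → L)) : Prop :=
  ∃ v w, v ≠ 0 ∧ w ≠ 0 ∧ v ∈ exceptionalLine e s ∧ w ∈ exceptionalLine e t ∧
    syzMatrix e v *ᵥ cuspPoint t + syzMatrix e w *ᵥ cuspPoint s = 0 ∧
    W = Submodule.span L {v, w}

theorem linearIndependent_cuspPoint {s t : L} (h : s ≠ t) :
    LinearIndependent L ![cuspPoint s, cuspPoint t] := by
  rw [LinearIndependent.pair_iff' (cuspPoint_ne_zero s)]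
  intro a ha
  exact h (eq_of_cuspPoint_eq_smul ha.symm).symm

theorem eq_zero_of_smul_cuspPoint_add {s t : L} (h : s ≠ t) (a b : L)
    (hab : a • cuspPoint s + b • cuspPoint t = 0) : a = 0 ∧ b = 0 := by
  have hli := linearIndependent_cuspPoint h
  rw [LinearIndependent.pair_iff] at hli
  exact hli a b hab

theorem eq_zero_of_mem_exceptionalLine [IsAlgClosed L] [CharZero L] (h : GeneralSextic e θ)
    {i j : Fin 6} (hij : i ≠ j) {v : Fin 4 → L} (hi : v ∈ exceptionalLine e (θ i))
    (hj : v ∈ exceptionalLine e (θ j)) : v = 0 :=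
  eq_zero_of_mulVec_of_linearIndependent h
    (linearIndependent_cuspPoint (h.injective.ne hij)) hi hj

theorem IsChord.finrank_eq_two [IsAlgClosed L] [CharZero L] (h : GeneralSextic e θ)
    {i j : Fin 6} (hij : i ≠ j) {v w : Fin 4 → L} (hv0 : v ≠ 0) (hw0 : w ≠ 0)
    (hv : v ∈ exceptionalLine e (θ i)) (hw : w ∈ exceptionalLine e (θ j)) :
    Module.finrank L (Submodule.span L {v, w}) = 2 := by
  have hli : LinearIndependent L ![v, w] := by
    rw [LinearIndependent.pair_iff' hv0]
    rintro a rfl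
    exact hw0 (eq_zero_of_mem_exceptionalLine h hij (Submodule.smul_mem _ a hv) hw)
  have := finrank_span_eq_card hli
  rwa [Matrix.range_cons_cons_empty, Fintype.card_fin] at this

/-- No three of the six points are collinear. -/
theorem eq_zero_of_cuspPoint_add_cuspPoint_eq (h : GeneralSextic e θ) {i j k : Fin 6}
    (hij : i ≠ j) (hik : i ≠ k) (hjk : j ≠ k) {a b c : L}
    (habc : a • cuspPoint (θ i) + b • cuspPoint (θ j) = c • cuspPoint (θ k)) :
    a = 0 ∧ b = 0 := by
  have h0 := congrFun habc 0
  have h1 := congrFun habc 1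
  have h2 := congrFun habc 2
  simp [cuspPoint] at h0 h1 h2
  have hb : b = 0 := by
    have : (θ j - θ k) * (θ j - θ i) * (θ i + θ j + θ k) ≠ 0 :=
      mul_ne_zero (mul_ne_zero (sub_ne_zero.mpr (h.injective.ne hjk))
        (sub_ne_zero.mpr (h.injective.ne hij.symm))) (h.add_add_ne_zero i j k hij hjk hik)
    refine (mul_eq_zero.mp ?_).resolve_right this
    linear_combination (h2 - θ k ^ 3 * h0) - (θ i ^ 2 + θ i * θ k + θ k ^ 2) * (h1 - θ k * h0)
  subst hb
  refine ⟨(mul_eq_zero.mp ?_).resolve_right (sub_ne_zero.mpr (h.injective.ne hik)), rfl⟩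
  linear_combination h1 - θ k * h0

/-- The square terms vanish on the exceptional lines and the mixed terms cancel, so the points of
the chord are matched linearly with those of `W` on the blow-up. -/
theorem IsChord.mulVec {s t : L} {v w : Fin 4 → L} (hv : v ∈ exceptionalLine e s)
    (hw : w ∈ exceptionalLine e t)
    (h : syzMatrix e v *ᵥ cuspPoint t + syzMatrix e w *ᵥ cuspPoint s = 0) (a b : L) :
    syzMatrix e (a • v + b • w) *ᵥ (a • cuspPoint s + b • cuspPoint t) = 0 := by
  rw [mem_exceptionalLine] at hv hw
  have : a • b • (syzMatrix e v *ᵥ cuspPoint t + syzMatrix e w *ᵥ cuspPoint s) = 0 := by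
    rw [h, smul_zero, smul_zero]
  rw [← this]
  simp only [syzMatrix_add, syzMatrix_smul, Matrix.add_mulVec, Matrix.mulVec_add, Matrix.smul_mulVec,
    Matrix.mulVec_smul, hv, hw]
  module

theorem IsChord.isSurfaceLine [IsAlgClosed L] [CharZero L] (h : GeneralSextic e θ)
    {i j : Fin 6} (hij : i ≠ j) {W : Submodule L (Fin 4 → L)}
    (hW : IsChord e (θ i) (θ j) W) : IsSurfaceLine e W := by
  obtain ⟨v, w, hv0, hw0, hv, hw, hrel, rfl⟩ := hW
  refine ⟨IsChord.finrank_eq_two h hij hv0 hw0 hv hw, fun x hx => ?_⟩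
  obtain ⟨a, b, rfl⟩ := Submodule.mem_span_pair.mp hx
  by_cases hab : a • cuspPoint (θ i) + b • cuspPoint (θ j) = 0
  · obtain ⟨rfl, rfl⟩ := eq_zero_of_smul_cuspPoint_add (h.injective.ne hij) a b hab
    simp
  · exact Matrix.exists_mulVec_eq_zero_iff.mp ⟨_, hab, IsChord.mulVec hv hw hrel a b⟩

/-- The map `v ↦ syzMatrix e v *ᵥ u` as a linear map. -/
def syzMap (e : Fin 6 → L) (u : Fin 3 → L) : (Fin 4 → L) →ₗ[L] (Fin 3 → L) where
  toFun v := syzMatrix e v *ᵥ u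
  map_add' v w := by rw [syzMatrix_add, Matrix.add_mulVec]
  map_smul' c v := by rw [syzMatrix_smul, Matrix.smul_mulVec, RingHom.id_apply]

/-- Dimension count: a product of two planes, of dimension 2 + 2, maps to a space of dimension 3.
Both components of a kernel vector are nonzero since distinct exceptional lines are skew. -/
theorem exists_isChord [IsAlgClosed L] [CharZero L] (h : GeneralSextic e θ)
    {i j : Fin 6} (hij : i ≠ j) : ∃ W, IsChord e (θ i) (θ j) W := by
  let Φ := ((syzMap e (cuspPoint (θ j))).comp (exceptionalLine e (θ i)).subtype).coprod
    ((syzMap e (cuspPoint (θ i))).comp (exceptionalLine e (θ j)).subtype)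
  have hker : LinearMap.ker Φ ≠ ⊥ := LinearMap.ker_ne_bot_of_finrank_lt (by
    rw [Module.finrank_prod, finrank_exceptionalLine h, finrank_exceptionalLine h,
      Module.finrank_fin_fun]
    norm_num)
  obtain ⟨⟨⟨v, hv⟩, ⟨w, hw⟩⟩, hx, hx0⟩ := Submodule.exists_mem_ne_zero_of_ne_bot hker
  have hrel : syzMatrix e v *ᵥ cuspPoint (θ j) + syzMatrix e w *ᵥ cuspPoint (θ i) = 0 := hx
  refine ⟨_, v, w, ?_, ?_, hv, hw, hrel, rfl⟩
  · rintro rfl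
    rw [syzMatrix_zero, Matrix.zero_mulVec, zero_add] at hrel
    have := eq_zero_of_mem_exceptionalLine h hij hrel hw
    exact hx0 (by simp [this])
  · rintro rfl
    rw [syzMatrix_zero, Matrix.zero_mulVec, add_zero] at hrel
    have := eq_zero_of_mem_exceptionalLine h hij hv hrel
    exact hx0 (by simp [this])

theorem cubicMap_add_cuspPoint_ne_zero (h : GeneralSextic e θ) {i j : Fin 6} (hij : i ≠ j) :
    cubicMap e (cuspPoint (θ i) + cuspPoint (θ j)) ≠ 0 := by
  intro hc
  have hli := eq_zero_of_smul_cuspPoint_add (h.injective.ne hij)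
  obtain ⟨k, c, -, hk⟩ := exists_eq_smul_cuspPoint h (fun h0 => by
    simpa using hli 1 1 (by simpa using h0)) hc
  by_cases hik : i = k
  · subst hik
    have := hli (1 - c) 1 (by rw [sub_smul, ← hk]; module)
    simp at this
  by_cases hjk : j = k
  · subst hjk
    have := hli 1 (1 - c) (by rw [sub_smul, ← hk]; module)
    simp at this
  have := eq_zero_of_cuspPoint_add_cuspPoint_eq h hij hik hjk (a := 1) (b := 1) (c := c)
    (by simpa using hk)
  simp at this

/-- The point `cuspPoint (θ i) + cuspPoint (θ j)` is not a base point, so `v + w` is determined up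
to scale, and skewness of the two exceptional lines recovers `v` and `w` from the sum. -/
theorem IsChord.unique [IsAlgClosed L] [CharZero L] (h : GeneralSextic e θ)
    {i j : Fin 6} (hij : i ≠ j) {W W' : Submodule L (Fin 4 → L)}
    (hW : IsChord e (θ i) (θ j) W) (hW' : IsChord e (θ i) (θ j) W') : W = W' := by
  obtain ⟨v, w, hv0, hw0, hv, hw, hrel, rfl⟩ := hW
  obtain ⟨v', w', hv0', hw0', hv', hw', hrel', rfl⟩ := hW'
  have hne := cubicMap_add_cuspPoint_ne_zero h hij
  have key := IsChord.mulVec hv hw hrel 1 1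
  have key' := IsChord.mulVec hv' hw' hrel' 1 1
  simp only [one_smul] at key key'
  obtain ⟨c, hc⟩ := eq_smul_cubicMap h.coeff_ne_zero hne key
  obtain ⟨c', hc'⟩ := eq_smul_cubicMap h.coeff_ne_zero hne key'
  have hc0 : c ≠ 0 := by
    rintro rfl
    rw [zero_smul, add_eq_zero_iff_eq_neg] at hc
    exact hv0 (eq_zero_of_mem_exceptionalLine h hij hv (hc ▸ Submodule.neg_mem _ hw))
  have hsum : c' • v - c • v' = c • w' - c' • w := by
    have : c' • (v + w) = c • (v' + w') := by rw [hc, hc', smul_comm]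
    rw [smul_add, smul_add] at this
    rw [sub_eq_sub_iff_add_eq_add, this, add_comm]
  have hz : c' • v - c • v' = 0 :=
    eq_zero_of_mem_exceptionalLine h hij
      (Submodule.sub_mem _ (Submodule.smul_mem _ _ hv) (Submodule.smul_mem _ _ hv'))
      (hsum ▸ Submodule.sub_mem _ (Submodule.smul_mem _ _ hw') (Submodule.smul_mem _ _ hw))
  rw [hz] at hsum
  have e1 : v' = (c⁻¹ * c') • v := by
    rw [mul_smul, sub_eq_zero.mp hz, inv_smul_smul₀ hc0]
  have e2 : w' = (c⁻¹ * c') • w := by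
    rw [mul_smul, ← sub_eq_zero.mp hsum.symm, inv_smul_smul₀ hc0]
  have hle : Submodule.span L {v', w'} ≤ Submodule.span L {v, w} := by
    rw [Submodule.span_le, e1, e2]
    rintro x (rfl | rfl)
    · exact Submodule.smul_mem _ _ (Submodule.subset_span (by simp))
    · exact Submodule.smul_mem _ _ (Submodule.subset_span (by simp))
  refine (Submodule.eq_of_le_of_finrank_eq hle ?_).symm
  rw [IsChord.finrank_eq_two h hij hv0 hw0 hv hw, IsChord.finrank_eq_two h hij hv0' hw0' hv' hw']

end Lines

/-! ### Classification of the lines and their incidence with the exceptional lines. -/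

section Lines

variable {L : Type*} [Field L] {e θ : Fin 6 → L}

theorem cubicDeriv_combination_left (e : Fin 6 → L) (q s : L) (a b : Fin 3 → L) :
    cubicDeriv e (q • a + s • b) a = (3 * q ^ 2) • cubicMap e a + (2 * q * s) • cubicDeriv e a b
      + s ^ 2 • cubicDeriv e b a := by
  ext j
  fin_cases j <;> simp [cubicMap, cubicDeriv] <;> ring

theorem cubicMap_combination (e : Fin 6 → L) (q s : L) (a b : Fin 3 → L) :
    cubicMap e (q • a + s • b) = q ^ 3 • cubicMap e a + (q ^ 2 * s) • cubicDeriv e a b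
      + (q * s ^ 2) • cubicDeriv e b a + s ^ 3 • cubicMap e b := by
  ext j
  fin_cases j <;> simp [cubicMap, cubicDeriv] <;> ring

/-- Along a pencil `a + s • b` whose image under the syzygies is the line through `v` and `w`, the
cubics are a quadratic polynomial in `s` times `v + s • w`. -/
theorem exists_quadratic_factor [IsAlgClosed L] [CharZero L] (h : GeneralSextic e θ)
    {a b : Fin 3 → L} {v w : Fin 4 → L} (hv0 : v 0 = 1) (hw0 : w 0 = 0) (hw1 : w 1 = 1)
    (ha : syzMatrix e v *ᵥ a = 0) (hb : syzMatrix e w *ᵥ b = 0)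
    (hab : syzMatrix e v *ᵥ b + syzMatrix e w *ᵥ a = 0) :
    ∃ k₀ k₁ k₂ : L, cubicMap e a = k₀ • v ∧ cubicDeriv e a b = k₁ • v + k₀ • w ∧
      cubicDeriv e b a = k₂ • v + k₁ • w ∧ cubicMap e b = k₂ • w := by
  -- Off the base points the cubics are proportional to `v + s • w`, whose coordinate 0 is 1; so the
  -- factor is coordinate 0 of the cubics.
  have hfac : ∀ s : L, cubicMap e (a + s • b) = cubicMap e (a + s • b) 0 • (v + s • w) := by
    intro s
    by_cases hc : cubicMap e (a + s • b) = 0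
    · rw [hc, Pi.zero_apply, zero_smul]
    · have hs : syzMatrix e (v + s • w) *ᵥ (a + s • b) = 0 := by
        have : s • (syzMatrix e v *ᵥ b + syzMatrix e w *ᵥ a) = 0 := by rw [hab, smul_zero]
        rw [← this]
        simp only [syzMatrix_add, syzMatrix_smul, Matrix.add_mulVec, Matrix.mulVec_add,
          Matrix.smul_mulVec, Matrix.mulVec_smul, ha, hb]
        module
      obtain ⟨c, hcv⟩ := eq_smul_cubicMap h.coeff_ne_zero hc hs
      have h1 : c * cubicMap e (a + s • b) 0 = 1 := by
        have := congrFun hcv 0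
        simp [hv0, hw0] at this
        exact this.symm
      rw [hcv, smul_smul, mul_comm, h1, one_smul]
  have hcoef : ∀ j, cubicMap e a j - cubicMap e a 0 * v j = 0 ∧
      cubicDeriv e a b j - cubicDeriv e a b 0 * v j - cubicMap e a 0 * w j = 0 ∧
      cubicDeriv e b a j - cubicDeriv e b a 0 * v j - cubicDeriv e a b 0 * w j = 0 ∧
      cubicMap e b j - cubicMap e b 0 * v j - cubicDeriv e b a 0 * w j = 0 ∧
      - (cubicMap e b 0 * w j) = 0 := by
    intro j
    refine coeffs_eq_zero_of_forall fun s => ?_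
    have h1 := congrFun (hfac s) j
    rw [cubicMap_add_smul] at h1
    simp only [Pi.add_apply, Pi.smul_apply, smul_eq_mul] at h1
    linear_combination h1
  -- The right side of `hfac` a priori has degree 4 in `s`; its top coefficient vanishes, so the
  -- factor is quadratic.
  have hk : cubicMap e b 0 = 0 := by
    simpa [hw1] using (hcoef 1).2.2.2.2
  refine ⟨cubicMap e a 0, cubicDeriv e a b 0, cubicDeriv e b a 0, ?_, ?_, ?_, ?_⟩ <;> ext j <;>
    simp only [Pi.add_apply, Pi.smul_apply, smul_eq_mul]
  · linear_combination (hcoef j).1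
  · linear_combination (hcoef j).2.1
  · linear_combination (hcoef j).2.2.1
  · linear_combination (hcoef j).2.2.2.1 + v j * hk

/-- The pencil traces a line in the plane on which the cubics have a common quadratic factor. Its
zeros are base points: two distinct ones make the line a chord, and a double zero contradicts the
reducedness of the base points. -/
theorem exists_isChord_of_pencil [IsAlgClosed L] [CharZero L] (h : GeneralSextic e θ)
    {a b : Fin 3 → L} {v w : Fin 4 → L} (hv0 : v 0 = 1) (hw0 : w 0 = 0) (hw1 : w 1 = 1)
    (hli : LinearIndependent L ![a, b])
    (ha : syzMatrix e v *ᵥ a = 0) (hb : syzMatrix e w *ᵥ b = 0)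
    (hab : syzMatrix e v *ᵥ b + syzMatrix e w *ᵥ a = 0) {W : Submodule L (Fin 4 → L)}
    (hW : Module.finrank L W = 2) (hv : v ∈ W) (hw : w ∈ W) :
    ∃ i j, i ≠ j ∧ IsChord e (θ i) (θ j) W := by
  rw [LinearIndependent.pair_iff] at hli
  obtain ⟨k₀, k₁, k₂, f₀, f₁, f₂, f₃⟩ := exists_quadratic_factor h hv0 hw0 hw1 ha hb hab
  have hbase : ∀ q s : L, (q ≠ 0 ∨ s ≠ 0) → k₀ * q ^ 2 + k₁ * q * s + k₂ * s ^ 2 = 0 →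
      ∃ i, ∃ c : L, c ≠ 0 ∧ q • a + s • b = c • cuspPoint (θ i) := by
    intro q s hqs hz
    refine exists_eq_smul_cuspPoint h (fun h0 => ?_) ?_
    · obtain ⟨rfl, rfl⟩ := hli q s h0
      simp at hqs
    · have : cubicMap e (q • a + s • b) =
          (k₀ * q ^ 2 + k₁ * q * s + k₂ * s ^ 2) • (q • v + s • w) := by
        rw [cubicMap_combination, f₀, f₁, f₂, f₃]
        module
      rw [this, hz, zero_smul]
  rcases binary_quadratic_zeros k₀ k₁ k₂ with ⟨q₁, s₁, q₂, s₂, hne, hz₁, hz₂⟩ | ⟨q, s, hqs, h1, h2⟩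
  · obtain ⟨i, c, hc, hi⟩ := hbase q₁ s₁ (by
      by_contra! h0
      simp [h0.1, h0.2] at hne) hz₁
    obtain ⟨j, d, hd, hj⟩ := hbase q₂ s₂ (by
      by_contra! h0
      simp [h0.1, h0.2] at hne) hz₂
    have hvw : ∀ q s : L, q • v + s • w = 0 → q = 0 ∧ s = 0 := by
      intro q s hqs
      have e0 := congrFun hqs 0
      have e1 := congrFun hqs 1
      simp [hv0, hw0] at e0
      simp [hw1, e0] at e1
      exact ⟨e0, e1⟩
    have hij : i ≠ j := by
      rintro rfl
      have : d • (q₁ • a + s₁ • b) - c • (q₂ • a + s₂ • b) = 0 := by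
        rw [hi, hj, smul_comm, sub_self]
      obtain ⟨g1, g2⟩ := hli (d * q₁ - c * q₂) (d * s₁ - c * s₂) (by rw [← this]; module)
      refine hne ((mul_eq_zero.mp (?_ : c * _ = 0)).resolve_left hc)
      linear_combination q₁ * (-g2) + s₁ * g1
    -- The bilinear expression is alternating in the parameters, so it vanishes at equal parameters.
    -- This puts the two image points on their exceptional lines.
    have hmul : ∀ q s q' s' : L, syzMatrix e (q • v + s • w) *ᵥ (q' • a + s' • b) =
        (q * s' - s * q') • (syzMatrix e v *ᵥ b) := by
      intro q s q' s'
      have : syzMatrix e w *ᵥ a = - (syzMatrix e v *ᵥ b) := eq_neg_of_add_eq_zero_right hab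
      simp only [syzMatrix_add, syzMatrix_smul, Matrix.add_mulVec, Matrix.mulVec_add,
        Matrix.smul_mulVec, Matrix.mulVec_smul, ha, hb, this]
      module
    have hi' : cuspPoint (θ i) = c⁻¹ • (q₁ • a + s₁ • b) := by rw [hi, inv_smul_smul₀ hc]
    have hj' : cuspPoint (θ j) = d⁻¹ • (q₂ • a + s₂ • b) := by rw [hj, inv_smul_smul₀ hd]
    have hx0 : c⁻¹ • (q₁ • v + s₁ • w) ≠ 0 := by
      refine smul_ne_zero (inv_ne_zero hc) fun h0 => ?_
      obtain ⟨rfl, rfl⟩ := hvw _ _ h0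
      simp at hne
    have hy0 : d⁻¹ • (q₂ • v + s₂ • w) ≠ 0 := by
      refine smul_ne_zero (inv_ne_zero hd) fun h0 => ?_
      obtain ⟨rfl, rfl⟩ := hvw _ _ h0
      simp at hne
    have hx : c⁻¹ • (q₁ • v + s₁ • w) ∈ exceptionalLine e (θ i) := by
      rw [mem_exceptionalLine, hi', syzMatrix_smul, Matrix.smul_mulVec, Matrix.mulVec_smul, hmul]
      module
    have hy : d⁻¹ • (q₂ • v + s₂ • w) ∈ exceptionalLine e (θ j) := by
      rw [mem_exceptionalLine, hj', syzMatrix_smul, Matrix.smul_mulVec, Matrix.mulVec_smul, hmul]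
      module
    refine ⟨i, j, hij, _, _, hx0, hy0, hx, hy, ?_, ?_⟩
    · rw [hi', hj', syzMatrix_smul, Matrix.smul_mulVec, Matrix.mulVec_smul, hmul,
        syzMatrix_smul, Matrix.smul_mulVec, Matrix.mulVec_smul, hmul]
      module
    · refine (Submodule.eq_of_le_of_finrank_eq ?_ ?_).symm
      · rw [Submodule.span_le]
        rintro x (rfl | rfl)
        · exact W.smul_mem _ (W.add_mem (W.smul_mem _ hv) (W.smul_mem _ hw))
        · exact W.smul_mem _ (W.add_mem (W.smul_mem _ hv) (W.smul_mem _ hw))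
      · rw [hW, IsChord.finrank_eq_two h hij hx0 hy0 hx hy]
  -- At a double zero the derivatives along both `a` and `b` vanish, so both are multiples of the
  -- same base point, against their independence.
  · exfalso
    obtain ⟨i, c, hc, hi⟩ := hbase q s hqs (by linear_combination (q * h1 + s * h2) / 2)
    have hda : cubicDeriv e (q • a + s • b) a = 0 := by
      have : cubicDeriv e (q • a + s • b) a =
          (2 * k₀ * q + k₁ * s) • (q • v + s • w)
            + (k₀ * q ^ 2 + k₁ * q * s + k₂ * s ^ 2) • v := by
        rw [cubicDeriv_combination_left, f₀, f₁, f₂]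
        module
      rw [this, h1]
      have : k₀ * q ^ 2 + k₁ * q * s + k₂ * s ^ 2 = 0 := by
        linear_combination (q * h1 + s * h2) / 2
      rw [this, zero_smul, zero_smul, zero_add]
    have hdb : cubicDeriv e (q • a + s • b) b = 0 := by
      have : cubicDeriv e (q • a + s • b) b =
          (k₁ * q + 2 * k₂ * s) • (q • v + s • w)
            + (k₀ * q ^ 2 + k₁ * q * s + k₂ * s ^ 2) • w := by
        rw [add_comm, cubicDeriv_combination_left, f₁, f₂, f₃]
        module
      rw [this, h2]
      have : k₀ * q ^ 2 + k₁ * q * s + k₂ * s ^ 2 = 0 := by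
        linear_combination (q * h1 + s * h2) / 2
      rw [this, zero_smul, zero_smul, zero_add]
    rw [hi, cubicDeriv_smul_left, smul_eq_zero_iff_right (pow_ne_zero 2 hc)] at hda hdb
    have ea := eq_smul_of_cubicDeriv_eq_zero h i hda
    have eb := eq_smul_of_cubicDeriv_eq_zero h i hdb
    have hzero := hli (b 0) (- a 0) (by
      ext j
      have ea' := congrFun ea j
      have eb' := congrFun eb j
      simp only [Pi.smul_apply, Pi.add_apply, smul_eq_mul, Pi.zero_apply] at ea' eb' ⊢
      linear_combination b 0 * ea' - a 0 * eb')
    have hb0 : b = 0 := by rw [eb, hzero.1, zero_smul]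
    have := hli 0 1 (by rw [hb0]; simp)
    exact one_ne_zero this.2

/-- The classification of the lines on the determinantal cubic surface. -/
theorem IsSurfaceLine.trichotomy [IsAlgClosed L] [CharZero L] (h : GeneralSextic e θ)
    {W : Submodule L (Fin 4 → L)} (hW : IsSurfaceLine e W) :
    (∃ i, W = exceptionalLine e (θ i)) ∨ (∃ i j, i ≠ j ∧ IsChord e (θ i) (θ j) W) ∨
      ∃ i, W = conicLine e (θ i) := by
  obtain ⟨α, τ, γ, hWg⟩ := hW.exists_eq_graphPlane h.coeff_ne_zero
  set v : Fin 4 → L := ![1, 0, α, γ] with hv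
  set w : Fin 4 → L := ![0, 1, τ, τ ^ 3 + e 0 * τ ^ 2] with hw
  have hvW : v ∈ W := hWg ▸ fst_mem_graphPlane _ _ _ _
  have hwW : w ∈ W := hWg ▸ snd_mem_graphPlane _ _ _ _
  have hdet : ∀ s : L, (syzMatrix e v + s • syzMatrix e w).det = 0 := by
    intro s
    rw [← syzMatrix_smul, ← syzMatrix_add]
    exact hW.2 _ (W.add_mem hvW (W.smul_mem s hwW))
  have hle : ∀ {W' : Submodule L (Fin 4 → L)}, Module.finrank L W' = 2 → v ∈ W' → w ∈ W' →
      W = W' := by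
    intro W' hW' h1 h2
    rw [hWg, eq_graphPlane_of_le hW' (graphPlane_le_iff.mpr ⟨h1, h2⟩)]
  -- Coordinate 0 of the cross product of the first two rows at `w` is `w 1 ^ 2 = 1`.
  rcases singular_pencil_trichotomy hdet (fun h0 => by
      have := congrFun h0 0
      simp [syzMatrix, hw, cross_apply] at this) with
    ⟨u, hu, huv, huw⟩ | ⟨a, b, hli, ha, hb, hab⟩ | ⟨x, hx, hxv, hxw⟩
  · left
    -- If the constant kernel vector were not a base point, `v` and `w` would both be multiples of
    -- its image.
    obtain ⟨i, c, hc, hi⟩ := exists_eq_smul_cuspPoint h hu (by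
      by_contra hne
      obtain ⟨c, hc⟩ := eq_smul_cubicMap h.coeff_ne_zero hne huv
      obtain ⟨d, hd⟩ := eq_smul_cubicMap h.coeff_ne_zero hne huw
      have c0 := congrFun hc 0
      have d0 := congrFun hd 0
      have d1 := congrFun hd 1
      simp [hv, hw] at c0 d0 d1
      rcases d0 with rfl | d0
      · simp at d1
      · simp [d0] at c0)
    rw [hi, Matrix.mulVec_smul, smul_eq_zero_iff_right hc] at huv huw
    exact ⟨i, hle (finrank_exceptionalLine h i) huv huw⟩
  · right; left
    exact exists_isChord_of_pencil h (by simp [hv]) (by simp [hw]) (by simp [hw]) hli ha hb hab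
      hW.1 hvW hwW
  · right; right
    have hx2 : x 2 ≠ 0 := by
      intro h2
      have r0 := congrFun hxw 0
      have r1 := congrFun hxw 1
      have r2 := congrFun hxw 2
      simp [syzMatrix, hw, Matrix.vecMul, dotProduct, Fin.sum_univ_three, h2] at r0 r1 r2
      simp [r2] at r1
      refine hx ?_
      ext j
      fin_cases j
      exacts [r1, r2, h2]
    obtain ⟨y, hy⟩ : ∃ y, y = (x 2)⁻¹ • x := ⟨_, rfl⟩
    have hy2 : y 2 = 1 := by simp [hy, hx2]
    have hyv : y ᵥ* syzMatrix e v = 0 := by rw [hy, Matrix.smul_vecMul, hxv, smul_zero]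
    have hyw : y ᵥ* syzMatrix e w = 0 := by rw [hy, Matrix.smul_vecMul, hxw, smul_zero]
    have r1 := congrFun hyw 1
    have r2 := congrFun hyw 2
    have q0 := congrFun hyv 0
    have q1 := congrFun hyv 1
    have q2 := congrFun hyv 2
    simp [syzMatrix, hv, hw, Matrix.vecMul, dotProduct, Fin.sum_univ_three, hy2] at r1 r2 q0 q1 q2
    -- For a conic line with root `t` the slope in `graphPlane` is `τ = t - e 0`.
    obtain ⟨t, ht⟩ : ∃ t, t = τ + e 0 := ⟨_, rfl⟩
    have hyt : y = leftPoint e t := by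
      have hy1 : y 1 = -t := by linear_combination -r2 + ht
      ext j
      fin_cases j
      · simp [leftPoint, ht]
        linear_combination -r1 - e 0 * τ * (hy1 - ht)
      · simpa [leftPoint] using hy1
      · simpa [leftPoint] using hy2
    rw [hyt] at q0 q1 q2
    simp [leftPoint] at q0 q1 q2
    obtain ⟨i, hi⟩ := (h.sextic_eq_zero_iff t).mp (by
      -- Eliminating the coordinates of `v` from the three column equations leaves `e 0` times the
      -- sextic at `t`.
      refine mul_left_cancel₀ h.coeff_ne_zero ?_
      unfold sextic
      linear_combination q0 + t * q1 + t ^ 3 * q2)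
    refine ⟨i, hle (isSurfaceLine_conicLine h i).1 ?_ ?_⟩
    · rw [mem_conicLine, hi, ← hyt, hyv]
    · rw [mem_conicLine, hi, ← hyt, hyw]

/-- The indices of those of the six exceptional lines which meet `W`. -/
def incidence (e θ : Fin 6 → L) (W : Submodule L (Fin 4 → L)) : Set (Fin 6) :=
  {i | ∃ v ∈ W, v ≠ 0 ∧ v ∈ exceptionalLine e (θ i)}

theorem incidence_exceptionalLine [IsAlgClosed L] [CharZero L] (h : GeneralSextic e θ)
    (i : Fin 6) : incidence e θ (exceptionalLine e (θ i)) = {i} := by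
  ext j
  constructor
  · rintro ⟨v, hv, hv0, hj⟩
    by_contra hij
    exact hv0 (eq_zero_of_mem_exceptionalLine h hij hj hv)
  · rintro rfl
    have : ![1, 0, e 3 - e 0 * θ j ^ 3,
        e 0 * (θ j * e 3 - e 0 * θ j ^ 4 + e 1 * θ j ^ 3 - e 4)] ∈ exceptionalLine e (θ j) := by
      rw [exceptionalLine_eq_graphPlane h]
      exact fst_mem_graphPlane _ _ _ _
    exact ⟨_, this, fun h0 => by simpa using congrFun h0 0, this⟩

theorem IsChord.incidence_eq [IsAlgClosed L] [CharZero L] (h : GeneralSextic e θ)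
    {i j : Fin 6} (hij : i ≠ j) {W : Submodule L (Fin 4 → L)} (hW : IsChord e (θ i) (θ j) W) :
    incidence e θ W = {i, j} := by
  obtain ⟨v, w, hv0, hw0, hv, hw, hrel, rfl⟩ := hW
  ext k
  constructor
  · rintro ⟨x, hx, hx0, hk⟩
    obtain ⟨a, b, rfl⟩ := Submodule.mem_span_pair.mp hx
    by_contra hne
    simp only [Set.mem_insert_iff, Set.mem_singleton_iff, not_or] at hne
    obtain ⟨c, hc⟩ := eq_smul_of_mulVec h hx0 (cuspPoint_ne_zero _) hk
      (IsChord.mulVec hv hw hrel a b)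
    obtain ⟨rfl, rfl⟩ := eq_zero_of_cuspPoint_add_cuspPoint_eq h hij (Ne.symm hne.1)
      (Ne.symm hne.2) hc
    simp at hx0
  · rintro (rfl | rfl)
    · exact ⟨v, Submodule.subset_span (by simp), hv0, hv⟩
    · exact ⟨w, Submodule.subset_span (by simp), hw0, hw⟩

/-- In the coordinates `(v 0, v 1)` of the exceptional line, membership in the conic line is two
linear equations. For `i ≠ k` the second follows from the first, so a nonzero solution exists. -/
theorem incidence_conicLine [IsAlgClosed L] [CharZero L] (h : GeneralSextic e θ)
    (k : Fin 6) : incidence e θ (conicLine e (θ k)) = {k}ᶜ := by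
  ext i
  constructor
  · rintro ⟨v, hv, hv0, hi⟩ rfl
    exact hv0 (eq_zero_of_leftPoint_of_cuspPoint h i hv hi)
  · intro hik
    have hne : θ k - θ i ≠ 0 := sub_ne_zero.mpr (h.injective.ne (Ne.symm hik))
    have hPi := (h.sextic_eq_zero_iff (θ i)).mpr ⟨i, rfl⟩
    have hPk := (h.sextic_eq_zero_iff (θ k)).mpr ⟨k, rfl⟩
    unfold sextic at hPi hPk
    obtain ⟨a, b, hab, hrel⟩ : ∃ a b : L, (a ≠ 0 ∨ b ≠ 0) ∧ (θ k - e 0 - θ i) * b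
        + e 0 * (θ i ^ 3 + θ k ^ 3 - e 0 * θ k ^ 2 + e 1 * θ k - e 2) * a = 0 := by
      by_cases h0 : θ k - e 0 - θ i = 0
      · exact ⟨0, 1, by simp, by rw [h0]; ring⟩
      · exact ⟨θ k - e 0 - θ i, -(e 0 * (θ i ^ 3 + θ k ^ 3 - e 0 * θ k ^ 2 + e 1 * θ k - e 2)),
          Or.inl h0, by ring⟩
    refine ⟨![a, b, (e 3 - e 0 * θ i ^ 3) * a + θ i * b,
      e 0 * (θ i * e 3 - e 0 * θ i ^ 4 + e 1 * θ i ^ 3 - e 4) * a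
        + (θ i ^ 3 + e 0 * θ i ^ 2) * b], ?_, ?_, ?_⟩
    · rw [conicLine_eq_graphPlane h, mem_graphPlane]
      constructor
      · simp
        linear_combination -hrel
      · simp
        -- After multiplication by `θ k - θ i` the second equation is a multiple of the first plus
        -- `e 0 * a` times the difference of the two sextic values, both zero.
        refine mul_left_cancel₀ hne ?_
        linear_combination (-(θ k - θ i) * (θ k ^ 2 + θ i * θ k + θ i ^ 2)) * hrel
          + e 0 * θ k * (θ k - θ i) * hrel + e 0 * a * (hPk - hPi)
    · intro h0
      have h1 := congrFun h0 0
      have h2 := congrFun h0 1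
      simp at h1 h2
      simp [h1, h2] at hab
    · rw [exceptionalLine_eq_graphPlane h, mem_graphPlane]
      simp

end Lines

/-! ### The 27 lines correspond to the subsets of size 1, 2 and 5 of the six indices. -/

section Lines

variable {L : Type*} [Field L] {e θ : Fin 6 → L}

theorem IsChord.symm {s t : L} {W : Submodule L (Fin 4 → L)} (hW : IsChord e s t W) :
    IsChord e t s W := by
  obtain ⟨v, w, hv0, hw0, hv, hw, hrel, rfl⟩ := hW
  exact ⟨w, v, hw0, hv0, hw, hv, by rw [add_comm, hrel], by rw [Set.pair_comm]⟩

theorem ncard_compl_singleton_fin_six (i : Fin 6) : ({i}ᶜ : Set (Fin 6)).ncard = 5 := by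
  rw [Set.ncard_compl, Set.ncard_singleton]
  simp

theorem ncard_incidence [IsAlgClosed L] [CharZero L] (h : GeneralSextic e θ)
    {W : Submodule L (Fin 4 → L)} (hW : IsSurfaceLine e W) :
    (incidence e θ W).ncard = 1 ∨ (incidence e θ W).ncard = 2 ∨ (incidence e θ W).ncard = 5 := by
  rcases hW.trichotomy h with ⟨i, rfl⟩ | ⟨i, j, hij, hc⟩ | ⟨i, rfl⟩
  · exact Or.inl (by rw [incidence_exceptionalLine h, Set.ncard_singleton])
  · exact Or.inr (Or.inl (by rw [hc.incidence_eq h hij, Set.ncard_pair hij]))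
  · exact Or.inr (Or.inr (by rw [incidence_conicLine h, ncard_compl_singleton_fin_six]))

/-- The size of the set tells the family of the line, and within a family the set tells the index or
the pair of indices. -/
theorem incidence_injOn [IsAlgClosed L] [CharZero L] (h : GeneralSextic e θ) :
    Set.InjOn (incidence e θ) {W | IsSurfaceLine e W} := by
  intro W hW W' hW' heq
  have hcard := congrArg Set.ncard heq
  rcases IsSurfaceLine.trichotomy h hW with ⟨i, rfl⟩ | ⟨i, j, hij, hc⟩ | ⟨i, rfl⟩ <;>
    rcases IsSurfaceLine.trichotomy h hW' with ⟨i', rfl⟩ | ⟨i', j', hij', hc'⟩ | ⟨i', rfl⟩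
  · rw [incidence_exceptionalLine h, incidence_exceptionalLine h, Set.singleton_eq_singleton_iff]
      at heq
    rw [heq]
  · rw [incidence_exceptionalLine h, hc'.incidence_eq h hij', Set.ncard_singleton,
      Set.ncard_pair hij'] at hcard
    omega
  · rw [incidence_exceptionalLine h, incidence_conicLine h, Set.ncard_singleton,
      ncard_compl_singleton_fin_six] at hcard
    omega
  · rw [incidence_exceptionalLine h, hc.incidence_eq h hij, Set.ncard_singleton,
      Set.ncard_pair hij] at hcard
    omega
  · rw [hc.incidence_eq h hij, hc'.incidence_eq h hij', Set.pair_eq_pair_iff] at heq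
    rcases heq with ⟨rfl, rfl⟩ | ⟨rfl, rfl⟩
    · exact hc.unique h hij hc'
    · exact hc.unique h hij hc'.symm
  · rw [hc.incidence_eq h hij, incidence_conicLine h, Set.ncard_pair hij,
      ncard_compl_singleton_fin_six] at hcard
    omega
  · rw [incidence_exceptionalLine h, incidence_conicLine h, Set.ncard_singleton,
      ncard_compl_singleton_fin_six] at hcard
    omega
  · rw [hc'.incidence_eq h hij', incidence_conicLine h, Set.ncard_pair hij',
      ncard_compl_singleton_fin_six] at hcard
    omega
  · rw [incidence_conicLine h, incidence_conicLine h, compl_inj_iff,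
      Set.singleton_eq_singleton_iff] at heq
    rw [heq]

theorem exists_incidence_eq [IsAlgClosed L] [CharZero L] (h : GeneralSextic e θ)
    {I : Set (Fin 6)} (hI : I.ncard = 1 ∨ I.ncard = 2 ∨ I.ncard = 5) :
    ∃ W, IsSurfaceLine e W ∧ incidence e θ W = I := by
  rcases hI with hI | hI | hI
  · obtain ⟨i, rfl⟩ := Set.ncard_eq_one.mp hI
    exact ⟨_, isSurfaceLine_exceptionalLine h i, incidence_exceptionalLine h i⟩
  · obtain ⟨i, j, hij, rfl⟩ := Set.ncard_eq_two.mp hI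
    obtain ⟨W, hW⟩ := exists_isChord h hij
    exact ⟨W, hW.isSurfaceLine h hij, hW.incidence_eq h hij⟩
  · have : Iᶜ.ncard = 1 := by
      rw [Set.ncard_compl, hI]
      simp
    obtain ⟨i, hi⟩ := Set.ncard_eq_one.mp this
    refine ⟨_, isSurfaceLine_conicLine h i, ?_⟩
    rw [incidence_conicLine h, ← hi, compl_compl]

end Lines

/-! ### Rationality of lines and Galois stability of index sets. -/

section Galois

variable {K L : Type*} [Field K] [Field L] [Algebra K L]

/-- A subspace of `L ^ n` which is spanned by vectors with coordinates in `K`. -/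
def IsRationalSubspace (K : Type*) {L : Type*} [Field K] [Field L] [Algebra K L]
    (W : Submodule L (Fin 4 → L)) : Prop :=
  ∃ W₀ : Submodule K (Fin 4 → K),
    W = Submodule.span L ((fun w j => algebraMap K L (w j)) '' (W₀ : Set (Fin 4 → K)))

/-- The conjugate of a subspace under a field automorphism. -/
def conjSubspace (σ : L ≃ₐ[K] L) (W : Submodule L (Fin 4 → L)) : Submodule L (Fin 4 → L) where
  carrier := {v | σ.symm ∘ v ∈ W}
  zero_mem' := by
    have : (σ.symm ∘ (0 : Fin 4 → L)) = 0 := by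
      ext j
      simp
    rw [Set.mem_ofPred_eq, this]
    exact W.zero_mem
  add_mem' {v w} hv hw := by
    have : σ.symm ∘ (v + w) = σ.symm ∘ v + σ.symm ∘ w := by
      ext j
      simp
    rw [Set.mem_ofPred_eq, this]
    exact W.add_mem hv hw
  smul_mem' c v hv := by
    have : σ.symm ∘ (c • v) = σ.symm c • (σ.symm ∘ v) := by
      ext j
      simp
    rw [Set.mem_ofPred_eq, this]
    exact W.smul_mem _ hv

theorem mem_conjSubspace {σ : L ≃ₐ[K] L} {W : Submodule L (Fin 4 → L)} {v : Fin 4 → L} :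
    v ∈ conjSubspace σ W ↔ σ.symm ∘ v ∈ W := Iff.rfl

theorem comp_mem_conjSubspace {σ : L ≃ₐ[K] L} {W : Submodule L (Fin 4 → L)} {v : Fin 4 → L}
    (hv : v ∈ W) : σ ∘ v ∈ conjSubspace σ W := by
  rw [mem_conjSubspace]
  convert hv
  ext j
  simp

theorem conjSubspace_graphPlane (σ : L ≃ₐ[K] L) (α τ γ δ : L) :
    conjSubspace σ (graphPlane α τ γ δ) = graphPlane (σ α) (σ τ) (σ γ) (σ δ) := by
  ext v
  rw [mem_conjSubspace, mem_graphPlane, mem_graphPlane]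
  simp only [Function.comp_apply]
  constructor
  · rintro ⟨h2, h3⟩
    have h2' := congrArg σ h2
    have h3' := congrArg σ h3
    simp at h2' h3'
    exact ⟨h2', h3'⟩
  · rintro ⟨h2, h3⟩
    simp [h2, h3]

theorem graphPlane_injective {α τ γ δ α' τ' γ' δ' : L}
    (h : graphPlane α τ γ δ = graphPlane α' τ' γ' δ') : α = α' ∧ τ = τ' ∧ γ = γ' ∧ δ = δ' := by
  have h0 : ![1, 0, α, γ] ∈ graphPlane α' τ' γ' δ' := h ▸ fst_mem_graphPlane _ _ _ _
  have h1 : ![0, 1, τ, δ] ∈ graphPlane α' τ' γ' δ' := h ▸ snd_mem_graphPlane _ _ _ _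
  rw [mem_graphPlane] at h0 h1
  simp at h0 h1
  exact ⟨h0.1, h1.1, h0.2, h1.2⟩

theorem isRationalSubspace_graphPlane (α τ γ δ : K) :
    IsRationalSubspace K (graphPlane (algebraMap K L α) (algebraMap K L τ) (algebraMap K L γ)
      (algebraMap K L δ)) := by
  refine ⟨graphPlane α τ γ δ, le_antisymm (graphPlane_le_iff.mpr ⟨?_, ?_⟩) ?_⟩
  · refine Submodule.subset_span ⟨_, fst_mem_graphPlane α τ γ δ, ?_⟩
    ext j
    fin_cases j <;> simp
  · refine Submodule.subset_span ⟨_, snd_mem_graphPlane α τ γ δ, ?_⟩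
    ext j
    fin_cases j <;> simp
  · rw [Submodule.span_le]
    rintro _ ⟨v, ⟨h2, h3⟩, rfl⟩
    refine ⟨?_, ?_⟩
    · simp only [h2, map_add, map_mul]
    · simp only [h3, map_add, map_mul]

theorem IsRationalSubspace.comp_mem {W : Submodule L (Fin 4 → L)} (hW : IsRationalSubspace K W)
    (σ : L ≃ₐ[K] L) {v : Fin 4 → L} (hv : v ∈ W) : σ ∘ v ∈ W := by
  obtain ⟨W₀, hW₀⟩ := hW
  have hle : W ≤ conjSubspace σ.symm W := by
    conv_lhs => rw [hW₀]
    rw [Submodule.span_le]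
    rintro _ ⟨w, hw, rfl⟩
    rw [SetLike.mem_coe, mem_conjSubspace]
    have : (σ.symm.symm ∘ fun j => algebraMap K L (w j)) = fun j => algebraMap K L (w j) := by
      ext j
      simp
    rw [this, hW₀]
    exact Submodule.subset_span ⟨w, hw, rfl⟩
  exact hle hv

/-- A set of indices which is stable under the Galois action on the `θ i`. -/
def IsGaloisStable (K : Type*) {L : Type*} [Field K] [Field L] [Algebra K L] (θ : Fin 6 → L)
    (I : Set (Fin 6)) : Prop :=
  ∀ (σ : L ≃ₐ[K] L) (i j : Fin 6), σ (θ i) = θ j → i ∈ I → j ∈ I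

variable {a : Fin 6 → K} {θ : Fin 6 → L}

theorem algEquiv_comp_algebraMap_comp (σ : L ≃ₐ[K] L) :
    σ ∘ (algebraMap K L ∘ a) = algebraMap K L ∘ a := by
  ext j
  simp

theorem comp_mem_exceptionalLine (σ : L ≃ₐ[K] L) {t : L} {v : Fin 4 → L}
    (hv : v ∈ exceptionalLine (algebraMap K L ∘ a) t) :
    σ ∘ v ∈ exceptionalLine (algebraMap K L ∘ a) (σ t) := by
  rw [mem_exceptionalLine] at hv ⊢
  ext i
  have h1 := congrArg σ (congrFun hv i)
  have h2 : σ ∘ cuspPoint t = cuspPoint (σ t) := by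
    ext j
    fin_cases j <;> simp [cuspPoint]
  simp only [Matrix.mulVec, dotProduct, map_sum, map_mul, Pi.zero_apply, map_zero] at h1 ⊢
  rw [← h1]
  refine Finset.sum_congr rfl fun j _ => ?_
  have h3 := map_syzMatrix (algebraMap K L ∘ a) (σ : L →+* L) v i j
  have h4 : ((σ : L →+* L) : L → L) ∘ (algebraMap K L ∘ a) = algebraMap K L ∘ a :=
    algEquiv_comp_algebraMap_comp σ
  rw [h4] at h3
  have h5 : ((σ : L →+* L) : L → L) ∘ v = σ ∘ v := rfl
  rw [h5] at h3
  rw [← h3, ← h2]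
  rfl

theorem exists_root_eq (h : GeneralSextic (algebraMap K L ∘ a) θ) (σ : L ≃ₐ[K] L) (i : Fin 6) :
    ∃ j, θ j = σ (θ i) := by
  rw [← h.sextic_eq_zero_iff]
  have := congrArg σ ((h.sextic_eq_zero_iff (θ i)).mpr ⟨i, rfl⟩)
  simpa [sextic] using this

/-- The Galois group permutes the exceptional lines as it permutes the roots. A line with stable
index set equals its conjugates, because the index set determines the line; its coordinates as a
`graphPlane` are then fixed, hence lie in `K`. -/
theorem isRationalSubspace_iff [IsAlgClosed L] [CharZero L] [IsGalois K L]
    (h : GeneralSextic (algebraMap K L ∘ a) θ) {W : Submodule L (Fin 4 → L)}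
    (hW : IsSurfaceLine (algebraMap K L ∘ a) W) :
    IsRationalSubspace K W ↔ IsGaloisStable K θ (incidence (algebraMap K L ∘ a) θ W) := by
  constructor
  · rintro hr σ i j hij ⟨v, hv, hv0, hi⟩
    refine ⟨σ ∘ v, hr.comp_mem σ hv, fun h0 => hv0 ?_, hij ▸ comp_mem_exceptionalLine σ hi⟩
    ext k
    simpa using congrFun h0 k
  · intro hI
    obtain ⟨α, τ, γ, hg⟩ := hW.exists_eq_graphPlane h.coeff_ne_zero
    have hconj : ∀ σ : L ≃ₐ[K] L, conjSubspace σ W = W := by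
      intro σ
      refine incidence_injOn h ?_ hW ?_
      · refine ⟨?_, fun v hv => ?_⟩
        · rw [hg, conjSubspace_graphPlane, finrank_graphPlane]
        · have := hW.2 _ hv
          have hd : σ.symm ((syzMatrix (algebraMap K L ∘ a) v).det) = 0 := by
            rw [← this]
            have : syzMatrix (algebraMap K L ∘ a) (σ.symm ∘ v) =
                (σ.symm : L →+* L).mapMatrix (syzMatrix (algebraMap K L ∘ a) v) := by
              ext i j
              rw [RingHom.mapMatrix_apply, Matrix.map_apply, map_syzMatrix]
              congr 1
              exact (algEquiv_comp_algebraMap_comp σ.symm).symm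
            rw [this, ← RingHom.map_det]
            rfl
          simpa using hd
      · ext i
        constructor
        · rintro ⟨v, hv, hv0, hi⟩
          obtain ⟨j, hj⟩ := exists_root_eq h σ.symm i
          refine hI σ j i (by rw [hj]; simp) ⟨σ.symm ∘ v, hv, fun h0 => hv0 ?_, ?_⟩
          · ext k
            simpa using congrFun h0 k
          · rw [hj]
            exact comp_mem_exceptionalLine σ.symm hi
        · intro hi
          obtain ⟨j, hj⟩ := exists_root_eq h σ.symm i
          obtain ⟨v, hv, hv0, hvj⟩ := hI σ.symm i j hj.symm hi
          refine ⟨σ ∘ v, comp_mem_conjSubspace hv, fun h0 => hv0 ?_, ?_⟩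
          · ext k
            simpa using congrFun h0 k
          · have := comp_mem_exceptionalLine σ hvj
            rw [hj] at this
            simpa using this
    have hfix : ∀ σ : L ≃ₐ[K] L, σ α = α ∧ σ τ = τ ∧ σ γ = γ := by
      intro σ
      have := hconj σ
      rw [hg, conjSubspace_graphPlane] at this
      have := graphPlane_injective this
      exact ⟨this.1, this.2.1, this.2.2.1⟩
    obtain ⟨α', rfl⟩ := (InfiniteGalois.mem_range_algebraMap_iff_fixed α).mpr fun σ => (hfix σ).1
    obtain ⟨τ', rfl⟩ := (InfiniteGalois.mem_range_algebraMap_iff_fixed τ).mpr fun σ => (hfix σ).2.1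
    obtain ⟨γ', rfl⟩ := (InfiniteGalois.mem_range_algebraMap_iff_fixed γ).mpr fun σ => (hfix σ).2.2
    rw [hg]
    have := isRationalSubspace_graphPlane (L := L) α' τ' γ' (τ' ^ 3 + a 0 * τ' ^ 2)
    simpa using this

end Galois

/-! ### The blow-up is cut out by the bilinear syzygies. -/

section BlowUp

variable {L : Type*} [Field L] {e θ : Fin 6 → L}

/-- The bilinear syzygies as polynomials in two groups of variables, in coordinates of three-space
that are changed by the matrix `B`. -/
noncomputable def syzPolynomial (e : Fin 6 → L) (B : Matrix (Fin 4) (Fin 4) L) (i : Fin 3) :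
    MvPolynomial (Fin 3 ⊕ Fin 4) L :=
  ∑ j, syzMatrix (MvPolynomial.C ∘ e)
    (fun k => ∑ l, MvPolynomial.C (B k l) * MvPolynomial.X (Sum.inr l)) i j *
      MvPolynomial.X (Sum.inl j)

theorem eval_syzPolynomial (B : Matrix (Fin 4) (Fin 4) L) (i : Fin 3) (u : Fin 3 → L)
    (v : Fin 4 → L) : MvPolynomial.eval (Sum.elim u v) (syzPolynomial e B i) =
      (syzMatrix e (B *ᵥ v) *ᵥ u) i := by
  simp only [syzPolynomial, map_sum, map_mul, MvPolynomial.eval_X, Sum.elim_inl, map_syzMatrix,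
    Matrix.mulVec, dotProduct]
  refine Finset.sum_congr rfl fun j _ => ?_
  congr 3
  · ext k
    simp
  · ext k
    simp [Matrix.mulVec, dotProduct]

variable {A B : Matrix (Fin 4) (Fin 4) L} {f : Fin 4 → MvPolynomial (Fin 3) L}

/-- The syzygies are bihomogeneous polynomials that vanish on the graph, hence on its closure. -/
theorem mulVec_eq_zero_of_mem_blowUp (hBA : B * A = 1)
    (hf : ∀ u, (fun j => MvPolynomial.eval u (f j)) = A *ᵥ cubicMap e u)
    {u : Fin 3 → L} {hu : u ≠ 0} {v : Fin 4 → L} {hv : v ≠ 0}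
    (hz : (Projectivization.mk L u hu, Projectivization.mk L v hv) ∈ blowUp f) :
    syzMatrix e (B *ᵥ v) *ᵥ u = 0 := by
  ext i
  rw [← eval_syzPolynomial]
  refine hz (syzPolynomial e B i) ?_ u hu v hv rfl
  rintro _ ⟨u₀, hu₀, hv₀, rfl⟩ u hu v hv huv
  rw [Prod.mk.injEq, Projectivization.mk_eq_mk_iff', Projectivization.mk_eq_mk_iff'] at huv
  obtain ⟨⟨c, rfl⟩, ⟨d, rfl⟩⟩ := huv
  rw [eval_syzPolynomial, hf, Matrix.mulVec_smul B d, Matrix.mulVec_mulVec, hBA, Matrix.one_mulVec,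
    syzMatrix_smul, Matrix.smul_mulVec, Matrix.mulVec_smul, syzMatrix_cubicMap_mulVec]
  simp

/-- A polynomial that vanishes along a pointed curve, parametrized by polynomials, vanishes at the
centre of the parametrization. -/
theorem eval_eq_zero_of_forall_ne [Infinite L] {ι : Type*} (g : MvPolynomial ι L)
    (γ : ι → L[X]) (q : L[X]) (hq : q ≠ 0)
    (h : ∀ s, q.eval s ≠ 0 → MvPolynomial.eval (fun i => (γ i).eval s) g = 0) (s : L) :
    MvPolynomial.eval (fun i => (γ i).eval s) g = 0 := by
  have heval : ∀ s, (MvPolynomial.aeval γ g).eval s =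
      MvPolynomial.eval (fun i => (γ i).eval s) g := by
    intro s
    have := MvPolynomial.map_aeval γ (Polynomial.evalRingHom s) g
    rw [Polynomial.coe_evalRingHom] at this
    rw [this, MvPolynomial.coe_eval₂Hom]
    have h2 : (Polynomial.evalRingHom s).comp (algebraMap L L[X]) = RingHom.id L := by
      ext x
      simp
    rw [h2]
    rfl
  have hzero : MvPolynomial.aeval γ g * q = 0 := by
    refine Polynomial.funext fun s => ?_
    rw [Polynomial.eval_mul, Polynomial.eval_zero, heval]
    by_cases hs : q.eval s = 0
    · rw [hs, mul_zero]
    · rw [h s hs, zero_mul]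
  rw [← heval, (mul_eq_zero.mp hzero).resolve_right hq, Polynomial.eval_zero]

/-- Off the base points the pair lies on the graph itself. Over a base point it is a limit of graph
points along a line whose direction is given by `exists_cubicDeriv_eq`. -/
theorem mem_blowUp_of_mulVec_eq_zero [IsAlgClosed L] [CharZero L] (h : GeneralSextic e θ)
    (hAB : A * B = 1) (hBA : B * A = 1)
    (hf : ∀ u, (fun j => MvPolynomial.eval u (f j)) = A *ᵥ cubicMap e u)
    {u : Fin 3 → L} {hu : u ≠ 0} {v : Fin 4 → L} {hv : v ≠ 0}
    (hz : syzMatrix e (B *ᵥ v) *ᵥ u = 0) :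
    (Projectivization.mk L u hu, Projectivization.mk L v hv) ∈ blowUp f := by
  have hA0 : ∀ x, A *ᵥ x = 0 → x = 0 := by
    intro x hx
    rw [← Matrix.one_mulVec x, ← hBA, ← Matrix.mulVec_mulVec, hx, Matrix.mulVec_zero]
  intro g hg u' hu' v' hv' huv
  have hz' : syzMatrix e (B *ᵥ v') *ᵥ u' = 0 := by
    rw [Prod.mk.injEq, Projectivization.mk_eq_mk_iff', Projectivization.mk_eq_mk_iff'] at huv
    obtain ⟨⟨c, rfl⟩, ⟨d, rfl⟩⟩ := huv
    rw [Matrix.mulVec_smul B d, syzMatrix_smul, Matrix.smul_mulVec, Matrix.mulVec_smul, hz]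
    simp
  clear huv hz
  have hv'' : v' = A *ᵥ (B *ᵥ v') := by rw [Matrix.mulVec_mulVec, hAB, Matrix.one_mulVec]
  by_cases hc : cubicMap e u' = 0
  · obtain ⟨i, c, hc0, hi⟩ := exists_eq_smul_cuspPoint h hu' hc
    rw [hi, Matrix.mulVec_smul, smul_eq_zero_iff_right hc0] at hz'
    obtain ⟨w, hw⟩ := exists_cubicDeriv_eq h i hz'
    have hw' : cubicDeriv e u' ((c ^ 2)⁻¹ • w) = B *ᵥ v' := by
      rw [hi, cubicDeriv_smul_left, cubicDeriv_smul_right, hw, smul_inv_smul₀ (pow_ne_zero 2 hc0)]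
    obtain ⟨x, hx⟩ : ∃ x, x = (c ^ 2)⁻¹ • w := ⟨_, rfl⟩
    rw [← hx] at hw'
    -- `d` is `cubicMap e (u' + s • x) / s`, a polynomial in `s` because `u'` is a base point; its
    -- value at 0 is `B *ᵥ v'`. Where `s ≠ 0` and `d j ≠ 0`, the curve `γ` runs in the graph.
    let d : Fin 4 → L[X] := fun j => C (cubicDeriv e u' x j) + X * C (cubicDeriv e x u' j)
      + X ^ 2 * C (cubicMap e x j)
    let γ : Fin 3 ⊕ Fin 4 → L[X] :=
      Sum.elim (fun i => C (u' i) + X * C (x i)) (fun j => ∑ k, C (A j k) * d k)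
    have hd : ∀ s : L, s • (fun j => (d j).eval s) = cubicMap e (u' + s • x) := by
      intro s
      rw [cubicMap_add_smul, hc]
      ext j
      simp [d]
      ring
    have hBv : B *ᵥ v' ≠ 0 := by
      intro h0
      rw [h0, Matrix.mulVec_zero] at hv''
      exact hv' hv''
    obtain ⟨j, hj⟩ := Function.ne_iff.mp hBv
    have hq : X * d j ≠ 0 := by
      refine mul_ne_zero X_ne_zero fun h0 => hj ?_
      have := congrArg (Polynomial.eval 0) h0
      simp only [d] at this
      simpa [hw'] using this
    have hγ : ∀ s, (fun i => (γ i).eval s) =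
        Sum.elim (u' + s • x) (A *ᵥ fun j => (d j).eval s) := by
      intro s
      ext i
      rcases i with i | i
      · simp [γ]
        ring
      · simp [γ, Matrix.mulVec, dotProduct, Polynomial.eval_finsetSum]
    have key := eval_eq_zero_of_forall_ne g γ (X * d j) hq (fun s hs => by
      rw [Polynomial.eval_mul, Polynomial.eval_X, mul_ne_zero_iff] at hs
      have hds : (fun j => (d j).eval s) ≠ 0 := fun h0 => hs.2 (congrFun h0 j)
      have hcs : cubicMap e (u' + s • x) ≠ 0 := by
        rw [← hd]
        exact smul_ne_zero hs.1 hds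
      have hus : u' + s • x ≠ 0 := by
        intro h0
        rw [h0] at hcs
        refine hcs ?_
        have := cubicMap_smul e 0 (0 : Fin 3 → L)
        simpa using this
      rw [hγ]
      refine hg _ ⟨u' + s • x, hus, ?_, rfl⟩ _ hus _ (fun h0 => hds (hA0 _ h0)) ?_
      · rw [hf]
        exact fun h0 => hcs (hA0 _ h0)
      · rw [Prod.mk.injEq]
        refine ⟨rfl, ?_⟩
        rw [Projectivization.mk_eq_mk_iff']
        refine ⟨s⁻¹, ?_⟩
        rw [hf, ← hd, Matrix.mulVec_smul, inv_smul_smul₀ hs.1]) 0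
    rw [hγ] at key
    have h0 : (fun j => (d j).eval 0) = B *ᵥ v' := by
      rw [← hw']
      ext j
      simp [d]
    rw [h0, ← hv'', zero_smul, add_zero] at key
    exact key
  · obtain ⟨c, hcv⟩ := eq_smul_cubicMap h.coeff_ne_zero hc hz'
    have hc0 : c ≠ 0 := by
      rintro rfl
      rw [hcv, zero_smul, Matrix.mulVec_zero] at hv''
      exact hv' hv''
    refine hg _ ⟨u', hu', ?_, rfl⟩ u' hu' v' hv' ?_
    · rw [hf]
      exact fun h0 => hc (hA0 _ h0)
    · rw [Prod.mk.injEq]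
      refine ⟨rfl, ?_⟩
      rw [Projectivization.mk_eq_mk_iff']
      refine ⟨c, ?_⟩
      rw [hf, hv'', hcv, Matrix.mulVec_smul]

theorem mk_mem_blowUp_iff [IsAlgClosed L] [CharZero L] (h : GeneralSextic e θ)
    (hAB : A * B = 1) (hBA : B * A = 1)
    (hf : ∀ u, (fun j => MvPolynomial.eval u (f j)) = A *ᵥ cubicMap e u)
    {u : Fin 3 → L} {hu : u ≠ 0} {v : Fin 4 → L} {hv : v ≠ 0} :
    (Projectivization.mk L u hu, Projectivization.mk L v hv) ∈ blowUp f ↔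
      syzMatrix e (B *ᵥ v) *ᵥ u = 0 :=
  ⟨mulVec_eq_zero_of_mem_blowUp hBA hf, mem_blowUp_of_mulVec_eq_zero h hAB hBA hf⟩

theorem mk_mem_blowUpSurface_iff [IsAlgClosed L] [CharZero L] (h : GeneralSextic e θ)
    (hAB : A * B = 1) (hBA : B * A = 1)
    (hf : ∀ u, (fun j => MvPolynomial.eval u (f j)) = A *ᵥ cubicMap e u)
    {v : Fin 4 → L} {hv : v ≠ 0} :
    Projectivization.mk L v hv ∈ blowUpSurface f ↔ (syzMatrix e (B *ᵥ v)).det = 0 := by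
  rw [← Matrix.exists_mulVec_eq_zero_iff]
  constructor
  · rintro ⟨⟨x, y⟩, hxy, rfl : y = _⟩
    induction x using Projectivization.ind with
    | h u hu => exact ⟨u, hu, (mk_mem_blowUp_iff h hAB hBA hf).mp hxy⟩
  · rintro ⟨u, hu, huv⟩
    exact ⟨(Projectivization.mk L u hu, Projectivization.mk L v hv),
      (mk_mem_blowUp_iff h hAB hBA hf).mpr huv, rfl⟩

theorem injOn_snd_blowUp [IsAlgClosed L] [CharZero L] (h : GeneralSextic e θ)
    (hAB : A * B = 1) (hBA : B * A = 1)
    (hf : ∀ u, (fun j => MvPolynomial.eval u (f j)) = A *ᵥ cubicMap e u) :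
    Set.InjOn Prod.snd (blowUp f) := by
  rintro ⟨x, y⟩ hxy ⟨x', y'⟩ hxy' (rfl : y = y')
  induction x using Projectivization.ind with
  | h u hu =>
    induction x' using Projectivization.ind with
    | h u' hu' =>
      induction y using Projectivization.ind with
      | h v hv =>
        rw [mk_mem_blowUp_iff h hAB hBA hf] at hxy hxy'
        have hBv : B *ᵥ v ≠ 0 := by
          intro h0
          have : v = A *ᵥ (B *ᵥ v) := by rw [Matrix.mulVec_mulVec, hAB, Matrix.one_mulVec]
          rw [h0, Matrix.mulVec_zero] at this
          exact hv this
        obtain ⟨c, hc⟩ := eq_smul_of_mulVec h hBv hu' hxy' hxy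
        rw [Prod.mk.injEq]
        exact ⟨(Projectivization.mk_eq_mk_iff' L u u' hu hu').mpr ⟨c, hc.symm⟩, rfl⟩

end BlowUp

/-! ### The equation of the surface and its partial derivatives. -/

section Smooth

/-- Jacobi's formula; it turns the partial derivatives of the determinantal form into the traces of
`eq_zero_of_trace_adjugate_mul`. -/
theorem derivation_det_fin_three {R A : Type*} [CommRing R] [CommRing A] [Algebra R A]
    (D : Derivation R A A) (M : Matrix (Fin 3) (Fin 3) A) :
    D M.det = (M.adjugate * M.map D).trace := by
  simp [Matrix.det_fin_three, Matrix.adjugate_fin_three, Matrix.trace_fin_three,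
    Matrix.vecMul, dotProduct, Fin.sum_univ_three, Derivation.leibniz]
  ring

theorem derivation_syzMatrix {R A : Type*} [CommRing R] [CommRing A] [Algebra R A]
    (D : Derivation R A A) (a : Fin 6 → A) (ha : ∀ i, D (a i) = 0) (v : Fin 4 → A) :
    (syzMatrix a v).map D = syzMatrix a (D ∘ v) := by
  ext i j
  fin_cases i <;> fin_cases j <;> simp [syzMatrix, Derivation.leibniz, ha]

variable {K L : Type*} [Field K] [Field L] [Algebra K L] {a : Fin 6 → K} {θ : Fin 6 → L}

/-- The determinant of the syzygy matrix, as a cubic form in coordinates of three-space changed by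
the matrix `H`. -/
noncomputable def surfaceForm (a : Fin 6 → K) (H : Matrix (Fin 4) (Fin 4) K) :
    MvPolynomial (Fin 4) K :=
  (syzMatrix (MvPolynomial.C ∘ a)
    fun k => ∑ l, MvPolynomial.C (H k l) * MvPolynomial.X l).det

theorem isHomogeneous_surfaceForm (a : Fin 6 → K) (H : Matrix (Fin 4) (Fin 4) K) :
    (surfaceForm a H).IsHomogeneous 3 := by
  have hentry : ∀ i j, (syzMatrix (MvPolynomial.C ∘ a)
      (fun k => ∑ l, MvPolynomial.C (H k l) * MvPolynomial.X l) i j).IsHomogeneous 1 := by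
    intro i j
    rw [syzMatrix_apply_eq_sum]
    refine MvPolynomial.IsHomogeneous.sum _ _ _ fun k _ => ?_
    have hC : syzMatrix (MvPolynomial.C ∘ a) (Pi.single k 1) i j =
        (MvPolynomial.C (syzMatrix a (Pi.single k 1) i j) : MvPolynomial (Fin 4) K) := by
      rw [map_syzMatrix]
      congr 1
      ext l
      by_cases hl : l = k
      · subst hl
        simp
      · simp [hl]
    rw [hC]
    refine MvPolynomial.IsHomogeneous.mul (m := 1) (n := 0) ?_ (MvPolynomial.isHomogeneous_C _ _)
    refine MvPolynomial.IsHomogeneous.sum _ _ _ fun l _ => ?_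
    exact MvPolynomial.IsHomogeneous.mul (m := 0) (n := 1) (MvPolynomial.isHomogeneous_C _ _)
      (MvPolynomial.isHomogeneous_X _ _)
  rw [surfaceForm, Matrix.det_apply]
  refine MvPolynomial.IsHomogeneous.sum _ _ _ fun σ _ => ?_
  have : (∏ i, syzMatrix (MvPolynomial.C ∘ a)
      (fun k => ∑ l, MvPolynomial.C (H k l) * MvPolynomial.X l) (σ i) i).IsHomogeneous 3 := by
    simpa using MvPolynomial.IsHomogeneous.prod Finset.univ _ (fun _ => 1)
      fun i _ => hentry (σ i) i
  rcases Int.units_eq_one_or (Equiv.Perm.sign σ) with h | h <;> rw [h]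
  · simpa using this
  · simpa using this.neg

theorem aeval_syzMatrix_apply (w : Fin 4 → MvPolynomial (Fin 4) K)
    (v : Fin 4 → L) (i j : Fin 3) :
    MvPolynomial.aeval v (syzMatrix (MvPolynomial.C ∘ a) w i j) =
      syzMatrix (algebraMap K L ∘ a) (fun k => MvPolynomial.aeval v (w k)) i j := by
  have := map_syzMatrix (MvPolynomial.C ∘ a)
    (MvPolynomial.aeval (R := K) v : MvPolynomial (Fin 4) K →ₐ[K] L).toRingHom w i j
  refine this.trans ?_
  congr 1
  ext l
  simp

theorem aeval_linearForms (H : Matrix (Fin 4) (Fin 4) K) (v : Fin 4 → L) :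
    (fun k => MvPolynomial.aeval v (∑ l, MvPolynomial.C (H k l) * MvPolynomial.X l :
      MvPolynomial (Fin 4) K)) = H.map (algebraMap K L) *ᵥ v := by
  ext k
  simp [Matrix.mulVec, dotProduct]

theorem aeval_surfaceForm (H : Matrix (Fin 4) (Fin 4) K) (v : Fin 4 → L) :
    MvPolynomial.aeval v (surfaceForm a H) =
      (syzMatrix (algebraMap K L ∘ a) (H.map (algebraMap K L) *ᵥ v)).det := by
  rw [surfaceForm, AlgHom.map_det]
  congr 1
  ext i j
  rw [AlgHom.mapMatrix_apply, Matrix.map_apply, aeval_syzMatrix_apply, aeval_linearForms]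

theorem aeval_pderiv_surfaceForm (H : Matrix (Fin 4) (Fin 4) K) (v : Fin 4 → L) (k : Fin 4) :
    MvPolynomial.aeval v (MvPolynomial.pderiv k (surfaceForm a H)) =
      ((syzMatrix (algebraMap K L ∘ a) (H.map (algebraMap K L) *ᵥ v)).adjugate *
        syzMatrix (algebraMap K L ∘ a) (H.map (algebraMap K L) *ᵥ Pi.single k 1)).trace := by
  have hmap : ∀ M : Matrix (Fin 3) (Fin 3) (MvPolynomial (Fin 4) K),
      MvPolynomial.aeval v M.trace = ((MvPolynomial.aeval (R := K) v).mapMatrix M).trace := by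
    intro M
    simp [Matrix.trace]
  rw [surfaceForm, derivation_det_fin_three, derivation_syzMatrix _ _ (by simp), hmap, map_mul,
    AlgHom.map_adjugate]
  congr 3
  · ext i j
    rw [AlgHom.mapMatrix_apply, Matrix.map_apply, aeval_syzMatrix_apply, aeval_linearForms]
  · ext i j
    rw [AlgHom.mapMatrix_apply, Matrix.map_apply, aeval_syzMatrix_apply]
    congr 1
    ext l
    simp [MvPolynomial.pderiv_X, Pi.single_apply]

theorem isSmoothCubicSurfaceOver_blowUpSurface [IsAlgClosed L] [CharZero L]
    (h : GeneralSextic (algebraMap K L ∘ a) θ) {G H : Matrix (Fin 4) (Fin 4) K}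
    (hGH : G.map (algebraMap K L) * H.map (algebraMap K L) = 1)
    (hHG : H.map (algebraMap K L) * G.map (algebraMap K L) = 1)
    {f : Fin 4 → MvPolynomial (Fin 3) L}
    (hf : ∀ u, (fun j => MvPolynomial.eval u (f j)) =
      G.map (algebraMap K L) *ᵥ cubicMap (algebraMap K L ∘ a) u) :
    IsSmoothCubicSurfaceOver K (blowUpSurface f) := by
  refine ⟨surfaceForm a H, isHomogeneous_surfaceForm a H, fun v hv => ?_, fun v hv hz => ?_⟩
  · rw [mk_mem_blowUpSurface_iff h hGH hHG hf, aeval_surfaceForm]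
  · by_contra! hd
    rw [aeval_surfaceForm] at hz
    simp only [aeval_pderiv_surfaceForm] at hd
    -- The trace is linear in the direction, so its vanishing on the coordinate vectors suffices.
    have hlin : ∀ x, ((syzMatrix (algebraMap K L ∘ a) (H.map (algebraMap K L) *ᵥ v)).adjugate *
        syzMatrix (algebraMap K L ∘ a) (H.map (algebraMap K L) *ᵥ x)).trace = 0 := by
      let Ψ : (Fin 4 → L) →ₗ[L] L :=
        { toFun := fun x =>
            ((syzMatrix (algebraMap K L ∘ a) (H.map (algebraMap K L) *ᵥ v)).adjugate *
              syzMatrix (algebraMap K L ∘ a) (H.map (algebraMap K L) *ᵥ x)).trace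
          map_add' := fun x y => by
            rw [Matrix.mulVec_add, syzMatrix_add, mul_add, Matrix.trace_add]
          map_smul' := fun c x => by
            rw [Matrix.mulVec_smul, syzMatrix_smul, Matrix.mul_smul, Matrix.trace_smul,
              RingHom.id_apply] }
      have hΨ : Ψ = 0 := by
        refine LinearMap.pi_ext' fun k => LinearMap.ext_ring ?_
        exact hd k
      exact fun x => LinearMap.congr_fun hΨ x
    have h0 := eq_zero_of_trace_adjugate_mul h hz fun x => by
      have := hlin (G.map (algebraMap K L) *ᵥ x)
      rwa [Matrix.mulVec_mulVec, hHG, Matrix.one_mulVec] at this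
    refine hv ?_
    rw [← Matrix.one_mulVec v, ← hGH, ← Matrix.mulVec_mulVec, h0, Matrix.mulVec_zero]

end Smooth

/-! ### Rational bases of the space of cubics through the six points. -/

section Basis

/-- A ternary cubic form as the sum of its ten terms. -/
theorem MvPolynomial.IsHomogeneous.eq_sum_of_three_three {R : Type*} [CommRing R]
    {f : MvPolynomial (Fin 3) R} (hf : f.IsHomogeneous 3) :
    ∃ c : Fin 10 → R, f =
      C (c 0) * X 0 ^ 3 + C (c 1) * X 0 ^ 2 * X 1 + C (c 2) * X 0 * X 1 ^ 2 + C (c 3) * X 1 ^ 3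
        + C (c 4) * X 0 ^ 2 * X 2 + C (c 5) * X 0 * X 1 * X 2 + C (c 6) * X 1 ^ 2 * X 2
        + C (c 7) * X 0 * X 2 ^ 2 + C (c 8) * X 1 * X 2 ^ 2 + C (c 9) * X 2 ^ 3 := by
  have hsum : f = ∑ x ∈ Finset.Nat.antidiagonalTuple 3 3,
      monomial (Finsupp.equivFunOnFinite.symm x)
        (coeff (Finsupp.equivFunOnFinite.symm x) f) := by
    ext d
    rw [coeff_sum]
    simp only [coeff_monomial]
    by_cases hd : d.degree = 3
    · rw [Finset.sum_eq_single (Finsupp.equivFunOnFinite d)]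
      · simp
      · intro b _ hb
        rw [if_neg]
        rintro rfl
        simp at hb
      · intro hb
        exfalso
        apply hb
        rw [Finset.Nat.mem_antidiagonalTuple]
        exact (Finsupp.degree_eq_sum d).symm.trans hd
    · rw [hf.coeff_eq_zero hd, Finset.sum_eq_zero]
      intro x hx
      rw [if_neg]
      rintro rfl
      apply hd
      rw [Finset.Nat.mem_antidiagonalTuple] at hx
      exact (Finsupp.degree_eq_sum _).trans hx
  have hT : Finset.Nat.antidiagonalTuple 3 3 = {![3, 0, 0], ![2, 1, 0], ![1, 2, 0], ![0, 3, 0],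
      ![2, 0, 1], ![1, 1, 1], ![0, 2, 1], ![1, 0, 2], ![0, 1, 2], ![0, 0, 3]} := by
    decide
  have hmono : ∀ (x : Fin 3 → ℕ) (r : R), monomial (Finsupp.equivFunOnFinite.symm x) r =
      C r * X 0 ^ x 0 * X 1 ^ x 1 * X 2 ^ x 2 := by
    intro x r
    rw [monomial_eq, Finsupp.prod_fintype _ _ (by simp), Fin.prod_univ_three]
    simp [mul_assoc]
  let k : (Fin 3 → ℕ) → R := fun x => coeff (Finsupp.equivFunOnFinite.symm x) f
  refine ⟨![k ![3, 0, 0], k ![2, 1, 0], k ![1, 2, 0], k ![0, 3, 0],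
      k ![2, 0, 1], k ![1, 1, 1], k ![0, 2, 1], k ![1, 0, 2], k ![0, 1, 2], k ![0, 0, 3]], ?_⟩
  conv_lhs => rw [hsum]
  simp only [hmono]
  rw [hT]
  repeat rw [Finset.sum_insert (by decide)]
  rw [Finset.sum_singleton]
  simp [k]
  ring

variable {K L : Type*} [Field K] [Field L] [Algebra K L] {a : Fin 6 → K} {θ : Fin 6 → L}

/-- The components of `cubicMap a` as cubic forms. -/
noncomputable def basisCubics (a : Fin 6 → K) : Fin 4 → MvPolynomial (Fin 3) K :=
  cubicMap (MvPolynomial.C ∘ a) MvPolynomial.X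

theorem aeval_basisCubics (a : Fin 6 → K) (u : Fin 3 → L) (j : Fin 4) :
    MvPolynomial.aeval u (basisCubics a j) = cubicMap (algebraMap K L ∘ a) u j := by
  have := map_cubicMap (MvPolynomial.C ∘ a)
    (MvPolynomial.aeval (R := K) u : MvPolynomial (Fin 3) K →ₐ[K] L).toRingHom
    MvPolynomial.X j
  refine this.trans ?_
  congr 1
  · ext l
    simp
  · ext l
    simp

theorem eval_basisCubics (a : Fin 6 → K) (u : Fin 3 → K) (j : Fin 4) :
    MvPolynomial.eval u (basisCubics a j) = cubicMap a u j :=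
  aeval_basisCubics (L := K) a u j

theorem extendScalars_basisCubics (a : Fin 6 → K) :
    extendScalars L (basisCubics a) = basisCubics (algebraMap K L ∘ a) := by
  ext1 j
  refine (map_cubicMap (MvPolynomial.C ∘ a) (MvPolynomial.map (algebraMap K L))
    MvPolynomial.X j).trans ?_
  rw [basisCubics]
  congr 1
  · ext1 l
    simp
  · ext1 l
    simp

theorem isHomogeneous_basisCubics (a : Fin 6 → K) (j : Fin 4) :
    (basisCubics a j).IsHomogeneous 3 := by
  have T : ∀ (r : K) (i j k : Fin 3), (MvPolynomial.C r * (MvPolynomial.X i * MvPolynomial.X j *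
      MvPolynomial.X k) : MvPolynomial (Fin 3) K).IsHomogeneous 3 := fun r i j k =>
    (((MvPolynomial.isHomogeneous_X K i).mul (MvPolynomial.isHomogeneous_X K j)).mul
      (MvPolynomial.isHomogeneous_X K k)).C_mul r
  fin_cases j
  · convert (T 1 0 0 2).add (T (-1) 1 1 1) using 1
    simp [basisCubics, cubicMap]
    ring
  · convert (((((((T 1 0 2 2).add (T (-a 0) 1 1 2)).add (T (a 1) 0 1 2)).add
      (T (-a 2) 0 0 2)).add (T (a 3) 0 1 1)).add (T (-a 4) 0 0 1)).add (T (a 5) 0 0 0)) using 1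
    simp [basisCubics, cubicMap]
    ring
  · convert (((((((T 1 1 2 2).add (T (-a 0) 0 2 2)).add (T (a 1) 1 1 2)).add
      (T (-a 2) 0 1 2)).add (T (a 3) 0 0 2)).add (T (-a 4) 0 1 1)).add (T (a 5) 0 0 1)) using 1
    simp [basisCubics, cubicMap]
    ring
  · convert (((((((T 1 2 2 2).add (T (a 1 - a 0 ^ 2) 1 2 2)).add (T (a 0 * a 1 - a 2) 0 2 2)).add
      (T (a 3 - a 0 * a 2) 1 1 2)).add (T (a 0 * a 3 - a 4) 0 1 2)).add
      (T (a 5 - a 0 * a 4) 0 0 2)).add (T (a 0 * a 5) 0 1 1)) using 1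
    simp [basisCubics, cubicMap]
    ring

/-- The cubic forms over `K` through the six points are spanned by `basisCubics a`. -/
theorem exists_eq_sum_basisCubics (h : GeneralSextic (algebraMap K L ∘ a) θ)
    {f : MvPolynomial (Fin 3) K} (hf : f.IsHomogeneous 3)
    (hv : ∀ i, MvPolynomial.aeval (cuspPoint (θ i)) f = 0) :
    ∃ g : Fin 4 → K, f = ∑ k, g k • basisCubics a k := by
  obtain ⟨c, hc⟩ := hf.eq_sum_of_three_three
  -- The coefficients `g0` to `g3` are chosen to cancel the monomials Y³, XZ², YZ² and Z³, where X,
  -- Y, Z are the variables 0, 1, 2.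
  obtain ⟨g3, hg3⟩ : ∃ g3, g3 = c 9 := ⟨_, rfl⟩
  obtain ⟨g2, hg2⟩ : ∃ g2, g2 = c 8 - (a 1 - a 0 ^ 2) * g3 := ⟨_, rfl⟩
  obtain ⟨g1, hg1⟩ : ∃ g1, g1 = c 7 + a 0 * g2 - (a 0 * a 1 - a 2) * g3 := ⟨_, rfl⟩
  obtain ⟨g0, hg0⟩ : ∃ g0, g0 = - c 3 := ⟨_, rfl⟩
  obtain ⟨d, hd⟩ : ∃ d : Fin 6 → K, d = ![c 0 - a 5 * g1, c 1 + a 4 * g1 - a 5 * g2,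
    c 2 - a 3 * g1 + a 4 * g2 - a 0 * a 5 * g3,
    c 4 - g0 + a 2 * g1 - a 3 * g2 - (a 5 - a 0 * a 4) * g3,
    c 5 - a 1 * g1 + a 2 * g2 - (a 0 * a 3 - a 4) * g3,
    c 6 + a 0 * g1 - a 1 * g2 - (a 3 - a 0 * a 2) * g3] := ⟨_, rfl⟩
  have hrem : f - ∑ k, ![g0, g1, g2, g3] k • basisCubics a k =
      MvPolynomial.C (d 0) * MvPolynomial.X 0 ^ 3
      + MvPolynomial.C (d 1) * MvPolynomial.X 0 ^ 2 * MvPolynomial.X 1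
      + MvPolynomial.C (d 2) * MvPolynomial.X 0 * MvPolynomial.X 1 ^ 2
      + MvPolynomial.C (d 3) * MvPolynomial.X 0 ^ 2 * MvPolynomial.X 2
      + MvPolynomial.C (d 4) * MvPolynomial.X 0 * MvPolynomial.X 1 * MvPolynomial.X 2
      + MvPolynomial.C (d 5) * MvPolynomial.X 1 ^ 2 * MvPolynomial.X 2 := by
    have e9 : c 9 = g3 := hg3.symm
    have e8 : c 8 = g2 + (a 1 - a 0 ^ 2) * g3 := by rw [hg2]; ring
    have e7 : c 7 = g1 - a 0 * g2 + (a 0 * a 1 - a 2) * g3 := by rw [hg1]; ring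
    have e3 : c 3 = - g0 := by rw [hg0]; ring
    rw [hc, hd, e9, e8, e7, e3]
    simp [Fin.sum_univ_four, MvPolynomial.smul_eq_C_mul, basisCubics, cubicMap]
    ring
  -- On (1 : t : t³) the six remaining monomials restrict to 1, t, ..., t⁵. A polynomial of degree
  -- at most 5 with six distinct roots is zero, by the Vandermonde determinant.
  have hdz : (fun i => algebraMap K L (d i)) = 0 := by
    refine Matrix.eq_zero_of_forall_index_sum_mul_pow_eq_zero h.injective fun i => ?_
    have h1 := congrArg (MvPolynomial.aeval (cuspPoint (θ i))) hrem
    rw [map_sub, hv, map_sum] at h1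
    simp only [map_smul, aeval_basisCubics, cubicMap_cuspPoint_eq_zero h, Pi.zero_apply, smul_zero,
      Finset.sum_const_zero, sub_zero] at h1
    simp [cuspPoint] at h1
    simp [Fin.sum_univ_six]
    linear_combination -h1
  have hd0 : ∀ i, d i = 0 := fun i =>
    (algebraMap K L).injective ((congrFun hdz i).trans (map_zero _).symm)
  refine ⟨![g0, g1, g2, g3], sub_eq_zero.mp ?_⟩
  rw [hrem]
  simp [hd0]

theorem mem_cubicsThrough {θ : Fin 6 → L} {f : MvPolynomial (Fin 3) L} :
    f ∈ cubicsThrough θ ↔ f.IsHomogeneous 3 ∧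
      ∀ i, MvPolynomial.aeval (R := L) (cuspPoint (θ i)) f = 0 := by
  simp [cubicsThrough]

/-- Four points with first coordinate 0 already separate the forms; `e 0` appears as the coefficient
of the second form there. -/
theorem linearIndependent_basisCubics [CharZero L] {e : Fin 6 → L} (h0 : e 0 ≠ 0) :
    LinearIndependent L (basisCubics e) := by
  rw [Fintype.linearIndependent_iff]
  intro g hg
  have hu : ∀ u : Fin 3 → L, ∑ k, g k * cubicMap e u k = 0 := by
    intro u
    have := congrArg (MvPolynomial.eval u) hg
    simpa [MvPolynomial.smul_eq_C_mul, eval_basisCubics] using this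
  have h1 := hu ![0, 1, 0]
  have h2 := hu ![0, 0, 1]
  have h3 := hu ![0, 1, 1]
  have h4 := hu ![0, 1, -1]
  simp [Fin.sum_univ_four, cubicMap] at h1 h2 h3 h4
  have g2 : g 2 = 0 := by
    rw [h1, h2] at h3 h4
    linear_combination (h3 + h4) / 2
  have g1 : g 1 = 0 := by
    refine mul_left_cancel₀ h0 ?_
    rw [h1, h2, g2] at h3
    linear_combination -h3
  intro k
  fin_cases k
  exacts [h1, g1, g2, h2]

theorem isRationalBasis_basisCubics [CharZero L] (h : GeneralSextic (algebraMap K L ∘ a) θ) :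
    IsRationalBasis θ (basisCubics a) := by
  refine ⟨?_, le_antisymm ?_ ?_⟩
  · rw [extendScalars_basisCubics]
    exact linearIndependent_basisCubics h.coeff_ne_zero
  · rw [Submodule.span_le, extendScalars_basisCubics]
    rintro _ ⟨j, rfl⟩
    refine mem_cubicsThrough.mpr ⟨isHomogeneous_basisCubics _ j, fun i => ?_⟩
    rw [aeval_basisCubics]
    exact congrFun (cubicMap_cuspPoint_eq_zero h i) j
  · intro f hf
    obtain ⟨hf, hv⟩ := mem_cubicsThrough.mp hf
    obtain ⟨g, rfl⟩ := exists_eq_sum_basisCubics (K := L) (L := L) h hf hv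
    rw [extendScalars_basisCubics]
    exact Submodule.sum_mem _ fun k _ =>
      Submodule.smul_mem _ _ (Submodule.subset_span ⟨k, rfl⟩)

/-- The reduction to the explicit basis works over `K`, since the forms have coefficients in `K`.
The transition matrix is invertible because a left kernel vector would be a linear relation. -/
theorem IsRationalBasis.exists_matrix [CharZero L]
    (h : GeneralSextic (algebraMap K L ∘ a) θ) {f : Fin 4 → MvPolynomial (Fin 3) K}
    (hf : IsRationalBasis θ f) : ∃ G H : Matrix (Fin 4) (Fin 4) K, G * H = 1 ∧ H * G = 1 ∧
      ∀ u : Fin 3 → L, (fun j => MvPolynomial.eval u (extendScalars L f j)) =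
        G.map (algebraMap K L) *ᵥ cubicMap (algebraMap K L ∘ a) u := by
  have hG : ∀ j, ∃ g : Fin 4 → K, f j = ∑ k, g k • basisCubics a k := by
    intro j
    have hj : extendScalars L f j ∈ cubicsThrough θ := by
      rw [← hf.span_eq]
      exact Submodule.subset_span ⟨j, rfl⟩
    obtain ⟨h1, h2⟩ := mem_cubicsThrough.mp hj
    refine exists_eq_sum_basisCubics h (h1.of_map (algebraMap K L).injective) fun i => ?_
    have := h2 i
    rwa [extendScalars, MvPolynomial.aeval_map_algebraMap] at this
  choose G hG using hG
  have hdet : (Matrix.of G).det ≠ 0 := by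
    intro hdet
    obtain ⟨x, hx0, hx⟩ := Matrix.exists_vecMul_eq_zero_iff.mpr hdet
    have hsum : ∑ j, x j • f j = 0 := by
      simp only [hG, Finset.smul_sum, smul_smul]
      rw [Finset.sum_comm]
      refine Finset.sum_eq_zero fun k _ => ?_
      rw [← Finset.sum_smul]
      have := congrFun hx k
      simp only [Matrix.vecMul, dotProduct, Matrix.of_apply, Pi.zero_apply] at this
      rw [this, zero_smul]
    have hli := Fintype.linearIndependent_iff.mp hf.linearIndependent
      (fun j => algebraMap K L (x j)) (by
        have := congrArg (MvPolynomial.map (algebraMap K L)) hsum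
        simpa only [MvPolynomial.smul_eq_C_mul, map_sum, map_mul, MvPolynomial.map_C, extendScalars,
          map_zero] using this)
    refine hx0 (funext fun j => (algebraMap K L).injective ?_)
    rw [hli j, Pi.zero_apply, map_zero]
  refine ⟨Matrix.of G, (Matrix.of G)⁻¹, Matrix.mul_nonsing_inv _ hdet.isUnit,
    Matrix.nonsing_inv_mul _ hdet.isUnit, fun u => ?_⟩
  ext j
  rw [extendScalars, hG, MvPolynomial.eval_map, ← MvPolynomial.aeval_def, map_sum]
  simp only [Matrix.mulVec, dotProduct]
  refine Finset.sum_congr rfl fun k _ => ?_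
  rw [map_smul, aeval_basisCubics, Algebra.smul_def, Matrix.map_apply, Matrix.of_apply]

end Basis

/-! ### Rational lines on the surface correspond to Galois stable index sets. -/

section RationalLines

variable {K L : Type*} [Field K] [Field L] [Algebra K L] {a : Fin 6 → K} {θ : Fin 6 → L}

theorem IsRationalSubspace.map {W : Submodule L (Fin 4 → L)} (hW : IsRationalSubspace K W)
    (M : Matrix (Fin 4) (Fin 4) K) :
    IsRationalSubspace K (W.map (M.map (algebraMap K L)).mulVecLin) := by
  obtain ⟨W₀, rfl⟩ := hW
  refine ⟨W₀.map M.mulVecLin, ?_⟩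
  rw [Submodule.map_span, Submodule.map_coe, Set.image_image, Set.image_image]
  congr 2
  ext w j
  simp [Matrix.mulVec, dotProduct]

/-- The coordinate change `H` carries the surface to the determinantal one and preserves rationality
since its entries lie in `K`; incidence then gives the bijection. -/
theorem encard_rationalLines_blowUpSurface [IsAlgClosed L] [CharZero L] [IsGalois K L]
    (h : GeneralSextic (algebraMap K L ∘ a) θ) {G H : Matrix (Fin 4) (Fin 4) K}
    (hGH : G.map (algebraMap K L) * H.map (algebraMap K L) = 1)
    (hHG : H.map (algebraMap K L) * G.map (algebraMap K L) = 1)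
    {f : Fin 4 → MvPolynomial (Fin 3) L}
    (hf : ∀ u, (fun j => MvPolynomial.eval u (f j)) =
      G.map (algebraMap K L) *ᵥ cubicMap (algebraMap K L ∘ a) u) :
    (rationalLines K (blowUpSurface f)).encard =
      {I : Set (Fin 6) | (I.ncard = 1 ∨ I.ncard = 2 ∨ I.ncard = 5) ∧
        IsGaloisStable K θ I}.encard := by
  let q : (Fin 4 → L) →ₗ[L] (Fin 4 → L) := (H.map (algebraMap K L)).mulVecLin
  let r : (Fin 4 → L) →ₗ[L] (Fin 4 → L) := (G.map (algebraMap K L)).mulVecLin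
  have hqr : q.comp r = LinearMap.id := by
    rw [← Matrix.mulVecLin_mul, hHG, Matrix.mulVecLin_one]
  have hrq : r.comp q = LinearMap.id := by
    rw [← Matrix.mulVecLin_mul, hGH, Matrix.mulVecLin_one]
  have hqr' : ∀ W : Submodule L (Fin 4 → L), (W.map r).map q = W := by
    intro W
    rw [← Submodule.map_comp, hqr, Submodule.map_id]
  have hrq' : ∀ W : Submodule L (Fin 4 → L), (W.map q).map r = W := by
    intro W
    rw [← Submodule.map_comp, hrq, Submodule.map_id]
  have hqinj : Function.Injective q := Function.LeftInverse.injective (g := r)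
    fun x => LinearMap.congr_fun hrq x
  have hmem : ∀ W, W ∈ rationalLines K (blowUpSurface f) ↔
      IsSurfaceLine (algebraMap K L ∘ a) (W.map q) ∧ IsRationalSubspace K (W.map q) := by
    intro W
    have h1 : Module.finrank L (W.map q) = Module.finrank L W :=
      (Submodule.equivMapOfInjective q hqinj W).finrank_eq.symm
    have h2 : (∀ (v : Fin 4 → L) (hv : v ≠ 0), v ∈ W →
        Projectivization.mk L v hv ∈ blowUpSurface f) ↔
        ∀ v ∈ W.map q, (syzMatrix (algebraMap K L ∘ a) v).det = 0 := by
      constructor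
      · rintro hW _ ⟨v, hv, rfl⟩
        by_cases hv0 : v = 0
        · rw [hv0, map_zero, syzMatrix_zero, Matrix.det_zero]
        · exact (mk_mem_blowUpSurface_iff h hGH hHG hf).mp (hW v hv0 hv)
      · intro hW v hv0 hv
        exact (mk_mem_blowUpSurface_iff h hGH hHG hf).mpr (hW _ ⟨v, hv, rfl⟩)
    have h3 : IsRationalSubspace K W ↔ IsRationalSubspace K (W.map q) := by
      refine ⟨fun hW => hW.map H, fun hW => ?_⟩
      rw [← hrq' W]
      exact hW.map G
    rw [IsSurfaceLine, h1, ← h2, ← h3, and_assoc]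
    rfl
  have himage : (fun W => incidence (algebraMap K L ∘ a) θ (W.map q)) ''
      rationalLines K (blowUpSurface f) =
      {I : Set (Fin 6) | (I.ncard = 1 ∨ I.ncard = 2 ∨ I.ncard = 5) ∧ IsGaloisStable K θ I} := by
    ext I
    constructor
    · rintro ⟨W, hW, rfl⟩
      obtain ⟨h1, h2⟩ := (hmem W).mp hW
      exact ⟨ncard_incidence h h1, (isRationalSubspace_iff h h1).mp h2⟩
    · rintro ⟨hI, hs⟩
      obtain ⟨W, hW, rfl⟩ := exists_incidence_eq h hI
      refine ⟨W.map r, (hmem _).mpr ?_, ?_⟩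
      · rw [hqr']
        exact ⟨hW, (isRationalSubspace_iff h hW).mpr hs⟩
      · simp only [hqr']
  rw [← himage, Set.InjOn.encard_image]
  intro W hW W' hW' heq
  have := incidence_injOn h ((hmem W).mp hW).1 ((hmem W').mp hW').1 heq
  rw [← hrq' W, this, hrq']

end RationalLines

/-! ### Counting Galois stable index sets by irreducible factors. -/

section Counting

variable {K L : Type*} [Field K] [Field L] [Algebra K L] {θ : Fin 6 → L}

theorem IsGaloisStable.compl {I : Set (Fin 6)} (hI : IsGaloisStable K θ I) :
    IsGaloisStable K θ Iᶜ := by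
  intro σ i j hij hi hj
  exact hi (hI σ.symm j i (by rw [← hij]; simp) hj)

theorem encard_stable_five :
    {I : Set (Fin 6) | I.ncard = 5 ∧ IsGaloisStable K θ I}.encard =
      {I : Set (Fin 6) | I.ncard = 1 ∧ IsGaloisStable K θ I}.encard := by
  have : {I : Set (Fin 6) | I.ncard = 5 ∧ IsGaloisStable K θ I} =
      compl '' {I : Set (Fin 6) | I.ncard = 1 ∧ IsGaloisStable K θ I} := by
    ext I
    have hcard := Set.ncard_add_ncard_compl I
    rw [Nat.card_eq_fintype_card, Fintype.card_fin] at hcard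
    constructor
    · rintro ⟨hI, hs⟩
      exact ⟨Iᶜ, ⟨by omega, hs.compl⟩, compl_compl I⟩
    · rintro ⟨J, ⟨hJ, hs⟩, rfl⟩
      rw [compl_compl] at hcard
      exact ⟨by omega, hs.compl⟩
  rw [this, compl_injective.injOn.encard_image]

/-- The indices of the roots of `Q` among the `θ i`. -/
def rootIndices (θ : Fin 6 → L) (Q : K[X]) : Set (Fin 6) := {i | aeval (θ i) Q = 0}

theorem isGaloisStable_rootIndices (Q : K[X]) : IsGaloisStable K θ (rootIndices θ Q) := by
  intro σ i j hij hi
  rw [rootIndices, Set.mem_ofPred_eq] at hi ⊢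
  rw [← hij, aeval_algEquiv, AlgHom.comp_apply, hi]
  simp

variable {F : K[X]}

theorem ncard_rootIndices [IsAlgClosed L] [CharZero K] (hinj : Function.Injective θ)
    (hF : ∀ t : L, aeval t F = 0 ↔ ∃ i, θ i = t) {Q : K[X]} (hQ : Irreducible Q) (hd : Q ∣ F) :
    (rootIndices θ Q).ncard = Q.natDegree := by
  have himage : Q.rootSet L = θ '' rootIndices θ Q := by
    ext t
    rw [mem_rootSet_of_ne hQ.ne_zero]
    constructor
    · intro ht
      obtain ⟨i, rfl⟩ := (hF t).mp (aeval_eq_zero_of_dvd_aeval_eq_zero hd ht)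
      exact ⟨i, ht, rfl⟩
    · rintro ⟨i, hi, rfl⟩
      exact hi
  rw [← Set.ncard_image_of_injective _ hinj, ← himage,
    ← card_rootSet_eq_natDegree hQ.separable (IsAlgClosed.splits (Q.map (algebraMap K L))),
    ← Nat.card_eq_fintype_card, Nat.card_coe_set_eq]

/-- The monic irreducible factors of `F` of degree `d`. -/
def monicFactors (F : K[X]) (d : ℕ) : Set K[X] :=
  {Q | Irreducible Q ∧ Q.Monic ∧ Q ∣ F ∧ Q.natDegree = d}

/-- Since `F` is squarefree, counting with multiplicity is counting distinct monic factors. -/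
theorem encard_monicFactors (h0 : F ≠ 0) (hsq : Squarefree F) (d : ℕ) :
    (monicFactors F d).encard = numIrreducibleFactors F d := by
  classical
  have hnd : (UniqueFactorizationMonoid.normalizedFactors F).Nodup :=
    (UniqueFactorizationMonoid.squarefree_iff_nodup_normalizedFactors h0).mp hsq
  have : monicFactors F d =
      (((UniqueFactorizationMonoid.normalizedFactors F).filter
        fun P => P.natDegree = d).toFinset : Set K[X]) := by
    ext Q
    rw [Finset.mem_coe, Multiset.mem_toFinset, Multiset.mem_filter,
      Polynomial.mem_normalizedFactors_iff h0]
    simp only [monicFactors, Set.mem_ofPred_eq]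
    tauto
  rw [this, Set.encard_coe_eq_coe_finsetCard,
    Multiset.toFinset_card_of_nodup (hnd.filter _), numIrreducibleFactors]

theorem minpoly_mem_monicFactors [IsAlgClosed L] [Algebra.IsAlgebraic K L]
    (hF : ∀ t : L, aeval t F = 0 ↔ ∃ i, θ i = t) (i : Fin 6) :
    minpoly K (θ i) ∈ monicFactors F (minpoly K (θ i)).natDegree := by
  have hint : IsIntegral K (θ i) := Algebra.IsIntegral.isIntegral _
  exact ⟨minpoly.irreducible hint, minpoly.monic hint, minpoly.dvd K _ ((hF _).mpr ⟨i, rfl⟩), rfl⟩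

theorem eq_minpoly_of_mem_rootIndices {d : ℕ} {Q : K[X]} (hQ : Q ∈ monicFactors F d) {i : Fin 6}
    (hi : i ∈ rootIndices θ Q) : Q = minpoly K (θ i) :=
  minpoly.eq_of_irreducible_of_monic hQ.1 hi hQ.2.1

theorem rootIndices_injOn [IsAlgClosed L] [CharZero K] (hinj : Function.Injective θ)
    (hF : ∀ t : L, aeval t F = 0 ↔ ∃ i, θ i = t) (d : ℕ) :
    Set.InjOn (rootIndices θ) (monicFactors F d) := by
  intro Q hQ Q' hQ' heq
  have hne : (rootIndices θ Q).Nonempty := by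
    rw [← Set.ncard_pos, ncard_rootIndices hinj hF hQ.1 hQ.2.2.1]
    exact hQ.1.natDegree_pos
  obtain ⟨i, hi⟩ := hne
  rw [eq_minpoly_of_mem_rootIndices hQ hi, eq_minpoly_of_mem_rootIndices hQ' (heq ▸ hi)]

/-- The minimal set of Galois stable indices which contains `i`. -/
theorem rootIndices_minpoly_subset [Normal K L] {I : Set (Fin 6)} (hI : IsGaloisStable K θ I)
    {i : Fin 6} (hi : i ∈ I) : rootIndices θ (minpoly K (θ i)) ⊆ I := by
  intro j hj
  have hint : IsIntegral K (θ i) := Algebra.IsIntegral.isIntegral _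
  have hm : minpoly K (θ i) = minpoly K (θ j) :=
    minpoly.eq_of_irreducible_of_monic (minpoly.irreducible hint) hj (minpoly.monic hint)
  obtain ⟨σ, hσ⟩ := (Normal.minpoly_eq_iff_mem_orbit (E := L)).mp hm.symm
  exact hI σ i j hσ hi

theorem mem_rootIndices_minpoly (i : Fin 6) : i ∈ rootIndices θ (minpoly K (θ i)) :=
  minpoly.aeval K (θ i)

/-- A stable singleton is a full Galois orbit, so the minimal polynomial of that root has degree 1.
-/
theorem image_rootIndices_one [IsAlgClosed L] [CharZero K] [Normal K L]
    (hinj : Function.Injective θ) (hF : ∀ t : L, aeval t F = 0 ↔ ∃ i, θ i = t) :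
    rootIndices θ '' monicFactors F 1 = {I | I.ncard = 1 ∧ IsGaloisStable K θ I} := by
  ext I
  constructor
  · rintro ⟨Q, hQ, rfl⟩
    exact ⟨(ncard_rootIndices hinj hF hQ.1 hQ.2.2.1).trans hQ.2.2.2,
      isGaloisStable_rootIndices Q⟩
  · rintro ⟨hI, hs⟩
    obtain ⟨i, rfl⟩ := Set.ncard_eq_one.mp hI
    have hmem := minpoly_mem_monicFactors hF i
    have heq : rootIndices θ (minpoly K (θ i)) = {i} :=
      Set.Subset.antisymm (rootIndices_minpoly_subset hs rfl)
        (Set.singleton_subset_iff.mpr (mem_rootIndices_minpoly i))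
    have hd : (minpoly K (θ i)).natDegree = 1 := by
      rw [← ncard_rootIndices hinj hF hmem.1 hmem.2.2.1, heq, Set.ncard_singleton]
    exact ⟨_, hd ▸ hmem, heq⟩

/-- The indices of the roots in the base field. -/
def rationalIndices (K : Type*) {L : Type*} [Field K] [Field L] [Algebra K L] (θ : Fin 6 → L) :
    Set (Fin 6) :=
  {i | IsGaloisStable K θ {i}}

theorem encard_rationalIndices :
    (rationalIndices K θ).encard =
      {I : Set (Fin 6) | I.ncard = 1 ∧ IsGaloisStable K θ I}.encard := by
  have : {I : Set (Fin 6) | I.ncard = 1 ∧ IsGaloisStable K θ I} =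
      (fun i => {i}) '' rationalIndices K θ := by
    ext I
    constructor
    · rintro ⟨hI, hs⟩
      obtain ⟨i, rfl⟩ := Set.ncard_eq_one.mp hI
      exact ⟨i, hs, rfl⟩
    · rintro ⟨i, hi, rfl⟩
      exact ⟨Set.ncard_singleton i, hi⟩
  rw [this, Set.singleton_injective.injOn.encard_image]

theorem encard_powersetCard_two {α : Type*} [Finite α] (R : Set α) :
    {I : Set α | I.ncard = 2 ∧ I ⊆ R}.encard = (R.ncard.choose 2 : ℕ) := by
  classical
  have hR : R.Finite := R.toFinite
  have : {I : Set α | I.ncard = 2 ∧ I ⊆ R} =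
      (fun s : Finset α => (s : Set α)) '' (Finset.powersetCard 2 hR.toFinset : Set (Finset α)) := by
    ext I
    constructor
    · rintro ⟨hI, hs⟩
      refine ⟨I.toFinite.toFinset, ?_, by simp⟩
      rw [Finset.mem_coe, Finset.mem_powersetCard, ← Set.ncard_eq_toFinset_card]
      exact ⟨by simpa using hs, hI⟩
    · rintro ⟨s, hs, rfl⟩
      rw [Finset.mem_coe, Finset.mem_powersetCard] at hs
      refine ⟨by rw [Set.ncard_coe_finset, hs.2], fun x hx => ?_⟩
      simpa using hs.1 hx
  rw [this, Finset.coe_injective.injOn.encard_image, Set.encard_coe_eq_coe_finsetCard,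
    Finset.card_powersetCard, ← Set.ncard_eq_toFinset_card]

/-- A stable pair is a single orbit, given by a quadratic factor, or a union of two orbits of size
one. -/
theorem stable_two_eq [IsAlgClosed L] [CharZero K] [Normal K L]
    (hinj : Function.Injective θ) (hF : ∀ t : L, aeval t F = 0 ↔ ∃ i, θ i = t) :
    {I | I.ncard = 2 ∧ IsGaloisStable K θ I} =
      rootIndices θ '' monicFactors F 2 ∪ {I | I.ncard = 2 ∧ I ⊆ rationalIndices K θ} := by
  ext I
  constructor
  · rintro ⟨hI, hs⟩
    by_cases hsub : I ⊆ rationalIndices K θ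
    · exact Or.inr ⟨hI, hsub⟩
    left
    obtain ⟨i, hi, hir⟩ := Set.not_subset.mp hsub
    have hmem := minpoly_mem_monicFactors hF i
    have hcard := ncard_rootIndices hinj hF hmem.1 hmem.2.2.1
    have heq : rootIndices θ (minpoly K (θ i)) = I := by
      refine Set.eq_of_subset_of_ncard_le (rootIndices_minpoly_subset hs hi) ?_
      -- An orbit smaller than the pair would be a singleton, making `i` a rational index.
      by_contra! hlt
      have h1 : (rootIndices θ (minpoly K (θ i))).ncard = 1 := by
        have := hmem.1.natDegree_pos
        omega
      obtain ⟨j, hj⟩ := Set.ncard_eq_one.mp h1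
      have hij : i = j := by
        have := mem_rootIndices_minpoly (K := K) (θ := θ) i
        rwa [hj] at this
      subst hij
      exact hir (by
        rw [rationalIndices, Set.mem_ofPred_eq, ← hj]
        exact isGaloisStable_rootIndices _)
    rw [heq, hI] at hcard
    exact ⟨_, hcard ▸ hmem, heq⟩
  · rintro (⟨Q, hQ, rfl⟩ | ⟨hI, hsub⟩)
    · exact ⟨(ncard_rootIndices hinj hF hQ.1 hQ.2.2.1).trans hQ.2.2.2,
        isGaloisStable_rootIndices Q⟩
    · refine ⟨hI, fun σ i j hij hi => ?_⟩
      have := hsub hi σ i j hij rfl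
      rw [Set.mem_singleton_iff] at this
      rwa [this]

theorem disjoint_stable_two [Normal K L] :
    Disjoint (rootIndices θ '' monicFactors F 2)
      {I | I.ncard = 2 ∧ I ⊆ rationalIndices K θ} := by
  rw [Set.disjoint_left]
  rintro _ ⟨Q, hQ, rfl⟩ ⟨hI, hsub⟩
  obtain ⟨i, hi⟩ : (rootIndices θ Q).Nonempty := by
    rw [← Set.ncard_pos, hI]
    exact two_pos
  have hle := rootIndices_minpoly_subset (hsub hi) (Set.mem_singleton i)
  rw [← eq_minpoly_of_mem_rootIndices hQ hi] at hle
  have := Set.ncard_le_ncard hle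
  rw [hI, Set.ncard_singleton] at this
  omega

/-- With ℓ linear and q quadratic factors, sizes 1, 2 and 5 contribute ℓ, q + C(ℓ, 2) and ℓ. -/
theorem encard_stable [IsAlgClosed L] [CharZero K] [Normal K L]
    (hinj : Function.Injective θ) (hF : ∀ t : L, aeval t F = 0 ↔ ∃ i, θ i = t)
    (h0 : F ≠ 0) (hsq : Squarefree F) :
    {I : Set (Fin 6) | (I.ncard = 1 ∨ I.ncard = 2 ∨ I.ncard = 5) ∧
        IsGaloisStable K θ I}.encard =
      ((2 * numIrreducibleFactors F 1 + numIrreducibleFactors F 2 +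
        (numIrreducibleFactors F 1).choose 2 : ℕ) : ℕ∞) := by
  have hone : {I : Set (Fin 6) | I.ncard = 1 ∧ IsGaloisStable K θ I}.encard =
      numIrreducibleFactors F 1 := by
    rw [← image_rootIndices_one hinj hF, (rootIndices_injOn hinj hF 1).encard_image,
      encard_monicFactors h0 hsq]
  have hR : (rationalIndices K θ).ncard = numIrreducibleFactors F 1 := by
    rw [Set.ncard_def, encard_rationalIndices, hone, ENat.toNat_natCast]
  have htwo : {I : Set (Fin 6) | I.ncard = 2 ∧ IsGaloisStable K θ I}.encard =
      numIrreducibleFactors F 2 + ((numIrreducibleFactors F 1).choose 2 : ℕ) := by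
    rw [stable_two_eq hinj hF, Set.encard_union_eq disjoint_stable_two,
      (rootIndices_injOn hinj hF 2).encard_image, encard_monicFactors h0 hsq,
      encard_powersetCard_two, hR]
  have hsplit : {I : Set (Fin 6) | (I.ncard = 1 ∨ I.ncard = 2 ∨ I.ncard = 5) ∧
      IsGaloisStable K θ I} = {I | I.ncard = 1 ∧ IsGaloisStable K θ I} ∪
        ({I | I.ncard = 2 ∧ IsGaloisStable K θ I} ∪
          {I | I.ncard = 5 ∧ IsGaloisStable K θ I}) := by
    ext I
    simp only [Set.mem_ofPred_eq, Set.mem_union]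
    tauto
  rw [hsplit, Set.encard_union_eq, Set.encard_union_eq, encard_stable_five, hone, htwo]
  · push_cast
    ring
  · rw [Set.disjoint_left]
    rintro I ⟨h2, -⟩ ⟨h5, -⟩
    omega
  · rw [Set.disjoint_left]
    rintro I ⟨h1, -⟩ (⟨h2, -⟩ | ⟨h5, -⟩) <;> omega

end Counting

/-! ### From the hyperplane arrangement to the general sextic. -/

section Main

variable {K L : Type*} [Field K] [Field L] [Algebra K L] {θ : Fin 6 → L}

theorem AvoidsE6.injective (h : AvoidsE6 θ) : Function.Injective θ := by
  intro i j hij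
  by_contra hne
  rcases lt_or_gt_of_ne hne with hlt | hlt
  · exact h.sub_ne_zero i j hlt (sub_eq_zero.mpr hij)
  · exact h.sub_ne_zero j i hlt (sub_eq_zero.mpr hij.symm)

theorem AvoidsE6.add_add_ne_zero_of_ne (h : AvoidsE6 θ) (i j k : Fin 6) (hij : i ≠ j)
    (hjk : j ≠ k) (hik : i ≠ k) : θ i + θ j + θ k ≠ 0 := by
  intro hsum
  rcases lt_or_gt_of_ne hij with h1 | h1 <;> rcases lt_or_gt_of_ne hjk with h2 | h2 <;>
    rcases lt_or_gt_of_ne hik with h3 | h3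
  · exact h.add_add_ne_zero i j k h1 h2 hsum
  · exact absurd (h1.trans h2) h3.not_gt
  · exact h.add_add_ne_zero i k j h3 h2 (by linear_combination hsum)
  · exact h.add_add_ne_zero k i j h3 h1 (by linear_combination hsum)
  · exact h.add_add_ne_zero j i k h1 h3 (by linear_combination hsum)
  · exact h.add_add_ne_zero j k i h2 h3 (by linear_combination hsum)
  · exact absurd (h2.trans h1) h3.not_gt
  · exact h.add_add_ne_zero k j i h2 h1 (by linear_combination hsum)

/-- The signed coefficients of a monic sextic. -/
noncomputable def signedCoeffs (P : K[X]) : Fin 6 → K :=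
  ![-P.coeff 5, P.coeff 4, -P.coeff 3, P.coeff 2, -P.coeff 1, P.coeff 0]

theorem eq_of_signedCoeffs {P : K[X]} (hP : P.Monic) (hdeg : P.natDegree = 6) :
    P = X ^ 6 + C (P.coeff 5) * X ^ 5 + C (P.coeff 4) * X ^ 4 + C (P.coeff 3) * X ^ 3
      + C (P.coeff 2) * X ^ 2 + C (P.coeff 1) * X + C (P.coeff 0) := by
  have h6 : P.coeff 6 = 1 := hdeg ▸ hP.coeff_natDegree
  conv_lhs => rw [P.as_sum_range_C_mul_X_pow, hdeg]
  simp only [Finset.sum_range_succ, Finset.sum_range_zero, h6, C_1]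
  ring

theorem sextic_signedCoeffs {P : K[X]} (hP : P.Monic) (hdeg : P.natDegree = 6) (t : L) :
    sextic (algebraMap K L ∘ signedCoeffs P) t = aeval t P := by
  conv_rhs => rw [eq_of_signedCoeffs hP hdeg]
  simp [sextic, signedCoeffs]

theorem sexticDeriv_signedCoeffs {P : K[X]} (hP : P.Monic) (hdeg : P.natDegree = 6) (t : L) :
    sexticDeriv (algebraMap K L ∘ signedCoeffs P) t = aeval t (derivative P) := by
  conv_rhs => rw [eq_of_signedCoeffs hP hdeg]
  have h2 : algebraMap K L 2 = 2 := map_ofNat _ 2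
  have h3 : algebraMap K L 3 = 3 := map_ofNat _ 3
  have h4 : algebraMap K L 4 = 4 := map_ofNat _ 4
  have h5 : algebraMap K L 5 = 5 := map_ofNat _ 5
  simp [sexticDeriv, signedCoeffs, h2, h3, h4, h5]
  ring

/-- Distinct roots make `P` separable, whence the nonzero derivatives; the leading signed
coefficient is the sum of the roots by Vieta. -/
theorem generalSextic_signedCoeffs {P : K[X]} (hP : P.Monic) (hdeg : P.natDegree = 6)
    (hprod : P.map (algebraMap K L) = ∏ i, (X - C (θ i))) (hE6 : AvoidsE6 θ) :
    GeneralSextic (algebraMap K L ∘ signedCoeffs P) θ := by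
  refine ⟨hE6.injective, fun t => ?_, fun i => ?_, hE6.add_add_ne_zero_of_ne, ?_⟩
  · rw [sextic_signedCoeffs hP hdeg, ← eval_map_algebraMap, hprod, eval_prod,
      Finset.prod_eq_zero_iff]
    simp [sub_eq_zero, eq_comm]
  · have hsep : P.Separable := by
      rw [← separable_map (algebraMap K L), hprod, separable_prod_X_sub_C_iff]
      exact hE6.injective
    rw [sexticDeriv_signedCoeffs hP hdeg]
    refine hsep.aeval_derivative_ne_zero ?_
    rw [← eval_map_algebraMap, hprod, eval_prod]
    exact Finset.prod_eq_zero (Finset.mem_univ i) (by simp)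
  · have h5 := prod_X_sub_C_coeff_card_pred (Finset.univ : Finset (Fin 6)) θ (by simp)
    rw [← hprod, Finset.card_univ, Fintype.card_fin, coeff_map] at h5
    have : (algebraMap K L ∘ signedCoeffs P) 0 = ∑ i, θ i := by
      simp [signedCoeffs, h5]
    rw [this]
    exact hE6.sum_ne_zero

end Main

theorem lemma2 (p : ℕ) [Fact p.Prime] (F : ℚ_[p][X]) (hdeg : F.natDegree = 6)
    (θ : Fin 6 → AlgebraicClosure ℚ_[p])
    (hθ : F.map (algebraMap ℚ_[p] (AlgebraicClosure ℚ_[p])) =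
      C (algebraMap ℚ_[p] (AlgebraicClosure ℚ_[p]) F.leadingCoeff) * ∏ i, (X - C (θ i)))
    (hE6 : AvoidsE6 θ) :
    (∃ f : Fin 4 → MvPolynomial (Fin 3) ℚ_[p], IsRationalBasis θ f) ∧
    ∀ f : Fin 4 → MvPolynomial (Fin 3) ℚ_[p], IsRationalBasis θ f →
      Set.InjOn Prod.snd (blowUp (extendScalars (AlgebraicClosure ℚ_[p]) f)) ∧
      IsSmoothCubicSurfaceOver ℚ_[p]
        (blowUpSurface (extendScalars (AlgebraicClosure ℚ_[p]) f)) ∧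
      (rationalLines ℚ_[p] (blowUpSurface (extendScalars (AlgebraicClosure ℚ_[p]) f))).encard =
        ((2 * numIrreducibleFactors F 1 + numIrreducibleFactors F 2 +
          (numIrreducibleFactors F 1).choose 2 : ℕ) : ℕ∞) := by
  have hF0 : F ≠ 0 := by
    rintro rfl
    simp at hdeg
  have hlc : F.leadingCoeff ≠ 0 := leadingCoeff_ne_zero.mpr hF0
  -- The explicit formulas need a monic sextic; the scaling changes neither the roots nor the field
  -- of coefficients.
  have hP : (F * C F.leadingCoeff⁻¹).Monic := monic_mul_leadingCoeff_inv hF0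
  have hPdeg : (F * C F.leadingCoeff⁻¹).natDegree = 6 := by
    rw [natDegree_mul_C (inv_ne_zero hlc), hdeg]
  have hprod : (F * C F.leadingCoeff⁻¹).map (algebraMap ℚ_[p] (AlgebraicClosure ℚ_[p])) =
      ∏ i, (X - C (θ i)) := by
    rw [Polynomial.map_mul, hθ, map_C, mul_right_comm, ← C_mul, ← map_mul, mul_inv_cancel₀ hlc,
      map_one, C_1, one_mul]
  have h := generalSextic_signedCoeffs hP hPdeg hprod hE6
  have hroots : ∀ t : AlgebraicClosure ℚ_[p], aeval t F = 0 ↔ ∃ i, θ i = t := by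
    intro t
    rw [← h.sextic_eq_zero_iff, sextic_signedCoeffs hP hPdeg, map_mul, aeval_C, mul_eq_zero]
    simp [hF0]
  have hsq : Squarefree F := by
    refine Separable.squarefree ?_
    rw [← separable_map (algebraMap ℚ_[p] (AlgebraicClosure ℚ_[p])), hθ]
    exact ((separable_prod_X_sub_C_iff).mpr hE6.injective).unit_mul
      (isUnit_C.mpr (isUnit_iff_ne_zero.mpr (by simpa using hF0)))
  refine ⟨⟨_, isRationalBasis_basisCubics h⟩, fun f hf => ?_⟩
  obtain ⟨G, H, hGH, hHG, hfG⟩ := hf.exists_matrix h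
  have hGH' : G.map (algebraMap ℚ_[p] (AlgebraicClosure ℚ_[p])) *
      H.map (algebraMap ℚ_[p] (AlgebraicClosure ℚ_[p])) = 1 := by
    rw [← Matrix.map_mul, hGH]
    simp
  have hHG' : H.map (algebraMap ℚ_[p] (AlgebraicClosure ℚ_[p])) *
      G.map (algebraMap ℚ_[p] (AlgebraicClosure ℚ_[p])) = 1 := by
    rw [← Matrix.map_mul, hHG]
    simp
  refine ⟨injOn_snd_blowUp h hGH' hHG' hfG,
    isSmoothCubicSurfaceOver_blowUpSurface h hGH' hHG' hfG, ?_⟩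
  rw [encard_rationalLines_blowUpSurface h hGH' hHG' hfG]
  exact encard_stable h.injective hroots hF0 hsq
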